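/- Let $k\ge 1$, $n\ge 0$, and let $\alpha$ be an action of $\mathbb Z^k$ on the torus $\mathbb T^n=\mathbb R^n/\mathbb Z^n$ by affine maps $\alpha(z)x=A_zx+b_z$ with $A_z\in GL(n,\mathbb Z)$, $b_z\in\mathbb T^n$, considered with Lebesgue measure $\lambda$. *Slow entropy.* For a finite measurable partition $\xi$ of $\mathbb T^n$ and a finite nonempty set $F\subset\mathbb Z^k$ let $d_F^\xi(x,y)$ be the proportion of $z\in F$ for which $\alpha(z)x$ and $\alpha(z)y$ lie in different elements of $\xi$, and let $S^H_\xi(\alpha,F,\epsilon,\delta)$ be the minimal number of $d^\xi_F$-balls of radius $\epsilon$ whose union has measure at least $1-\delta$. For a norm $p$ on $\mathbb R^k$ put $F^p_s=\{z\in\mathbb Z^k: p(z)\le s\}$ and $$sh(p,\alpha)=\sup_\xi\ \lim_{\epsilon,\delta\to0}\ \limsup_{s\to\infty}\frac1s\log S^H_\xi(\alpha,F^p_s,\epsilon,\delta),\qquad sh(\alpha)=\inf_{p}\,sh(p,\alpha),$$ the infimum being over all norms $p$ on $\mathbb R^k$ whose unit ball has volume $1$. *Lyapunov hyperplanes.*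 A linear functional $\chi:\mathbb R^k\to\mathbb R$ is a Lyapunov exponent of $\alpha$ if there is $v\in\mathbb R^n\setminus\{0\}$ with $\lim_{m\to\infty}\frac1m\log\|A_z^mv\|=\chi(z)$ for all $z\in\mathbb Z^k$. The Lyapunov hyperplanes are the kernels of the Lyapunov exponents (a zero exponent imposes no condition; an empty intersection is $\mathbb R^k$). *Entropy function and Fried average entropy.* The suspension of $\alpha$ is the action of $\mathbb R^k$ induced by $(s,x)\mapsto(s+t,x)$ on $(\mathbb R^k\times\mathbb T^n)/\mathbb Z^k$, where $(s,x)\sim(s-z,\alpha(z)x)$ for $z\in\mathbb Z^k$, with the probability measure induced by Lebesgue measure. The entropy function $h^\alpha:\mathbb R^k\to[0,\infty]$ assigns to $t$ the Kolmogorov–Sinai entropy of the element $t$ of the suspension. The Fried average entropy is $h^*(\alpha)=\dfrac{2^k}{k!\,\mathrm{vol}\{t\in\mathbb R^k: h^\alpha(t)\le1\}}$, which is $0$ if that volume is infinite. Then the following are equivalent: (1) $sh(\alpha)=0$; (2) the intersection of all Lyapunov hyperplanes contains a nonzero vector of $\mathbb R^k$; (3) the entropy function $h^\alpha$ is not a norm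 on $\mathbb R^k$; (4) $h^*(\alpha)=0$. -/

import Mathlib

open Filter Topology MeasureTheory
open scoped ENNReal

noncomputable section

/-! ### Measure-theoretic entropy of a transformation -/

/-- Shannon entropy of the partition generated by `ξ, ξ ∘ T, …, ξ ∘ T^(m-1)`, where a finite
measurable partition is given by its labelling function `ξ : X → Fin N`. -/
def iteratedPartitionEntropy {X : Type*} [MeasurableSpace X] (μ : Measure X) (T : X → X)
    {N : ℕ} (ξ : X → Fin N) (m : ℕ) : ℝ :=
  ∑ w : Fin m → Fin N, Real.negMulLog (μ.real {x | ∀ i : Fin m, ξ (T^[i] x) = w i})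

/-- Kolmogorov–Sinai entropy `h_μ(T)`: the supremum over finite measurable partitions of the
exponential rate of the iterated partitions. -/
def ksEntropy {X : Type*} [MeasurableSpace X] (μ : Measure X) (T : X → X) : ℝ≥0∞ :=
  ⨆ (N : ℕ) (ξ : X → Fin N) (_ : Measurable ξ),
    limsup (fun m : ℕ => ENNReal.ofReal (iteratedPartitionEntropy μ T ξ m / m)) atTop

/-! ### Slow entropy of a `ℤ^k`-action -/

/-- The inclusion `ℤ^k ⊂ ℝ^k`. -/
def latticeVec {k : ℕ} (z : Fin k → ℤ) : Fin k → ℝ := fun i => (z i : ℝ)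

/-- A seminorm on `ℝ^k` is a norm if it vanishes only at the origin. -/
def IsNormOn {k : ℕ} (p : Seminorm ℝ (Fin k → ℝ)) : Prop := ∀ x, p x = 0 → x = 0

/-- `F_s^p`: the lattice points in the `p`-ball of radius `s` around the origin. -/
def latticeBall {k : ℕ} (p : Seminorm ℝ (Fin k → ℝ)) (s : ℝ) : Set (Fin k → ℤ) :=
  {z | p (latticeVec z) ≤ s}

/-- The pull-back to `X` of the normalized Hamming metric on `F`-codes: the proportion of `z ∈ F`
for which `α(z) x` and `α(z) y` lie in different elements of the partition `ξ`. -/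
def hammingDistOn {k : ℕ} {X : Type*} (α : (Fin k → ℤ) → X → X) {N : ℕ} (ξ : X → Fin N)
    (F : Set (Fin k → ℤ)) (x y : X) : ℝ :=
  ({z | z ∈ F ∧ ξ (α z x) ≠ ξ (α z y)}.ncard : ℝ) / (F.ncard : ℝ)

/-- `S^H_ξ(α, F, ε, δ)`: the minimal number of Hamming balls of radius `ε` whose union has
measure at least `1 - δ`. -/
def hammingCoverNumber {k : ℕ} {X : Type*} [MeasurableSpace X] (μ : Measure X)
    (α : (Fin k → ℤ) → X → X) {N : ℕ} (ξ : X → Fin N) (F : Set (Fin k → ℤ)) (ε δ : ℝ) : ℕ :=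
  sInf {m : ℕ | ∃ C : Finset X, C.card = m ∧
    1 - δ ≤ μ.real (⋃ c ∈ C, {x | hammingDistOn α ξ F c x < ε})}

/-- `sh(p, α, ξ) = lim_{ε, δ → 0⁺} limsup_{s → ∞} (1/s) log S^H_ξ(α, F_s^p, ε, δ)`.
The inner quantity is monotone in `ε` and `δ`, so that the outer `limsup` is a limit. -/
def slowEntropyPartition {k : ℕ} {X : Type*} [MeasurableSpace X] (μ : Measure X)
    (α : (Fin k → ℤ) → X → X) (p : Seminorm ℝ (Fin k → ℝ)) {N : ℕ} (ξ : X → Fin N) : ℝ≥0∞ :=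
  limsup (fun e : ℝ × ℝ =>
      limsup (fun s : ℝ => ENNReal.ofReal
        (Real.log (hammingCoverNumber μ α ξ (latticeBall p s) e.1 e.2) / s)) atTop)
    (𝓝[>] (0 : ℝ) ×ˢ 𝓝[>] (0 : ℝ))

/-- `sh(p, α)`: the supremum of `sh(p, α, ξ)` over finite measurable partitions `ξ`. -/
def slowEntropyNorm {k : ℕ} {X : Type*} [MeasurableSpace X] (μ : Measure X)
    (α : (Fin k → ℤ) → X → X) (p : Seminorm ℝ (Fin k → ℝ)) : ℝ≥0∞ :=
  ⨆ (N : ℕ) (ξ : X → Fin N) (_ : Measurable ξ), slowEntropyPartition μ α p ξ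

/-- `sh(α)`: the infimum of `sh(p, α)` over the norms `p` on `ℝ^k` whose unit ball has
volume one. -/
def slowEntropy {k : ℕ} {X : Type*} [MeasurableSpace X] (μ : Measure X)
    (α : (Fin k → ℤ) → X → X) : ℝ≥0∞ :=
  ⨅ (p : Seminorm ℝ (Fin k → ℝ)) (_ : IsNormOn p) (_ : volume {x | p x ≤ 1} = 1),
    slowEntropyNorm μ α p

/-! ### Affine actions on tori -/

/-- The affine map `x ↦ A x + b` of the torus `𝕋^n = (ℝ/ℤ)^n`, with `A` an integer matrix. -/
def torusAffineMap {n : ℕ} (A : Matrix (Fin n) (Fin n) ℤ) (b : UnitAddTorus (Fin n))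
    (x : UnitAddTorus (Fin n)) : UnitAddTorus (Fin n) :=
  fun i => (∑ j, A i j • x j) + b i

/-- An action of `ℤ^k` on `𝕋^n` by affine maps `x ↦ A_z x + b_z`. The group laws force
`A_z ∈ GL(n, ℤ)`, and `A_z`, `b_z` are determined by the map. -/
structure AffineTorusAction (k n : ℕ) where
  /-- the linear part `A_z`, which is the derivative of the action -/
  lin : (Fin k → ℤ) → Matrix (Fin n) (Fin n) ℤ
  /-- the translation part `b_z` -/
  trans : (Fin k → ℤ) → UnitAddTorus (Fin n)
  map_zero : ∀ x, torusAffineMap (lin 0) (trans 0) x = x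
  map_add : ∀ z w x, torusAffineMap (lin (z + w)) (trans (z + w)) x =
    torusAffineMap (lin z) (trans z) (torusAffineMap (lin w) (trans w) x)

namespace AffineTorusAction

variable {k n : ℕ} (α : AffineTorusAction k n)

/-- The transformation `α(z)` of the torus. -/
def act (z : Fin k → ℤ) : UnitAddTorus (Fin n) → UnitAddTorus (Fin n) :=
  torusAffineMap (α.lin z) (α.trans z)

theorem act_zero (x : UnitAddTorus (Fin n)) : α.act 0 x = x := α.map_zero x

theorem act_add (z w : Fin k → ℤ) (x : UnitAddTorus (Fin n)) :
    α.act (z + w) x = α.act z (α.act w x) := α.map_add z w x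

/-- A linear functional `χ` on `ℝ^k` is a Lyapunov exponent of the action if some nonzero tangent
vector `v` grows at rate `χ(z)` under the derivative of `α(z)`, for every `z ∈ ℤ^k`:
`lim_m (1/m) log ‖D(α(z)^m) v‖ = χ(z)`. -/
def IsLyapunovExponent (χ : Module.Dual ℝ (Fin k → ℝ)) : Prop :=
  ∃ v : Fin n → ℝ, v ≠ 0 ∧ ∀ z : Fin k → ℤ,
    Tendsto (fun m : ℕ =>
        Real.log ‖((α.lin (m • z)).map (fun a : ℤ => (a : ℝ))).mulVec v‖ / (m : ℝ))
      atTop (𝓝 (χ (latticeVec z)))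

/-- The Lyapunov hyperplanes are the kernels of the Lyapunov exponents. (A zero exponent
contributes the whole space, which does not affect the intersection.) -/
def lyapunovHyperplanes : Set (Submodule ℝ (Fin k → ℝ)) :=
  {H | ∃ χ : Module.Dual ℝ (Fin k → ℝ), α.IsLyapunovExponent χ ∧ H = LinearMap.ker χ}

/-! ### The suspension, the entropy function and the Fried average entropy -/

/-- The equivalence relation `(s, x) ∼ (s - z, α(z) x)`, `z ∈ ℤ^k`, on `ℝ^k × 𝕋^n`. -/
def suspensionSetoid : Setoid ((Fin k → ℝ) × UnitAddTorus (Fin n)) where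
  r a b := ∃ z : Fin k → ℤ, b.1 = a.1 - latticeVec z ∧ b.2 = α.act z a.2
  iseqv := by
    refine ⟨fun a => ⟨0, ?_, (α.act_zero _).symm⟩, ?_, ?_⟩
    · ext i; simp [latticeVec]
    · rintro a b ⟨z, h1, h2⟩
      refine ⟨-z, ?_, ?_⟩
      · ext i; simp [h1, latticeVec]
      · rw [h2, ← α.act_add, neg_add_cancel, α.act_zero]
    · rintro a b c ⟨z, h1, h2⟩ ⟨w, h3, h4⟩
      refine ⟨w + z, ?_, ?_⟩
      · ext i; simp [h1, h3, latticeVec]; ring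
      · rw [h4, h2, α.act_add]

/-- The suspension space `(ℝ^k × 𝕋^n) / ℤ^k`. -/
def Suspension : Type := Quotient α.suspensionSetoid

/-- The suspension carries the quotient of the Borel `σ`-algebra. -/
instance : MeasurableSpace α.Suspension :=
  inferInstanceAs (MeasurableSpace (Quotient α.suspensionSetoid))

/-- The quotient projection `ℝ^k × 𝕋^n → (ℝ^k × 𝕋^n) / ℤ^k`. -/
def suspensionMk (a : (Fin k → ℝ) × UnitAddTorus (Fin n)) : α.Suspension :=
  Quotient.mk α.suspensionSetoid a

/-- The suspension of `α`: the `ℝ^k`-action induced by `(s, x) ↦ (s + t, x)`. -/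
def suspensionFlow (t : Fin k → ℝ) : α.Suspension → α.Suspension :=
  Quotient.map (sa := α.suspensionSetoid) (sb := α.suspensionSetoid)
    (fun a => (a.1 + t, a.2)) (by
      rintro a b ⟨z, h1, h2⟩
      refine ⟨z, ?_, h2⟩
      ext i; simp [h1]; ring)

/-- The invariant probability measure of the suspension: Lebesgue measure on the fundamental
domain `[0,1)^k × 𝕋^n`, projected to the quotient. -/
def suspensionMeasure : Measure α.Suspension :=
  (((volume : Measure (Fin k → ℝ)).restrict (Set.univ.pi fun _ => Set.Ico (0 : ℝ) 1)).prod
    (volume : Measure (UnitAddTorus (Fin n)))).map α.suspensionMk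

/-- The entropy function: the measure-theoretic entropy of the elements of the suspension. -/
def entropyFunction (t : Fin k → ℝ) : ℝ≥0∞ :=
  ksEntropy α.suspensionMeasure (α.suspensionFlow t)

/-- The entropy function is (finite and equal to) a norm on `ℝ^k`. -/
def EntropyFunctionIsNorm : Prop :=
  ∃ p : Seminorm ℝ (Fin k → ℝ), IsNormOn p ∧ ∀ t, α.entropyFunction t = ENNReal.ofReal (p t)

/-- The Fried average entropy `2^k / (k! vol B)`, with `B` the unit ball of the entropy function;
it is `0` if `B` has infinite volume. -/
def friedEntropy : ℝ≥0∞ :=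
  (2 ^ k / (k.factorial : ℝ≥0∞)) / volume {t : Fin k → ℝ | α.entropyFunction t ≤ 1}

end AffineTorusAction

end

/-! All four conditions are controlled by one seminorm on `ℝ^k`: G = (1/2) ∑ |χ_j|, where χ_1, …,
χ_n are the Lyapunov exponents with multiplicity (`exponentSeminorm`). Each condition is shown to
say that G is not a norm, that is, that the χ_j have a common zero t ≠ 0.

The exponents come from the joint generalized eigenspaces of the commuting linear parts. They give a
real basis whose vectors obey ‖A_z b_j‖ ≤ C exp(χ_j(z) + ε‖z‖) uniformly in z
(`exists_growth_basis`). In this basis a Bowen ball contains an explicit box, which bounds its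
volume from below. The matching upper bound encloses a two-time Bowen ball in a box by pairing with
a growth basis of the transpose, whose exponents are compared with the χ_j through the same volumes.
Since |det A_z| = 1, the exponents sum to zero, so the sum of their positive parts is G. These facts
are collected in `IsExponentSystem`. Its clause |ψ| ≤ 2G for every Lyapunov exponent ψ makes a
classification of the exponents unnecessary: every hyperplane contains every zero of G.

The entropy function equals G (`entropyFunction_eq`). For the lower bound, a cylinder of a fine
partition lies in a translate of a Bowen ball, so all its atoms are small. For the upper bound,
orbits in the suspension are sorted into polynomially many classes sharing the same integer parts,
each class is covered by about exp(m G(t)) Bowen sets, and two points of one such set have codes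
close in Hamming distance apart from rare visits to a set where the labelling is irregular. The
statements on the norm and on the Fried entropy follow, because the unit ball of a seminorm is
compact for a norm and of infinite volume otherwise.

For the slow entropy, G ≤ a p gives sh(p) ≤ n a by Bowen covers (`slowEntropyNorm_le`). If G
vanishes somewhere off the origin, small perturbations of G have unit balls of arbitrarily large
volume, and normalizing that volume to one makes a arbitrarily small. If G is a norm, no p-ball of
volume one fits into a small multiple of the G-ball, so every admissible p has a lattice direction z
with G(z) ≥ c₀ q and p(z) ≤ q, with c₀ independent of p. Averaging over segments in direction z then
bounds sh(p) below by a fixed multiple of c₀ (`le_slowEntropyNorm`). -/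

/-! ### Growth of vectors under commuting matrices -/

/-- A representation of `ℤ^k` by `n × n` matrices. -/
structure IsMatrixRep {k n : ℕ} {𝕜 : Type*} [Field 𝕜]
    (A : (Fin k → ℤ) → Matrix (Fin n) (Fin n) 𝕜) : Prop where
  map_zero : A 0 = 1
  map_add : ∀ z w, A (z + w) = A z * A w

namespace IsMatrixRep

variable {k n : ℕ} {𝕜 : Type*} [Field 𝕜] {A : (Fin k → ℤ) → Matrix (Fin n) (Fin n) 𝕜}

theorem add_mulVec (hA : IsMatrixRep A) (z w : Fin k → ℤ) (v : Fin n → 𝕜) :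
    (A (z + w)).mulVec v = (A z).mulVec ((A w).mulVec v) := by
  rw [hA.map_add, Matrix.mulVec_mulVec]

theorem zero_mulVec (hA : IsMatrixRep A) (v : Fin n → 𝕜) : (A 0).mulVec v = v := by
  rw [hA.map_zero, Matrix.one_mulVec]

theorem neg_mulVec_mulVec (hA : IsMatrixRep A) (z : Fin k → ℤ) (v : Fin n → 𝕜) :
    (A (-z)).mulVec ((A z).mulVec v) = v := by
  rw [← hA.add_mulVec, neg_add_cancel, hA.zero_mulVec]

theorem mulVec_comm (hA : IsMatrixRep A) (z w : Fin k → ℤ) (v : Fin n → 𝕜) :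
    (A z).mulVec ((A w).mulVec v) = (A w).mulVec ((A z).mulVec v) := by
  rw [← hA.add_mulVec, ← hA.add_mulVec, add_comm]

theorem transpose (hA : IsMatrixRep A) : IsMatrixRep fun z => (A z).transpose where
  map_zero := by simp [hA.map_zero]
  map_add z w := by rw [add_comm, hA.map_add, Matrix.transpose_mul]

end IsMatrixRep

@[simp] theorem latticeVec_zero {k : ℕ} : latticeVec (0 : Fin k → ℤ) = 0 := by
  ext i; simp [latticeVec]

theorem latticeVec_add {k : ℕ} (z w : Fin k → ℤ) :
    latticeVec (z + w) = latticeVec z + latticeVec w := by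
  ext i; simp [latticeVec]

theorem latticeVec_neg {k : ℕ} (z : Fin k → ℤ) : latticeVec (-z) = -latticeVec z := by
  ext i; simp [latticeVec]

theorem latticeVec_nsmul {k : ℕ} (m : ℕ) (z : Fin k → ℤ) :
    latticeVec (m • z) = (m : ℝ) • latticeVec z := by
  ext i; simp [latticeVec]

/-- The vectors `v` with `‖A_z v‖ ≤ C_ε exp (χ(z) + ε ‖z‖)` for every `ε > 0`. -/
def growthSpace {k n : ℕ} {𝕜 : Type*} [NormedField 𝕜]
    (A : (Fin k → ℤ) → Matrix (Fin n) (Fin n) 𝕜) (χ : Module.Dual ℝ (Fin k → ℝ)) :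
    Submodule 𝕜 (Fin n → 𝕜) where
  carrier := {v | ∀ ε : ℝ, 0 < ε → ∃ C : ℝ, ∀ z : Fin k → ℤ,
    ‖(A z).mulVec v‖ ≤ C * Real.exp (χ (latticeVec z) + ε * ‖latticeVec z‖)}
  zero_mem' := fun ε _ => ⟨0, fun z => by simp⟩
  add_mem' := by
    intro v w hv hw ε hε
    obtain ⟨C, hC⟩ := hv ε hε
    obtain ⟨D, hD⟩ := hw ε hε
    refine ⟨C + D, fun z => ?_⟩
    rw [Matrix.mulVec_add, add_mul]
    exact (norm_add_le _ _).trans (add_le_add (hC z) (hD z))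
  smul_mem' := by
    intro c v hv ε hε
    obtain ⟨C, hC⟩ := hv ε hε
    refine ⟨‖c‖ * C, fun z => ?_⟩
    rw [Matrix.mulVec_smul, norm_smul, mul_assoc]
    exact mul_le_mul_of_nonneg_left (hC z) (norm_nonneg _)

theorem mem_growthSpace {k n : ℕ} {𝕜 : Type*} [NormedField 𝕜]
    {A : (Fin k → ℤ) → Matrix (Fin n) (Fin n) 𝕜} {χ : Module.Dual ℝ (Fin k → ℝ)}
    {v : Fin n → 𝕜} :
    v ∈ growthSpace A χ ↔ ∀ ε : ℝ, 0 < ε → ∃ C : ℝ, ∀ z : Fin k → ℤ,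
      ‖(A z).mulVec v‖ ≤ C * Real.exp (χ (latticeVec z) + ε * ‖latticeVec z‖) := Iff.rfl

/-- Pointwise bounds for a family of linear maps on a finite-dimensional subspace are uniform. -/
theorem exists_uniform_bound_of_pointwise {ι 𝕜 E F : Type*} [NontriviallyNormedField 𝕜]
    [CompleteSpace 𝕜] [NormedAddCommGroup E] [NormedSpace 𝕜 E] [NormedAddCommGroup F]
    [NormedSpace 𝕜 F] (W : Submodule 𝕜 E) [FiniteDimensional 𝕜 W] (T : ι → E →ₗ[𝕜] F) (g : ι → ℝ)
    (hg : ∀ i, 0 ≤ g i) (h : ∀ v ∈ W, ∃ C : ℝ, ∀ i, ‖T i v‖ ≤ C * g i) :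
    ∃ C : ℝ, 0 ≤ C ∧ ∀ v ∈ W, ∀ i, ‖T i v‖ ≤ C * g i * ‖v‖ := by
  let b := Module.finBasis 𝕜 W
  choose C hC using fun j => h (b j) (b j).2
  let D := ∑ j, |C j| * ‖(b.coord j).toContinuousLinearMap‖
  refine ⟨D, by positivity, fun v hv i => ?_⟩
  have hv' : v = ∑ j, b.coord j ⟨v, hv⟩ • (b j : E) := by
    have := congrArg W.subtype (b.sum_repr ⟨v, hv⟩)
    simp only [map_sum, map_smul] at this
    exact this.symm
  calc ‖T i v‖ = ‖∑ j, b.coord j ⟨v, hv⟩ • T i (b j)‖ := by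
        conv_lhs => rw [hv']
        simp only [map_sum, map_smul]
    _ ≤ ∑ j, ‖b.coord j ⟨v, hv⟩ • T i (b j)‖ := norm_sum_le _ _
    _ ≤ ∑ j, |C j| * ‖(b.coord j).toContinuousLinearMap‖ * (g i * ‖v‖) := by
        refine Finset.sum_le_sum fun j _ => ?_
        rw [norm_smul]
        have h1 : ‖b.coord j ⟨v, hv⟩‖ ≤ ‖(b.coord j).toContinuousLinearMap‖ * ‖v‖ :=
          (b.coord j).toContinuousLinearMap.le_opNorm ⟨v, hv⟩
        have h2 : ‖T i (b j)‖ ≤ |C j| * g i :=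
          (hC j i).trans (mul_le_mul_of_nonneg_right (le_abs_self _) (hg i))
        calc _ ≤ (‖(b.coord j).toContinuousLinearMap‖ * ‖v‖) * (|C j| * g i) :=
              mul_le_mul h1 h2 (norm_nonneg _) (by positivity)
          _ = _ := by ring
    _ = D * g i * ‖v‖ := by rw [← Finset.sum_mul]; ring

/-- A sequence on `ℤ` whose increments grow subexponentially grows subexponentially. -/
theorem exists_bound_of_increment_bound {E : Type*} [NormedAddCommGroup E] (a : ℤ → E)
    {C ε : ℝ} (hε : 0 < ε) (h : ∀ m : ℤ, ‖a (m + 1) - a m‖ ≤ C * Real.exp (ε * |(m : ℝ)|)) :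
    ∃ D : ℝ, ∀ m : ℤ, ‖a m‖ ≤ D * Real.exp (2 * ε * |(m : ℝ)|) := by
  have hC : 0 ≤ C := by simpa using (norm_nonneg _).trans (h 0)
  have hpos : ∀ m : ℕ, ‖a m‖ ≤ ‖a 0‖ + m * (C * Real.exp (ε * m)) := by
    intro m
    induction m with
    | zero => simp
    | succ m ih =>
      have h1 : ‖a (m + 1)‖ ≤ ‖a m‖ + C * Real.exp (ε * m) := by
        have := h m
        have h2 := norm_le_norm_add_norm_sub' (a (m + 1)) (a m)
        simp at this; linarith
      have h3 : Real.exp (ε * m) ≤ Real.exp (ε * (m + 1)) := Real.exp_le_exp.2 (by nlinarith)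
      push_cast
      nlinarith [mul_le_mul_of_nonneg_left h3 hC, (Nat.cast_nonneg m : (0 : ℝ) ≤ m),
        mul_le_mul_of_nonneg_left (mul_le_mul_of_nonneg_left h3 hC)
          (Nat.cast_nonneg m : (0 : ℝ) ≤ m)]
  have hneg : ∀ m : ℕ, ‖a (-m)‖ ≤ ‖a 0‖ + m * (C * Real.exp (ε * m)) := by
    intro m
    induction m with
    | zero => simp
    | succ m ih =>
      have h1 : ‖a (-(m + 1))‖ ≤ ‖a (-m)‖ + C * Real.exp (ε * (m + 1)) := by
        have := h (-(m + 1))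
        have h2 := norm_le_norm_add_norm_sub (a (-m)) (a (-(m + 1)))
        have h4 : |(-1 + -(m : ℝ))| = m + 1 := by
          rw [show -1 + -(m : ℝ) = -(m + 1) by ring, abs_neg, abs_of_nonneg (by positivity)]
        simp [h4] at this h2 ⊢; linarith
      have h3 : Real.exp (ε * m) ≤ Real.exp (ε * (m + 1)) := Real.exp_le_exp.2 (by nlinarith)
      push_cast
      nlinarith [mul_le_mul_of_nonneg_left h3 hC, (Nat.cast_nonneg m : (0 : ℝ) ≤ m),
        mul_le_mul_of_nonneg_left (mul_le_mul_of_nonneg_left h3 hC)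
          (Nat.cast_nonneg m : (0 : ℝ) ≤ m)]
  -- The linear factor is absorbed by m ≤ exp(ε m) / ε; this is why the rate doubles.
  have key : ∀ m : ℕ, ‖a 0‖ + m * (C * Real.exp (ε * m)) ≤
      (‖a 0‖ + C / ε) * Real.exp (2 * ε * m) := by
    intro m
    have h1 : (m : ℝ) ≤ Real.exp (ε * m) / ε := by
      rw [le_div_iff₀ hε]
      linarith [Real.add_one_le_exp (ε * m)]
    have h2 : (1 : ℝ) ≤ Real.exp (2 * ε * m) := Real.one_le_exp (by positivity)
    have h3 : Real.exp (2 * ε * m) = Real.exp (ε * m) * Real.exp (ε * m) := by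
      rw [← Real.exp_add]; ring_nf
    rw [add_mul]
    refine add_le_add (le_mul_of_one_le_right (norm_nonneg _) h2) ?_
    calc (m : ℝ) * (C * Real.exp (ε * m)) ≤
        Real.exp (ε * m) / ε * (C * Real.exp (ε * m)) := by gcongr
      _ = _ := by rw [h3]; ring
  refine ⟨‖a 0‖ + C / ε, fun m => ?_⟩
  obtain ⟨j, rfl | rfl⟩ := m.eq_nat_or_neg
  · simpa using (hpos j).trans (key j)
  · simpa using (hneg j).trans (key j)

/-- Along a generator, generalized eigenvectors grow at the rate of the eigenvalue. -/
theorem IsMatrixRep.exists_bound_of_pow_sub_eq_zero {k n : ℕ}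
    {A : (Fin k → ℤ) → Matrix (Fin n) (Fin n) ℂ} (hA : IsMatrixRep A) (e : Fin k → ℤ) {c : ℂ}
    (hc : c ≠ 0) (j : ℕ) :
    ∀ v : Fin n → ℂ, (((Matrix.toLin' (A e) : Module.End ℂ (Fin n → ℂ)) -
      algebraMap ℂ (Module.End ℂ (Fin n → ℂ)) c) ^ j) v = 0 → ∀ ε : ℝ, 0 < ε →
      ∃ D : ℝ, ∀ m : ℤ, ‖(A (m • e)).mulVec v‖ ≤
        D * Real.exp (m * Real.log ‖c‖ + ε * |(m : ℝ)|) := by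
  have hcn : 0 < ‖c‖ := norm_pos_iff.2 hc
  induction j with
  | zero =>
    intro v hv ε _
    have : v = 0 := by simpa using hv
    exact ⟨0, fun m => by simp [this]⟩
  | succ j ih =>
    intro v hv ε hε
    set u : Fin n → ℂ := (A e).mulVec v - c • v with hu
    have hu0 : (((Matrix.toLin' (A e) : Module.End ℂ (Fin n → ℂ)) -
        algebraMap ℂ (Module.End ℂ (Fin n → ℂ)) c) ^ j) u = 0 := by
      rw [pow_succ] at hv
      simpa [hu] using hv
    obtain ⟨D, hD⟩ := ih u hu0 (ε / 2) (half_pos hε)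
    -- The normalized orbit c^(-m) A^m v has increments c^(-m-1) A^m u with u = (A - c) v, which is
    -- killed by a lower power; the induction hypothesis makes them subexponential in both time
    -- directions.
    have hstep : ∀ m : ℤ, ‖(c ^ (m + 1))⁻¹ • (A ((m + 1) • e)).mulVec v -
        (c ^ m)⁻¹ • (A (m • e)).mulVec v‖ ≤ (D / ‖c‖) * Real.exp (ε / 2 * |(m : ℝ)|) := by
      intro m
      have h1 : (A ((m + 1) • e)).mulVec v =
          c • (A (m • e)).mulVec v + (A (m • e)).mulVec u := by
        rw [add_smul, one_smul, hA.add_mulVec, hu, Matrix.mulVec_sub, Matrix.mulVec_smul]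
        abel
      have h2 : (c ^ (m + 1))⁻¹ • (A ((m + 1) • e)).mulVec v -
          (c ^ m)⁻¹ • (A (m • e)).mulVec v = (c ^ (m + 1))⁻¹ • (A (m • e)).mulVec u := by
        rw [h1, smul_add, smul_smul, zpow_add_one₀ hc, mul_inv, mul_assoc, inv_mul_cancel₀ hc,
          mul_one, add_sub_cancel_left]
      have h3 : Real.exp (m * Real.log ‖c‖ + ε / 2 * |(m : ℝ)|) =
          ‖c‖ ^ m * Real.exp (ε / 2 * |(m : ℝ)|) := by
        rw [Real.exp_add, mul_comm (m : ℝ), Real.exp_mul, Real.exp_log hcn, Real.rpow_intCast]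
      have h4 : 0 < ‖c‖ ^ m := zpow_pos hcn m
      rw [h2, norm_smul, norm_inv, norm_zpow, zpow_add_one₀ hcn.ne']
      calc _ ≤ (‖c‖ ^ m * ‖c‖)⁻¹ * (D * (‖c‖ ^ m * Real.exp (ε / 2 * |(m : ℝ)|))) := by
            rw [← h3]
            exact mul_le_mul_of_nonneg_left (hD m) (by positivity)
        _ = _ := by field_simp
    obtain ⟨D', hD'⟩ := exists_bound_of_increment_bound
      (fun m : ℤ => (c ^ m)⁻¹ • (A (m • e)).mulVec v) (half_pos hε) hstep
    refine ⟨D', fun m => ?_⟩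
    have h4 : 0 < ‖c‖ ^ m := zpow_pos hcn m
    have h5 := hD' m
    simp only [norm_smul, norm_inv, norm_zpow] at h5
    rw [inv_mul_le_iff₀ h4] at h5
    rw [Real.exp_add, mul_comm (m : ℝ), Real.exp_mul, Real.exp_log hcn, Real.rpow_intCast]
    calc _ ≤ _ := h5
      _ = _ := by rw [show 2 * (ε / 2) = ε by ring]; ring

/-- The functional `t ↦ ∑ tᵢ log |cᵢ|`. -/
noncomputable def logFunctional {k : ℕ} (c : Fin k → ℂ) : Module.Dual ℝ (Fin k → ℝ) :=
  ∑ i, Real.log ‖c i‖ • LinearMap.proj i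

theorem logFunctional_apply {k : ℕ} (c : Fin k → ℂ) (t : Fin k → ℝ) :
    logFunctional c t = ∑ i, t i * Real.log ‖c i‖ := by
  simp [logFunctional, mul_comm]

/-- A lattice element is a sum of multiples of the generators, and on the joint generalized
eigenspace each generator contributes its own factor log |c_i| with subexponential error. -/
theorem IsMatrixRep.iInf_maxGenEigenspace_le_growthSpace {k n : ℕ}
    {A : (Fin k → ℤ) → Matrix (Fin n) (Fin n) ℂ} (hA : IsMatrixRep A) (c : Fin k → ℂ) :
    (⨅ i, Module.End.maxGenEigenspace (Matrix.toLin' (A (Pi.single i 1))) (c i)) ≤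
      growthSpace A (logFunctional c) := by
  set V := ⨅ i, Module.End.maxGenEigenspace (Matrix.toLin' (A (Pi.single i 1))) (c i) with hV
  by_cases hc : ∀ i, c i ≠ 0
  swap
  -- Each A_z is invertible, so a generalized eigenspace for the eigenvalue 0 is trivial.
  · push Not at hc
    obtain ⟨i, hi⟩ := hc
    intro v hv
    rw [hV, Submodule.mem_iInf] at hv
    obtain ⟨j, hj⟩ := Module.End.mem_maxGenEigenspace _ _ _ |>.1 (hv i)
    rw [hi, zero_smul, sub_zero] at hj
    have : v = 0 := by
      clear hv
      induction j with
      | zero => simpa using hj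
      | succ j ih =>
        apply ih
        rw [pow_succ'] at hj
        have h1 : (A (Pi.single i 1)).mulVec
          (((Matrix.toLin' (A (Pi.single i 1)) : Module.End ℂ (Fin n → ℂ)) ^ j) v) = 0 := by
          simpa using hj
        rw [← hA.neg_mulVec_mulVec (Pi.single i 1) (((Matrix.toLin' (A (Pi.single i 1)) :
          Module.End ℂ (Fin n → ℂ)) ^ j) v), h1, Matrix.mulVec_zero]
    rw [this]
    exact zero_mem _
  have hinv : ∀ w, ∀ v ∈ V, (A w).mulVec v ∈ V := by
    intro w v hv
    rw [hV, Submodule.mem_iInf] at hv ⊢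
    intro i
    have hcomm : Commute (Matrix.toLin' (A (Pi.single i 1)) : Module.End ℂ (Fin n → ℂ))
        (Matrix.toLin' (A w)) := by
      refine LinearMap.ext fun x => ?_
      simpa using hA.mulVec_comm (Pi.single i 1) w x
    exact Module.End.mapsTo_maxGenEigenspace_of_comm hcomm (c i) (hv i)
  intro v hv
  rw [mem_growthSpace]
  intro ε hε
  set ε' : ℝ := ε / (k + 1) with hε'
  have hε'0 : 0 < ε' := by positivity
  -- Uniformity over V is essential: the bound for one generator is applied to a vector already
  -- moved by the others, which stays in V by `hinv`.
  have hone : ∀ i, ∃ C : ℝ, 0 ≤ C ∧ ∀ w ∈ V, ∀ m : ℤ, ‖(A (m • Pi.single i 1)).mulVec w‖ ≤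
      C * Real.exp (m * Real.log ‖c i‖ + ε' * |(m : ℝ)|) * ‖w‖ := by
    intro i
    have := exists_uniform_bound_of_pointwise V
      (fun m : ℤ => Matrix.toLin' (A (m • Pi.single i 1)))
      (fun m : ℤ => Real.exp (m * Real.log ‖c i‖ + ε' * |(m : ℝ)|))
      (fun m => (Real.exp_pos _).le) (fun w hw => by
        rw [hV, Submodule.mem_iInf] at hw
        obtain ⟨j, hj⟩ := Module.End.mem_maxGenEigenspace _ _ _ |>.1 (hw i)
        have := hA.exists_bound_of_pow_sub_eq_zero (Pi.single i 1) (hc i) j w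
          (by simpa [Algebra.algebraMap_eq_smul_one] using hj) ε' hε'0
        simpa using this)
    simpa using this
  choose C hC0 hC using hone
  have hS : ∀ (S : Finset (Fin k)) (z : Fin k → ℤ), ∀ w ∈ V,
      ‖(A (∑ i ∈ S, z i • Pi.single i 1)).mulVec w‖ ≤
        (∏ i ∈ S, C i) * Real.exp (∑ i ∈ S, ((z i : ℝ) * Real.log ‖c i‖ + ε' * |(z i : ℝ)|)) *
          ‖w‖ := by
    intro S z
    induction S using Finset.induction_on with
    | empty => intro w _; simp [hA.zero_mulVec]
    | insert i S hi ih =>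
      intro w hw
      rw [Finset.sum_insert hi, Finset.sum_insert hi, Finset.prod_insert hi, hA.add_mulVec,
        Real.exp_add]
      calc _ ≤ _ := hC i _ (hinv _ w hw) (z i)
        _ ≤ C i * Real.exp (z i * Real.log ‖c i‖ + ε' * |(z i : ℝ)|) * _ :=
          mul_le_mul_of_nonneg_left (ih w hw) (mul_nonneg (hC0 i) (Real.exp_pos _).le)
        _ = _ := by ring
  refine ⟨(∏ i, C i) * ‖v‖, fun z => ?_⟩
  have hz : z = ∑ i, z i • Pi.single i (1 : ℤ) := by
    ext j; simp [Finset.sum_apply, Pi.single_apply]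
  have h1 := hS Finset.univ z v hv
  rw [← hz] at h1
  refine h1.trans ?_
  rw [mul_right_comm]
  refine mul_le_mul_of_nonneg_left (Real.exp_le_exp.2 ?_)
    (mul_nonneg (Finset.prod_nonneg fun i _ => hC0 i) (norm_nonneg _))
  rw [Finset.sum_add_distrib, logFunctional_apply]
  refine add_le_add le_rfl ?_
  calc ∑ i, ε' * |(z i : ℝ)| ≤ ∑ _i : Fin k, ε' * ‖latticeVec z‖ := by
        refine Finset.sum_le_sum fun i _ => mul_le_mul_of_nonneg_left ?_ hε'0.le
        exact norm_le_pi_norm (latticeVec z) i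
    _ = k * ε' * ‖latticeVec z‖ := by simp; ring
    _ ≤ ε * ‖latticeVec z‖ := by
        refine mul_le_mul_of_nonneg_right ?_ (norm_nonneg _)
        rw [hε', mul_div_assoc', div_le_iff₀ (by positivity)]
        nlinarith

/-- Over ℂ the joint generalized eigenspaces of commuting endomorphisms span, and each lies in a
growth space. -/
theorem IsMatrixRep.iSup_growthSpace_complex {k n : ℕ}
    {A : (Fin k → ℤ) → Matrix (Fin n) (Fin n) ℂ} (hA : IsMatrixRep A) :
    ⨆ χ, growthSpace A χ = ⊤ := by
  have h := Module.End.iSup_iInf_maxGenEigenspace_eq_top_of_iSup_maxGenEigenspace_eq_top_of_commute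
    (fun i : Fin k => (Matrix.toLin' (A (Pi.single i 1)) : Module.End ℂ (Fin n → ℂ)))
    (fun i j _ => LinearMap.ext fun x => by
      simpa using hA.mulVec_comm (Pi.single i 1) (Pi.single j 1) x)
    (fun i => Module.End.iSup_maxGenEigenspace_eq_top _)
  rw [eq_top_iff, ← h]
  exact iSup_le fun c => (hA.iInf_maxGenEigenspace_le_growthSpace c).trans
    (le_iSup (fun χ => growthSpace A χ) (logFunctional c))

/-- Descent from ℂ: taking real parts commutes with a real matrix and does not increase the norm, so
it maps complex growth spaces into real ones, and every real vector is a real part. -/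
theorem IsMatrixRep.iSup_growthSpace_real {k n : ℕ}
    {A : (Fin k → ℤ) → Matrix (Fin n) (Fin n) ℝ} (hA : IsMatrixRep A) :
    ⨆ χ, growthSpace A χ = ⊤ := by
  set B : (Fin k → ℤ) → Matrix (Fin n) (Fin n) ℂ := fun z => (A z).map Complex.ofReal with hB
  have hBrep : IsMatrixRep B :=
    ⟨by simp [hB, hA.map_zero], fun z w => by
      simp only [hB, hA.map_add]
      exact Matrix.map_mul (f := Complex.ofRealHom)⟩
  have hre : ∀ (z : Fin k → ℤ) (w : Fin n → ℂ),
      (A z).mulVec (fun i => (w i).re) = fun i => ((B z).mulVec w i).re := by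
    intro z w
    ext i
    simp [hB, Matrix.mulVec, dotProduct]
  rw [eq_top_iff]
  intro v _
  have hall : ∀ w : Fin n → ℂ, (fun i => (w i).re) ∈ ⨆ χ, growthSpace A χ := by
    intro w
    have hw : w ∈ ⨆ χ, growthSpace B χ := by
      rw [hBrep.iSup_growthSpace_complex]; trivial
    induction hw using Submodule.iSup_induction' with
    | mem χ x hx =>
      refine Submodule.mem_iSup_of_mem χ ?_
      rw [mem_growthSpace] at hx ⊢
      intro ε hε
      obtain ⟨C, hC⟩ := hx ε hε
      refine ⟨C, fun z => le_trans ?_ (hC z)⟩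
      rw [hre, pi_norm_le_iff_of_nonneg (norm_nonneg _)]
      intro i
      exact (Complex.abs_re_le_norm _).trans (norm_le_pi_norm ((B z).mulVec x) i)
    | zero => exact zero_mem _
    | add x y _ _ hx hy => exact add_mem hx hy
  simpa using hall fun i => (v i : ℂ)

/-- A basis of `ℝ^n` adapted to the growth of the representation. -/
theorem IsMatrixRep.exists_growth_basis {k n : ℕ}
    {A : (Fin k → ℤ) → Matrix (Fin n) (Fin n) ℝ} (hA : IsMatrixRep A) :
    ∃ (b : Module.Basis (Fin n) ℝ (Fin n → ℝ)) (χ : Fin n → Module.Dual ℝ (Fin k → ℝ)),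
      ∀ j, b j ∈ growthSpace A (χ j) := by
  have hspan : ⊤ ≤ Submodule.span ℝ (⋃ χ, (growthSpace A χ : Set (Fin n → ℝ))) := by
    rw [← hA.iSup_growthSpace_real]
    exact iSup_le fun χ x hx => Submodule.subset_span (Set.mem_iUnion.2 ⟨χ, hx⟩)
  let b := Module.Basis.ofSpan hspan
  have hmem : ∀ i, ∃ χ, b i ∈ growthSpace A χ := by
    intro i
    have : b i ∈ ⋃ χ, (growthSpace A χ : Set (Fin n → ℝ)) :=
      Module.Basis.ofSpan_subset hspan ⟨i, rfl⟩
    simpa using this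
  have := FiniteDimensional.fintypeBasisIndex b
  let e := Fintype.equivFinOfCardEq (n := n) ((Module.finrank_eq_card_basis b).symm.trans (by simp))
  choose χ hχ using hmem
  exact ⟨b.reindex e, fun j => χ (e.symm j), fun j => by simpa using hχ (e.symm j)⟩

theorem tendsto_div_nat_of_abs_sub_le {a : ℕ → ℝ} {c : ℝ}
    (h : ∀ ε : ℝ, 0 < ε → ∃ K : ℝ, ∀ m : ℕ, |a m - m * c| ≤ K + ε * m) :
    Tendsto (fun m : ℕ => a m / m) atTop (𝓝 c) := by
  rw [Metric.tendsto_atTop]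
  intro ε hε
  obtain ⟨K, hK⟩ := h (ε / 2) (half_pos hε)
  obtain ⟨N, hN⟩ := exists_nat_gt (2 * K / ε)
  refine ⟨N + 1, fun m hm => ?_⟩
  have hm0 : (0 : ℝ) < m := by exact_mod_cast (by omega : 0 < m)
  have hm1 : (N : ℝ) ≤ m := by exact_mod_cast (by omega : N ≤ m)
  have h1 : a m / m - c = (a m - m * c) / m := by field_simp
  rw [Real.dist_eq, h1, abs_div, abs_of_pos hm0, div_lt_iff₀ hm0]
  have h2 : 2 * K / ε < m := hN.trans_le hm1
  rw [div_lt_iff₀ hε] at h2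
  linarith [hK m]

theorem le_of_forall_nat_mul_le {a b : ℝ}
    (h : ∀ ε : ℝ, 0 < ε → ∃ K : ℝ, ∀ m : ℕ, (m : ℝ) * a ≤ m * b + K + ε * m) : a ≤ b := by
  by_contra! hab
  obtain ⟨K, hK⟩ := h ((a - b) / 2) (by linarith)
  obtain ⟨m, hm⟩ := exists_nat_gt (2 * K / (a - b))
  rw [div_lt_iff₀ (by linarith)] at hm
  have := hK m
  nlinarith

theorem IsMatrixRep.mulVec_mem_growthSpace {k n : ℕ}
    {A : (Fin k → ℤ) → Matrix (Fin n) (Fin n) ℝ} (hA : IsMatrixRep A)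
    {χ : Module.Dual ℝ (Fin k → ℝ)} {v : Fin n → ℝ} (hv : v ∈ growthSpace A χ) (w : Fin k → ℤ) :
    (A w).mulVec v ∈ growthSpace A χ := by
  rw [mem_growthSpace] at hv ⊢
  intro ε hε
  obtain ⟨C, hC⟩ := hv ε hε
  have hC0 : 0 ≤ C := by simpa using (norm_nonneg _).trans (hC 0)
  refine ⟨C * Real.exp (χ (latticeVec w) + ε * ‖latticeVec w‖), fun z => ?_⟩
  rw [← hA.add_mulVec, mul_assoc, ← Real.exp_add]
  refine (hC _).trans (mul_le_mul_of_nonneg_left (Real.exp_le_exp.2 ?_) hC0)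
  rw [latticeVec_add, _root_.map_add]
  nlinarith [norm_add_le (latticeVec z) (latticeVec w)]

/-- On a growth space the growth bound is also a lower bound. -/
theorem IsMatrixRep.exists_norm_le_of_mem_growthSpace {k n : ℕ}
    {A : (Fin k → ℤ) → Matrix (Fin n) (Fin n) ℝ} (hA : IsMatrixRep A)
    {χ : Module.Dual ℝ (Fin k → ℝ)} {v : Fin n → ℝ} (hv : v ∈ growthSpace A χ) {ε : ℝ}
    (hε : 0 < ε) : ∃ C : ℝ, 0 < C ∧ ∀ z : Fin k → ℤ,
      ‖v‖ ≤ C * Real.exp (-χ (latticeVec z) + ε * ‖latticeVec z‖) * ‖(A z).mulVec v‖ := by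
  obtain ⟨C, hC0, hC⟩ := exists_uniform_bound_of_pointwise (growthSpace A χ)
    (fun z => Matrix.toLin' (A z))
    (fun z => Real.exp (χ (latticeVec z) + ε * ‖latticeVec z‖)) (fun z => (Real.exp_pos _).le)
    (fun v hv => by simpa using mem_growthSpace.1 hv ε hε)
  refine ⟨C + 1, by positivity, fun z => ?_⟩
  -- The growth space is invariant, so the uniform upper bound for A_(-z) may be applied to A_z v,
  -- which it returns to v.
  have h := hC _ (hA.mulVec_mem_growthSpace hv z) (-z)
  rw [Matrix.toLin'_apply, hA.neg_mulVec_mulVec, latticeVec_neg, map_neg, norm_neg] at h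
  refine h.trans ?_
  gcongr
  linarith

/-- The upper bound defining the growth space and the lower bound from inverting the action pinch
the logarithmic growth. Hence each χ_j of a growth basis is a genuine Lyapunov exponent. -/
theorem IsMatrixRep.tendsto_of_mem_growthSpace {k n : ℕ}
    {A : (Fin k → ℤ) → Matrix (Fin n) (Fin n) ℝ} (hA : IsMatrixRep A)
    {χ : Module.Dual ℝ (Fin k → ℝ)} {v : Fin n → ℝ} (hv : v ∈ growthSpace A χ) (hv0 : v ≠ 0)
    (z : Fin k → ℤ) :
    Tendsto (fun m : ℕ => Real.log ‖(A (m • z)).mulVec v‖ / (m : ℝ)) atTop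
      (𝓝 (χ (latticeVec z))) := by
  apply tendsto_div_nat_of_abs_sub_le
  intro ε hε
  have hvn : 0 < ‖v‖ := norm_pos_iff.2 hv0
  set ε' : ℝ := ε / (‖latticeVec z‖ + 1) with hε'
  have hε'0 : 0 < ε' := by positivity
  have hε'z : ε' * ‖latticeVec z‖ ≤ ε := by
    rw [hε', div_mul_eq_mul_div, div_le_iff₀ (by positivity)]
    nlinarith [norm_nonneg (latticeVec z)]
  obtain ⟨C, hC⟩ := mem_growthSpace.1 hv ε' hε'0
  obtain ⟨D, hD0, hD⟩ := hA.exists_norm_le_of_mem_growthSpace hv hε'0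
  have hC0 : 0 < C := hvn.trans_le (by simpa [hA.zero_mulVec] using hC 0)
  refine ⟨|Real.log C| + |Real.log D - Real.log ‖v‖|, fun m => ?_⟩
  have hlv : ‖latticeVec (m • z)‖ = m * ‖latticeVec z‖ := by
    rw [latticeVec_nsmul, norm_smul]; simp
  have hχ : χ (latticeVec (m • z)) = m * χ (latticeVec z) := by
    rw [latticeVec_nsmul, map_smul, smul_eq_mul]
  have hpos : 0 < ‖(A (m • z)).mulVec v‖ := by
    have := hvn.trans_le (hD (m • z))
    exact pos_of_mul_pos_right this (by positivity)
  have hm : (m : ℝ) * (ε' * ‖latticeVec z‖) ≤ m * ε :=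
    mul_le_mul_of_nonneg_left hε'z (Nat.cast_nonneg m)
  have up := Real.log_le_log hpos (hC (m • z))
  rw [Real.log_mul hC0.ne' (Real.exp_pos _).ne', Real.log_exp, hχ, hlv] at up
  have lo := Real.log_le_log hvn (hD (m • z))
  rw [Real.log_mul (by positivity) hpos.ne', Real.log_mul hD0.ne' (Real.exp_pos _).ne',
    Real.log_exp, hχ, hlv] at lo
  rw [abs_le]
  constructor
  · nlinarith [le_abs_self (Real.log D - Real.log ‖v‖), abs_nonneg (Real.log C)]
  · nlinarith [le_abs_self (Real.log C), abs_nonneg (Real.log D - Real.log ‖v‖)]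

/-! ### Volumes of Bowen balls in a growth basis. -/

section Basis

variable {k n : ℕ} {A : (Fin k → ℤ) → Matrix (Fin n) (Fin n) ℝ}
  {b : Module.Basis (Fin n) ℝ (Fin n → ℝ)} {χ : Fin n → Module.Dual ℝ (Fin k → ℝ)}

theorem exists_growth_basis_bound (hb : ∀ j, b j ∈ growthSpace A (χ j)) {ε : ℝ} (hε : 0 < ε) :
    ∃ C : ℝ, 0 < C ∧ ∀ j z, ‖(A z).mulVec (b j)‖ ≤
      C * Real.exp (χ j (latticeVec z) + ε * ‖latticeVec z‖) := by
  choose C hC using fun j => mem_growthSpace.1 (hb j) ε hε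
  refine ⟨1 + ∑ j, |C j|, by positivity, fun j z => (hC j z).trans ?_⟩
  gcongr
  have : |C j| ≤ ∑ j, |C j| := Finset.single_le_sum (fun i _ => abs_nonneg (C i))
    (Finset.mem_univ j)
  linarith [le_abs_self (C j)]

/-- The growth rate of an arbitrary vector is at most the largest exponent. -/
theorem abs_le_sum_of_tendsto (hb : ∀ j, b j ∈ growthSpace A (χ j))
    {ψ : Module.Dual ℝ (Fin k → ℝ)} {v : Fin n → ℝ} (hv0 : v ≠ 0) (hA : IsMatrixRep A)
    (hψ : ∀ z, Tendsto (fun m : ℕ => Real.log ‖(A (m • z)).mulVec v‖ / (m : ℝ)) atTop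
      (𝓝 (ψ (latticeVec z)))) (z : Fin k → ℤ) :
    |ψ (latticeVec z)| ≤ ∑ j, |χ j (latticeVec z)| := by
  have main : ∀ z, ψ (latticeVec z) ≤ ∑ j, |χ j (latticeVec z)| := by
    intro z
    set S := ∑ j, |χ j (latticeVec z)| with hS
    refine le_of_forall_pos_le_add fun ε hε => ?_
    set ε' : ℝ := ε / (‖latticeVec z‖ + 1) with hε'
    have hε'0 : 0 < ε' := by positivity
    have hε'z : ε' * ‖latticeVec z‖ ≤ ε := by
      rw [hε', div_mul_eq_mul_div, div_le_iff₀ (by positivity)]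
      nlinarith [norm_nonneg (latticeVec z)]
    obtain ⟨C, hC0, hC⟩ := exists_growth_basis_bound hb hε'0
    set D := 1 + ∑ j, |b.repr v j| * C with hD
    have hD0 : 0 < D := by positivity
    have hbound : ∀ m : ℕ, ‖(A (m • z)).mulVec v‖ ≤ D * Real.exp (m * (S + ε)) := by
      intro m
      have hv : (A (m • z)).mulVec v = ∑ j, b.repr v j • (A (m • z)).mulVec (b j) := by
        conv_lhs => rw [← b.sum_repr v]
        rw [Matrix.mulVec_sum]
        simp only [Matrix.mulVec_smul]
      rw [hv]
      calc _ ≤ ∑ j, ‖b.repr v j • (A (m • z)).mulVec (b j)‖ := norm_sum_le _ _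
        _ ≤ ∑ j, |b.repr v j| * C * Real.exp (m * (S + ε)) := by
          refine Finset.sum_le_sum fun j _ => ?_
          rw [norm_smul, mul_assoc, Real.norm_eq_abs]
          refine mul_le_mul_of_nonneg_left ((hC j _).trans ?_) (abs_nonneg _)
          refine mul_le_mul_of_nonneg_left (Real.exp_le_exp.2 ?_) hC0.le
          rw [latticeVec_nsmul, map_smul, norm_smul, smul_eq_mul]
          have h1 : χ j (latticeVec z) ≤ S := (le_abs_self _).trans
            (Finset.single_le_sum (f := fun j => |χ j (latticeVec z)|)
              (fun i _ => abs_nonneg _) (Finset.mem_univ j))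
          have h2 : ‖(m : ℝ)‖ = m := by simp
          rw [h2]
          calc (m : ℝ) * χ j (latticeVec z) + ε' * (m * ‖latticeVec z‖) =
              m * (χ j (latticeVec z) + ε' * ‖latticeVec z‖) := by ring
            _ ≤ _ := by gcongr
        _ = (∑ j, |b.repr v j| * C) * Real.exp (m * (S + ε)) := by rw [Finset.sum_mul]
        _ ≤ _ := by gcongr; linarith
    have hlim : Tendsto (fun m : ℕ => Real.log D / m + (S + ε)) atTop (𝓝 (0 + (S + ε))) :=
      (tendsto_const_div_atTop_nhds_zero_nat _).add_const _
    rw [zero_add] at hlim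
    refine le_of_tendsto_of_tendsto (hψ z) hlim ?_
    filter_upwards [eventually_gt_atTop 0] with m hm
    have hm0 : (0 : ℝ) < m := by exact_mod_cast hm
    have hpos : 0 < ‖(A (m • z)).mulVec v‖ := by
      refine norm_pos_iff.2 fun h0 => hv0 ?_
      rw [← hA.neg_mulVec_mulVec (m • z) v, h0, Matrix.mulVec_zero]
    have := Real.log_le_log hpos (hbound m)
    rw [Real.log_mul hD0.ne' (Real.exp_pos _).ne', Real.log_exp] at this
    rw [div_add' _ _ _ hm0.ne', div_le_div_iff_of_pos_right hm0]
    linarith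
  rw [abs_le]
  refine ⟨?_, main z⟩
  -- The sum of absolute values is even, so the upper bound at -z is the lower bound at z.
  have := main (-z)
  simp only [latticeVec_neg, map_neg, abs_neg] at this
  linarith

/-- Lower bound for the volume of a Bowen ball. -/
theorem exists_le_volume_bowen (hb : ∀ j, b j ∈ growthSpace A (χ j)) {ε r : ℝ} (hε : 0 < ε)
    (hr : 0 < r) :
    ∃ c : ℝ, 0 < c ∧ ∀ (F : Set (Fin k → ℤ)) (M : Fin n → ℝ),
      (∀ z ∈ F, ∀ j, χ j (latticeVec z) + ε * ‖latticeVec z‖ ≤ M j) →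
      ENNReal.ofReal (c * Real.exp (-∑ j, M j)) ≤
        volume {u : Fin n → ℝ | ∀ z ∈ F, ‖(A z).mulVec u‖ ≤ r} := by
  obtain ⟨C, hC0, hC⟩ := exists_growth_basis_bound hb hε
  -- A box with sides ρ exp(-M_j) keeps each of the n basis components below ρ C throughout F, and n
  -- ρ C ≤ r.
  set ρ : ℝ := r / (C * (n + 1)) with hρ
  have hρ0 : 0 < ρ := by positivity
  set f : (Fin n → ℝ) →ₗ[ℝ] (Fin n → ℝ) := b.equivFun.toLinearMap with hf
  have hdet : LinearMap.det f ≠ 0 := (LinearEquiv.isUnit_det' b.equivFun).ne_zero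
  refine ⟨|(LinearMap.det f)⁻¹| * (2 * ρ) ^ n, by positivity, fun F M hM => ?_⟩
  set s : Set (Fin n → ℝ) := Set.Icc (fun j => -(ρ * Real.exp (-M j)))
    (fun j => ρ * Real.exp (-M j)) with hs
  have hvol : volume (f ⁻¹' s) =
      ENNReal.ofReal (|(LinearMap.det f)⁻¹| * (2 * ρ) ^ n * Real.exp (-∑ j, M j)) := by
    rw [MeasureTheory.Measure.addHaar_preimage_linearMap _ hdet, hs, Real.volume_Icc_pi,
      ← ENNReal.ofReal_prod_of_nonneg, ← ENNReal.ofReal_mul (abs_nonneg _)]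
    · congr 1
      rw [mul_assoc, ← Finset.sum_neg_distrib, Real.exp_sum]
      congr 1
      rw [show (2 * ρ) ^ n = ∏ _j : Fin n, (2 * ρ) by simp, ← Finset.prod_mul_distrib]
      exact Finset.prod_congr rfl fun j _ => by ring
    · intro j _
      have := Real.exp_pos (-M j)
      have : 0 < ρ * Real.exp (-M j) := by positivity
      linarith
  rw [← hvol]
  refine measure_mono fun u hu z hz => ?_
  have hu' : ∀ j, |b.repr u j| ≤ ρ * Real.exp (-M j) := fun j => by
    rw [abs_le]
    exact ⟨hu.1 j, hu.2 j⟩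
  have hv : (A z).mulVec u = ∑ j, b.repr u j • (A z).mulVec (b j) := by
    conv_lhs => rw [← b.sum_repr u]
    rw [Matrix.mulVec_sum]
    simp only [Matrix.mulVec_smul]
  rw [hv]
  calc _ ≤ ∑ j, ‖b.repr u j • (A z).mulVec (b j)‖ := norm_sum_le _ _
    _ ≤ ∑ _j : Fin n, ρ * C := by
      refine Finset.sum_le_sum fun j _ => ?_
      rw [norm_smul, Real.norm_eq_abs]
      calc _ ≤ ρ * Real.exp (-M j) * (C * Real.exp (M j)) := by
            refine mul_le_mul (hu' j) ((hC j z).trans ?_) (norm_nonneg _) (by positivity)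
            gcongr
            exact hM z hz j
        _ = ρ * C * (Real.exp (-M j) * Real.exp (M j)) := by ring
        _ = _ := by rw [← Real.exp_add]; simp
    _ = n * (ρ * C) := by simp
    _ ≤ r := by
      rw [hρ, div_mul_eq_mul_div, mul_div_assoc', div_le_iff₀ (by positivity)]
      nlinarith [mul_pos hr hC0]

/-- Upper bound for the volume of a Bowen ball, in terms of the growth for the transpose. -/
theorem exists_volume_bowen_le_of_transpose (hA : IsMatrixRep A)
    (hb : ∀ j, b j ∈ growthSpace (fun z => (A z).transpose) (χ j)) {ε r : ℝ} (hε : 0 < ε)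
    (hr : 0 < r) :
    ∃ C : ℝ, 0 < C ∧ ∀ z : Fin k → ℤ,
      volume {u : Fin n → ℝ | ‖u‖ ≤ r ∧ ‖(A z).mulVec u‖ ≤ r} ≤
        ENNReal.ofReal (C * Real.exp (-∑ j, max 0 (χ j (latticeVec z)) + ε * ‖latticeVec z‖)) := by
  set ε' : ℝ := ε / (n + 1) with hε'
  have hε'0 : 0 < ε' := by positivity
  obtain ⟨C, hC0, hC⟩ := exists_growth_basis_bound hb hε'0
  set f : (Fin n → ℝ) →ₗ[ℝ] (Fin n → ℝ) := Matrix.mulVecLin (Matrix.of fun j => b j) with hf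
  have hdet : LinearMap.det f ≠ 0 := by
    have h1 : Function.Injective (Matrix.mulVecLin (Matrix.of fun j => b j)) := by
      rw [Matrix.coe_mulVecLin, Matrix.mulVec_injective_iff_isUnit,
        ← Matrix.linearIndependent_rows_iff_isUnit]
      exact b.linearIndependent
    have h2 := LinearMap.isUnit_iff_ker_eq_bot _ |>.2 (LinearMap.ker_eq_bot.2 h1)
    exact (h2.map LinearMap.det).ne_zero
  set ρ : ℝ := n * C * r with hρ
  refine ⟨1 + |(LinearMap.det f)⁻¹| * (2 * ρ) ^ n, by positivity, fun z => ?_⟩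
  set N := ‖latticeVec z‖ with hN
  set s : Set (Fin n → ℝ) := Set.Icc
    (fun j => -(ρ * Real.exp (-max 0 (χ j (latticeVec z)) + ε' * N)))
    (fun j => ρ * Real.exp (-max 0 (χ j (latticeVec z)) + ε' * N)) with hs
  have hvol : volume (f ⁻¹' s) = ENNReal.ofReal (|(LinearMap.det f)⁻¹| * (2 * ρ) ^ n *
      Real.exp (∑ j, (-max 0 (χ j (latticeVec z)) + ε' * N))) := by
    rw [MeasureTheory.Measure.addHaar_preimage_linearMap _ hdet, hs, Real.volume_Icc_pi,
      ← ENNReal.ofReal_prod_of_nonneg, ← ENNReal.ofReal_mul (abs_nonneg _)]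
    · congr 1
      rw [mul_assoc, Real.exp_sum]
      congr 1
      rw [show (2 * ρ) ^ n = ∏ _j : Fin n, (2 * ρ) by simp, ← Finset.prod_mul_distrib]
      exact Finset.prod_congr rfl fun j _ => by ring
    · intro j _
      have : 0 ≤ ρ * Real.exp (-max 0 (χ j (latticeVec z)) + ε' * N) := by positivity
      linarith
  have hsub : {u : Fin n → ℝ | ‖u‖ ≤ r ∧ ‖(A z).mulVec u‖ ≤ r} ⊆ f ⁻¹' s := by
    rintro u ⟨hu1, hu2⟩
    have hdot : ∀ x y : Fin n → ℝ, |x ⬝ᵥ y| ≤ n * (‖x‖ * ‖y‖) := by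
      intro x y
      calc |∑ i, x i * y i| ≤ ∑ i, |x i * y i| := Finset.abs_sum_le_sum_abs _ _
        _ ≤ ∑ _i : Fin n, ‖x‖ * ‖y‖ := by
          refine Finset.sum_le_sum fun i _ => ?_
          rw [abs_mul]
          exact mul_le_mul (norm_le_pi_norm x i) (norm_le_pi_norm y i) (abs_nonneg _)
            (norm_nonneg _)
        _ = _ := by simp
    have hcoord : ∀ j, |b j ⬝ᵥ u| ≤ ρ * Real.exp (-max 0 (χ j (latticeVec z)) + ε' * N) := by
      intro j
      rcases le_total (χ j (latticeVec z)) 0 with hχ | hχ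
      · rw [max_eq_left hχ]
        refine (hdot _ _).trans ?_
        have h1 : ‖b j‖ ≤ C := by simpa [hA.map_zero] using hC j 0
        have h2 : 1 ≤ Real.exp (-0 + ε' * N) := Real.one_le_exp (by rw [neg_zero]; positivity)
        calc _ ≤ n * (C * r) := by gcongr
          _ = ρ * 1 := by rw [hρ]; ring
          _ ≤ _ := by gcongr
      · rw [max_eq_right hχ]
        -- In an expanding direction the constraint on A_z u is the useful one. Moving the matrix
        -- onto the dual vector gains the factor exp(-χ_j(z)); this is the reason for working with
        -- the transpose.
        have h1 : b j ⬝ᵥ u = ((A (-z)).transpose.mulVec (b j)) ⬝ᵥ ((A z).mulVec u) := by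
          rw [Matrix.mulVec_transpose, ← Matrix.dotProduct_mulVec, hA.neg_mulVec_mulVec]
        have h2 := hC j (-z)
        rw [latticeVec_neg, map_neg, norm_neg] at h2
        rw [h1]
        refine (hdot _ _).trans ?_
        calc _ ≤ n * (C * Real.exp (-χ j (latticeVec z) + ε' * N) * r) := by gcongr
          _ = _ := by rw [hρ]; ring
    exact ⟨fun j => (abs_le.1 (hcoord j)).1, fun j => (abs_le.1 (hcoord j)).2⟩
  refine (measure_mono hsub).trans ?_
  rw [hvol]
  apply ENNReal.ofReal_le_ofReal
  gcongr
  · linarith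
  · rw [Finset.sum_add_distrib, Finset.sum_neg_distrib]
    have : ∑ _j : Fin n, ε' * N ≤ ε * N := by
      simp only [Finset.sum_const, Finset.card_univ, Fintype.card_fin, nsmul_eq_mul, ← mul_assoc]
      refine mul_le_mul_of_nonneg_right ?_ (norm_nonneg _)
      rw [hε', mul_div_assoc', div_le_iff₀ (by positivity)]
      nlinarith
    linarith

end Basis

theorem dual_eq_zero_of_latticeVec {k : ℕ} {χ : Module.Dual ℝ (Fin k → ℝ)}
    (h : ∀ z : Fin k → ℤ, χ (latticeVec z) = 0) : χ = 0 := by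
  refine LinearMap.pi_ext' fun i => LinearMap.ext_ring ?_
  have := h (Pi.single i 1)
  have h2 : latticeVec (Pi.single i (1 : ℤ)) = Pi.single i (1 : ℝ) := by
    ext j; by_cases hj : j = i
    · subst hj; simp [latticeVec]
    · simp [latticeVec, hj]
  rw [h2] at this
  simpa using this

section Basis

variable {k n : ℕ} {A : (Fin k → ℤ) → Matrix (Fin n) (Fin n) ℝ}
  {b : Module.Basis (Fin n) ℝ (Fin n → ℝ)} {χ : Fin n → Module.Dual ℝ (Fin k → ℝ)}

theorem exists_small_mul_le (N : ℝ) (hN : 0 ≤ N) {ε : ℝ} (hε : 0 < ε) :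
    ∃ ε' : ℝ, 0 < ε' ∧ ε' * N ≤ ε := by
  refine ⟨ε / (N + 1), by positivity, ?_⟩
  rw [div_mul_eq_mul_div, div_le_iff₀ (by positivity)]
  nlinarith

/-- The exponents of a unimodular representation sum to zero. -/
theorem sum_exponents_eq_zero (hb : ∀ j, b j ∈ growthSpace A (χ j))
    (hdet : ∀ z, |(A z).det| = 1) : ∑ j, χ j = 0 := by
  have key : ∀ z : Fin k → ℤ, -∑ j, χ j (latticeVec z) ≤ 0 := by
    intro z
    apply le_of_forall_nat_mul_le
    intro ε hε
    obtain ⟨ε', hε'0, hε'⟩ := exists_small_mul_le (n * ‖latticeVec z‖) (by positivity) hε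
    obtain ⟨c, hc0, hc⟩ := exists_le_volume_bowen hb hε'0 one_pos
    set V := (volume (Metric.closedBall (0 : Fin n → ℝ) 1)).toReal with hV
    have hVtop : volume (Metric.closedBall (0 : Fin n → ℝ) 1) ≠ ∞ :=
      (isCompact_closedBall _ _).measure_lt_top.ne
    refine ⟨Real.log V - Real.log c, fun m => ?_⟩
    -- For a single time the Bowen ball is the preimage of the unit ball, whose volume does not
    -- depend on m since |det| = 1. Letting m grow gives one inequality, and -z gives the other.
    have h1 := hc {m • z} (fun j => χ j (latticeVec (m • z)) + ε' * ‖latticeVec (m • z)‖)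
      (fun w hw j => by rw [Set.mem_singleton_iff.1 hw])
    have h2 : {u : Fin n → ℝ | ∀ w ∈ ({m • z} : Set (Fin k → ℤ)), ‖(A w).mulVec u‖ ≤ 1} =
        (Matrix.toLin' (A (m • z))) ⁻¹' Metric.closedBall 0 1 := by
      ext u; simp
    have hd : LinearMap.det (Matrix.toLin' (A (m • z))) = (A (m • z)).det :=
      LinearMap.det_toLin' _
    rw [h2, MeasureTheory.Measure.addHaar_preimage_linearMap _ (by
      rw [hd]; intro h0; have := hdet (m • z); rw [h0] at this; simp at this), hd, abs_inv,
      hdet, inv_one, ENNReal.ofReal_one, one_mul, ENNReal.ofReal_le_iff_le_toReal hVtop, ← hV]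
      at h1
    have h3 := Real.log_le_log (by positivity) h1
    rw [Real.log_mul hc0.ne' (Real.exp_pos _).ne', Real.log_exp, Finset.sum_add_distrib] at h3
    simp only [latticeVec_nsmul] at h3
    simp only [map_smul, smul_eq_mul, norm_smul, Finset.sum_const,
      Finset.card_univ, Fintype.card_fin, nsmul_eq_mul, ← Finset.mul_sum, Real.norm_natCast] at h3
    have h4 : (m : ℝ) * (ε' * (n * ‖latticeVec z‖)) ≤ m * ε :=
      mul_le_mul_of_nonneg_left hε' (Nat.cast_nonneg m)
    nlinarith
  apply dual_eq_zero_of_latticeVec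
  intro z
  have h1 := key z
  have h2 := key (-z)
  simp only [latticeVec_neg, map_neg, Finset.sum_neg_distrib, LinearMap.sum_apply] at h1 h2 ⊢
  linarith

/-- The positive parts of the exponents of the transpose are bounded by those of `A`. -/
theorem sum_pos_exponents_transpose_le (hA : IsMatrixRep A)
    (hb : ∀ j, b j ∈ growthSpace A (χ j)) {b' : Module.Basis (Fin n) ℝ (Fin n → ℝ)}
    {χ' : Fin n → Module.Dual ℝ (Fin k → ℝ)}
    (hb' : ∀ j, b' j ∈ growthSpace (fun z => (A z).transpose) (χ' j)) (z : Fin k → ℤ) :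
    ∑ j, max 0 (χ' j (latticeVec z)) ≤ ∑ j, max 0 (χ j (latticeVec z)) := by
  apply le_of_forall_nat_mul_le
  intro ε hε
  obtain ⟨ε', hε'0, hε'⟩ := exists_small_mul_le ((n + 1) * ‖latticeVec z‖) (by positivity) hε
  obtain ⟨c, hc0, hc⟩ := exists_le_volume_bowen hb hε'0 one_pos
  obtain ⟨C, hC0, hC⟩ := exists_volume_bowen_le_of_transpose hA hb' hε'0 one_pos
  refine ⟨Real.log C - Real.log c, fun m => ?_⟩
  -- The same two-time Bowen ball is bounded below through the exponents of A and above through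
  -- those of the transpose; comparing rates as m grows yields the inequality.
  have h1 := hc {0, m • z}
    (fun j => max 0 (χ j (latticeVec (m • z))) + ε' * ‖latticeVec (m • z)‖) (fun w hw j => by
      rcases hw with rfl | hw
      · simp only [latticeVec_zero, map_zero, norm_zero, mul_zero, add_zero]
        positivity
      · rw [Set.mem_singleton_iff.1 hw]
        gcongr
        exact le_max_right _ _)
  have h2 : {u : Fin n → ℝ | ∀ w ∈ ({0, m • z} : Set (Fin k → ℤ)), ‖(A w).mulVec u‖ ≤ 1} =
      {u : Fin n → ℝ | ‖u‖ ≤ 1 ∧ ‖(A (m • z)).mulVec u‖ ≤ 1} := by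
    ext u; simp [hA.map_zero]
  rw [h2] at h1
  have h3 := h1.trans (hC (m • z))
  rw [ENNReal.ofReal_le_ofReal_iff (by positivity)] at h3
  have h4 := Real.log_le_log (by positivity) h3
  rw [Real.log_mul hc0.ne' (Real.exp_pos _).ne', Real.log_exp,
    Real.log_mul hC0.ne' (Real.exp_pos _).ne', Real.log_exp, Finset.sum_add_distrib] at h4
  have hmax : ∀ x : ℝ, max 0 ((m : ℝ) * x) = m * max 0 x := fun x => by
    rw [mul_max_of_nonneg _ _ (Nat.cast_nonneg m), mul_zero]
  simp only [latticeVec_nsmul] at h4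
  simp only [map_smul, smul_eq_mul, norm_smul, Finset.sum_const, hmax,
    Finset.card_univ, Fintype.card_fin, nsmul_eq_mul, ← Finset.mul_sum, Real.norm_natCast] at h4
  have h5 : (m : ℝ) * (ε' * ((n + 1) * ‖latticeVec z‖)) ≤ m * ε :=
    mul_le_mul_of_nonneg_left hε' (Nat.cast_nonneg m)
  nlinarith

/-- Upper bound for the volume of a Bowen ball. -/
theorem exists_volume_bowen_le (hA : IsMatrixRep A) (hb : ∀ j, b j ∈ growthSpace A (χ j))
    {ε r : ℝ} (hε : 0 < ε) (hr : 0 < r) :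
    ∃ C : ℝ, 0 < C ∧ ∀ z : Fin k → ℤ,
      volume {u : Fin n → ℝ | ‖u‖ ≤ r ∧ ‖(A z).mulVec u‖ ≤ r} ≤
        ENNReal.ofReal (C * Real.exp (-∑ j, max 0 (χ j (latticeVec z)) + ε * ‖latticeVec z‖)) := by
  obtain ⟨b', χ', hb'⟩ := hA.transpose.exists_growth_basis
  obtain ⟨C, hC0, hC⟩ := exists_volume_bowen_le_of_transpose hA hb' hε hr
  refine ⟨C, hC0, fun z => (hC z).trans (ENNReal.ofReal_le_ofReal ?_)⟩
  -- The comparison is used for the transposed representation, with A as its transpose, because the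
  -- opposite inequality is needed here.
  have h := sum_pos_exponents_transpose_le hA.transpose hb' (b' := b) (χ' := χ)
    (by simpa using hb) z
  gcongr

end Basis

/-! ### The seminorm of the exponents. -/

/-- Half the sum of the absolute values of the exponents: when the exponents sum to zero, this is
the sum of their positive parts. -/
noncomputable def exponentSeminorm {k n : ℕ} (χ : Fin n → Module.Dual ℝ (Fin k → ℝ)) :
    Seminorm ℝ (Fin k → ℝ) :=
  Seminorm.of (fun t => (1 / 2) * ∑ j, |χ j t|)
    (fun s t => by
      rw [← mul_add, ← Finset.sum_add_distrib]
      gcongr with j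
      rw [map_add]
      exact abs_add_le _ _)
    (fun a t => by
      simp only [map_smul, smul_eq_mul, abs_mul, ← Finset.mul_sum, Real.norm_eq_abs]
      ring)

theorem exponentSeminorm_apply {k n : ℕ} (χ : Fin n → Module.Dual ℝ (Fin k → ℝ))
    (t : Fin k → ℝ) : exponentSeminorm χ t = (1 / 2) * ∑ j, |χ j t| := rfl

theorem sum_max_zero_eq_exponentSeminorm {k n : ℕ} {χ : Fin n → Module.Dual ℝ (Fin k → ℝ)}
    (h : ∑ j, χ j = 0) (t : Fin k → ℝ) : ∑ j, max 0 (χ j t) = exponentSeminorm χ t := by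
  have h1 : ∑ j, χ j t = 0 := by
    rw [← LinearMap.sum_apply, h, LinearMap.zero_apply]
  have h2 : ∀ x : ℝ, max 0 x = (1 / 2) * |x| + (1 / 2) * x := fun x => by
    rcases le_total x 0 with hx | hx
    · rw [max_eq_left hx, abs_of_nonpos hx]; ring
    · rw [max_eq_right hx, abs_of_nonneg hx]; ring
  simp only [h2, Finset.sum_add_distrib, ← Finset.mul_sum, h1, exponentSeminorm_apply]
  ring

theorem exponentSeminorm_eq_zero_iff {k n : ℕ} {χ : Fin n → Module.Dual ℝ (Fin k → ℝ)}
    {t : Fin k → ℝ} : exponentSeminorm χ t = 0 ↔ ∀ j, χ j t = 0 := by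
  rw [exponentSeminorm_apply, mul_eq_zero, or_iff_right (by norm_num),
    Finset.sum_eq_zero_iff_of_nonneg (fun j _ => abs_nonneg _)]
  simp

/-- A seminorm on `ℝ^k` is bounded by a multiple of the norm. -/
theorem Seminorm.exists_le_mul_norm {k : ℕ} (p : Seminorm ℝ (Fin k → ℝ)) :
    ∃ C : ℝ, 0 < C ∧ ∀ x, p x ≤ C * ‖x‖ := by
  refine ⟨1 + ∑ i, p (Pi.single i 1), by positivity, fun x => ?_⟩
  have hx : x = ∑ i, x i • Pi.single i (1 : ℝ) := by
    ext j; simp [Finset.sum_apply, Pi.single_apply]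
  have : p x ≤ ∑ i, ‖x‖ * p (Pi.single i 1) := by
    conv_lhs => rw [hx]
    refine (Finset.le_sum_of_subadditive p (map_zero p).le (map_add_le_add p) _ _).trans
      (Finset.sum_le_sum fun i _ => ?_)
    rw [map_smul_eq_mul]
    exact mul_le_mul_of_nonneg_right (norm_le_pi_norm x i) (apply_nonneg _ _)
  rw [← Finset.mul_sum] at this
  nlinarith [norm_nonneg x]

/-- A linear functional dominated by a seminorm on the lattice is dominated everywhere. -/
theorem abs_le_seminorm_of_latticeVec {k : ℕ} (p : Seminorm ℝ (Fin k → ℝ))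
    (ψ : Module.Dual ℝ (Fin k → ℝ)) (h : ∀ z : Fin k → ℤ, |ψ (latticeVec z)| ≤ p (latticeVec z))
    (t : Fin k → ℝ) : |ψ t| ≤ p t := by
  obtain ⟨C, hC0, hC⟩ := p.exists_le_mul_norm
  obtain ⟨D, hD0, hD⟩ := (normSeminorm ℝ ℝ |>.comp ψ).exists_le_mul_norm
  apply le_of_forall_nat_mul_le
  intro ε hε
  refine ⟨C + D, fun m => ?_⟩
  -- Rounding m t to the lattice costs a bounded amount on both sides, which disappears after
  -- division by m.
  set z : Fin k → ℤ := fun i => ⌊(m : ℝ) * t i⌋ with hz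
  have hd : ‖(m : ℝ) • t - latticeVec z‖ ≤ 1 := by
    rw [pi_norm_le_iff_of_nonneg zero_le_one]
    intro i
    simp only [Pi.sub_apply, Pi.smul_apply, smul_eq_mul, latticeVec, hz, Real.norm_eq_abs]
    rw [abs_of_nonneg (Int.fract_nonneg _)]
    exact (Int.fract_lt_one _).le
  have h1 : (m : ℝ) * |ψ t| = |ψ ((m : ℝ) • t)| := by
    rw [map_smul, smul_eq_mul, abs_mul, Nat.abs_cast]
  have h2 : (m : ℝ) * p t = p ((m : ℝ) • t) := by
    rw [map_smul_eq_mul, Real.norm_natCast]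
  have h3 : |ψ ((m : ℝ) • t)| ≤ |ψ (latticeVec z)| + D := by
    have := hD ((m : ℝ) • t - latticeVec z)
    simp only [Seminorm.comp_apply, coe_normSeminorm, map_sub, Real.norm_eq_abs] at this
    have h5 := abs_sub_abs_le_abs_sub (ψ ((m : ℝ) • t)) (ψ (latticeVec z))
    nlinarith
  have h4 : p (latticeVec z) ≤ p ((m : ℝ) • t) + C := by
    have h5 := hC ((m : ℝ) • t - latticeVec z)
    have h6 := abs_sub_map_le_sub p ((m : ℝ) • t) (latticeVec z)
    have := (abs_le.1 h6).1
    nlinarith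
  have h5 : 0 ≤ ε * m := by positivity
  rw [h1, h2]
  linarith [h z]

/-! ### The covering map of the torus -/

/-- The covering map `ℝ^n → 𝕋^n`. -/
def torusMk {n : ℕ} (u : Fin n → ℝ) : UnitAddTorus (Fin n) := fun i => (u i : UnitAddCircle)

section TorusMk

variable {n : ℕ}

theorem torusMk_sub (u v : Fin n → ℝ) : torusMk (u - v) = torusMk u - torusMk v := by
  ext i; simp [torusMk]

theorem continuous_torusMk : Continuous (torusMk (n := n)) :=
  continuous_pi fun i => (AddCircle.continuous_mk' 1).comp (continuous_apply i)

theorem norm_torusMk_le (u : Fin n → ℝ) : ‖torusMk u‖ ≤ ‖u‖ := by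
  rw [pi_norm_le_iff_of_nonneg (norm_nonneg _)]
  intro i
  refine le_trans ?_ (norm_le_pi_norm u i)
  exact QuotientAddGroup.norm_mk_le_norm

/-- Two lifts of a point differ by an integer vector, and such a vector of sup norm below 1 is zero.
-/
theorem eq_of_torusMk_eq {u v : Fin n → ℝ} (h : torusMk u = torusMk v) (hlt : ‖u - v‖ < 1) :
    u = v := by
  ext i
  have hi : ((u i - v i : ℝ) : UnitAddCircle) = 0 := by
    have := congrFun h i
    simp only [torusMk] at this
    rw [AddCircle.coe_sub, this, sub_self]
  obtain ⟨m, hm⟩ := (AddCircle.coe_eq_zero_iff (1 : ℝ)).1 hi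
  have h1 : |u i - v i| < 1 := (norm_le_pi_norm (u - v) i).trans_lt hlt
  have h2 : u i - v i = m := by rw [← hm]; simp
  rw [h2] at h1
  have h3 : |m| < 1 := by exact_mod_cast h1
  have h4 : m = 0 := Int.abs_lt_one_iff.1 h3
  rw [h4] at h2
  simp only [Int.cast_zero] at h2
  linarith

theorem measurePreserving_torusMk : MeasurePreserving (torusMk (n := n))
    (volume.restrict (Set.univ.pi fun _ => Set.Ioc (-(1 / 2) : ℝ) (1 / 2))) volume := by
  have h1 : ∀ _i : Fin n, MeasurePreserving (fun x : ℝ => (x : UnitAddCircle))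
      (volume.restrict (Set.Ioc (-(1 / 2) : ℝ) (1 / 2))) volume := fun _ => by
    have := AddCircle.measurePreserving_mk 1 (-(1 / 2) : ℝ)
    rwa [show (-(1 / 2) : ℝ) + 1 = 1 / 2 by norm_num] at this
  have h2 :=
      measurePreserving_pi (fun _ : Fin n => volume.restrict (Set.Ioc (-(1 / 2) : ℝ) (1 / 2)))
    (fun _ => (volume : Measure UnitAddCircle)) h1
  rw [← Measure.restrict_pi_pi] at h2
  exact h2

instance : IsProbabilityMeasure (volume : Measure (UnitAddTorus (Fin n))) := by
  have : IsProbabilityMeasure (volume : Measure UnitAddCircle) :=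
    ⟨by rw [AddCircle.measure_univ]; simp⟩
  exact inferInstanceAs
    (IsProbabilityMeasure (Measure.pi fun _ : Fin n => (volume : Measure UnitAddCircle)))

/-- Translated images of small compact sets have the same volume. -/
theorem volume_image_add_torusMk {K : Set (Fin n → ℝ)} (hK : IsCompact K)
    (hs : ∀ u ∈ K, ‖u‖ < 1 / 2) (x : UnitAddTorus (Fin n)) :
    volume ((fun u => x + torusMk u) '' K) = volume K := by
  have h1 : (fun u => x + torusMk u) '' K = (fun y => x + y) '' (torusMk '' K) := by
    rw [Set.image_image]
  have hcomp : MeasurableSet (torusMk '' K) := (hK.image continuous_torusMk).measurableSet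
  rw [h1, Set.image_add_left, measure_preimage_add,
    ← measurePreserving_torusMk.measure_preimage hcomp.nullMeasurableSet,
    Measure.restrict_apply (measurePreserving_torusMk.measurable hcomp)]
  -- It remains to see that, within the fundamental cube, only K itself maps into the image of K:
  -- two lifts in the open and the half-open cube are closer than 1.
  congr 1
  ext u
  constructor
  · rintro ⟨⟨v, hv, hvu⟩, hu⟩
    have hlt : ‖v - u‖ < 1 := by
      rw [pi_norm_lt_iff one_pos]
      intro i
      have h2 : |v i| < 1 / 2 := (norm_le_pi_norm v i).trans_lt (hs v hv)
      have h3 := hu i (Set.mem_univ i)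
      rw [abs_lt] at h2
      rw [Pi.sub_apply, Real.norm_eq_abs, abs_lt]
      constructor <;> linarith [h3.1, h3.2]
    rwa [← eq_of_torusMk_eq hvu hlt]
  · intro hu
    refine ⟨⟨u, hu, rfl⟩, fun i _ => ?_⟩
    have h2 : |u i| < 1 / 2 := (norm_le_pi_norm u i).trans_lt (hs u hu)
    rw [abs_lt] at h2
    exact ⟨h2.1, h2.2.le⟩

/-- A finite measurable partition of the torus of small mesh. -/
theorem exists_torus_partition (n : ℕ) {r : ℝ} (hr : 0 < r) :
    ∃ (N : ℕ) (Q : UnitAddTorus (Fin n) → Fin N), Measurable Q ∧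
      ∀ x y, Q x = Q y → ∃ u : Fin n → ℝ, ‖u‖ ≤ r ∧ y = x + torusMk u := by
  obtain ⟨M, hM⟩ := exists_nat_gt (1 / r)
  have hM0 : (0 : ℝ) < M := lt_trans (by positivity) hM
  let rep : UnitAddCircle → ℝ := fun y => (AddCircle.measurableEquivIco 1 0 y : ℝ)
  have hrep : Measurable rep :=
      measurable_subtype_coe.comp (AddCircle.measurableEquivIco 1 0).measurable
  have hrepIco : ∀ y, 0 ≤ rep y ∧ rep y < 1 := fun y => by
    have := (AddCircle.measurableEquivIco 1 0 y).2
    simpa using this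
  have hmk : ∀ y, ((rep y : ℝ) : UnitAddCircle) = y := fun y =>
    (AddCircle.measurableEquivIco 1 0).symm_apply_apply y
  have hlt : ∀ y, ⌊(M : ℝ) * rep y⌋₊ < M := fun y => by
    rw [Nat.floor_lt (mul_nonneg hM0.le (hrepIco y).1)]
    nlinarith [(hrepIco y).2]
  let Q0 : UnitAddTorus (Fin n) → (Fin n → Fin M) := fun x i => ⟨⌊(M : ℝ) * rep (x i)⌋₊, hlt _⟩
  have hQ0 : Measurable Q0 := by
    refine measurable_pi_lambda _ fun i => ?_
    have h1 : Measurable fun x : UnitAddTorus (Fin n) => ⌊(M : ℝ) * rep (x i)⌋₊ :=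
      Nat.measurable_floor.comp ((hrep.comp (measurable_pi_apply i)).const_mul _)
    refine measurable_to_countable' fun a => ?_
    have : (fun x => Q0 x i) ⁻¹' {a} =
        (fun x : UnitAddTorus (Fin n) => ⌊(M : ℝ) * rep (x i)⌋₊) ⁻¹' {(a : ℕ)} := by
      ext x; simp [Q0, Fin.ext_iff]
    rw [this]
    exact h1 (measurableSet_singleton _)
  let e := Fintype.equivFin (Fin n → Fin M)
  refine ⟨_, fun x => e (Q0 x), (measurable_of_finite e).comp hQ0, fun x y hxy => ?_⟩
  have hxy' : Q0 x = Q0 y := e.injective hxy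
  refine ⟨fun i => rep (y i) - rep (x i), ?_, ?_⟩
  · rw [pi_norm_le_iff_of_nonneg hr.le]
    intro i
    have h1 : ⌊(M : ℝ) * rep (x i)⌋₊ = ⌊(M : ℝ) * rep (y i)⌋₊ := by
      simpa [Q0, Fin.ext_iff] using congrFun hxy' i
    have a1 := Nat.floor_le (mul_nonneg hM0.le (hrepIco (x i)).1)
    have a2 := Nat.lt_floor_add_one ((M : ℝ) * rep (x i))
    have b1 := Nat.floor_le (mul_nonneg hM0.le (hrepIco (y i)).1)
    have b2 := Nat.lt_floor_add_one ((M : ℝ) * rep (y i))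
    rw [h1] at a1 a2
    have h2 : |(M : ℝ) * (rep (y i) - rep (x i))| ≤ 1 := by
      rw [abs_le]; constructor <;> linarith
    rw [abs_mul, abs_of_pos hM0] at h2
    have h3 : 1 < M * r := by rwa [div_lt_iff₀ hr] at hM
    rw [Real.norm_eq_abs]
    by_contra! hlt'
    nlinarith
  · ext i
    simp [torusMk, hmk]

end TorusMk

/-! ### Linear parts, cylinders and Bowen covers on the torus. -/

namespace AffineTorusAction

variable {k n : ℕ} (α : AffineTorusAction k n)

/-- The linear part of `α(z)` as a real matrix. -/
def linReal (z : Fin k → ℤ) : Matrix (Fin n) (Fin n) ℝ :=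
  (α.lin z).map (fun a : ℤ => (a : ℝ))

/-- The bridge between torus and linear algebra: displacements evolve by the linear part alone, so
the translations b_z never enter the estimates. -/
theorem act_add_torusMk (z : Fin k → ℤ) (x : UnitAddTorus (Fin n)) (u : Fin n → ℝ) :
    α.act z (x + torusMk u) = α.act z x + torusMk ((α.linReal z).mulVec u) := by
  ext i
  have h : ((∑ j, (α.lin z i j : ℝ) * u j : ℝ) : UnitAddCircle) =
      ∑ j, α.lin z i j • (u j : UnitAddCircle) := by
    rw [← QuotientAddGroup.mk'_apply, map_sum]
    refine Finset.sum_congr rfl fun j _ => ?_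
    rw [← zsmul_eq_mul, map_zsmul, QuotientAddGroup.mk'_apply]
  simp only [act, torusAffineMap, torusMk, Pi.add_apply, smul_add, Finset.sum_add_distrib,
    linReal, Matrix.mulVec, dotProduct, Matrix.map_apply, h]
  abel

/-- A real linear map that induces the zero map on the torus vanishes. -/
theorem _root_.eq_zero_of_forall_torusMk_mulVec {B : Matrix (Fin n) (Fin n) ℝ}
    (h : ∀ u, torusMk (B.mulVec u) = 0) : B = 0 := by
  have hz : ∀ u, B.mulVec u = 0 := by
    intro u
    -- Scaling makes B(cu) shorter than 1, where the lift of 0 is unique.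
    set c : ℝ := (‖B.mulVec u‖ + 1)⁻¹ with hc
    have hc0 : 0 < c := by positivity
    have h1 : torusMk (B.mulVec (c • u)) = torusMk (0 : Fin n → ℝ) := by
      rw [h]; ext i; simp [torusMk]
    have h2 : ‖B.mulVec (c • u) - 0‖ < 1 := by
      rw [sub_zero, Matrix.mulVec_smul, norm_smul, Real.norm_eq_abs, abs_of_pos hc0, hc,
        inv_mul_lt_iff₀ (by positivity)]
      linarith
    have h3 := eq_of_torusMk_eq h1 h2
    rw [Matrix.mulVec_smul] at h3
    exact (smul_eq_zero.1 h3).resolve_left hc0.ne'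
  ext i j
  have := congrFun (hz (Pi.single j 1)) i
  simpa using this

theorem isMatrixRep_linReal : IsMatrixRep α.linReal where
  map_zero := by
    rw [← sub_eq_zero]
    refine eq_zero_of_forall_torusMk_mulVec fun u => ?_
    have h := α.act_add_torusMk 0 0 u
    rw [α.act_zero, α.act_zero] at h
    rw [Matrix.sub_mulVec, Matrix.one_mulVec, torusMk_sub, ← add_left_cancel h, sub_self]
  map_add z w := by
    rw [← sub_eq_zero]
    refine eq_zero_of_forall_torusMk_mulVec fun u => ?_
    have h := α.act_add_torusMk (z + w) 0 u
    rw [α.act_add, α.act_add, α.act_add_torusMk w, α.act_add_torusMk z] at h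
    rw [Matrix.sub_mulVec, ← Matrix.mulVec_mulVec, torusMk_sub, add_left_cancel h, sub_self]

/-- The determinants at z and -z are integers with product 1. -/
theorem abs_det_linReal (z : Fin k → ℤ) : |(α.linReal z).det| = 1 := by
  have hdet : ∀ w, (α.linReal w).det = ((α.lin w).det : ℝ) := fun w =>
    ((Int.castRingHom ℝ).map_det (α.lin w)).symm
  have h : (α.linReal z).det * (α.linReal (-z)).det = 1 := by
    rw [← Matrix.det_mul, ← α.isMatrixRep_linReal.map_add, add_neg_cancel,
      α.isMatrixRep_linReal.map_zero, Matrix.det_one]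
  rw [hdet, hdet] at h
  have h2 : (α.lin z).det * (α.lin (-z)).det = 1 := by exact_mod_cast h
  rw [hdet, ← Int.cast_abs, Int.isUnit_iff_abs_eq.1 (IsUnit.of_mul_eq_one _ h2), Int.cast_one]

theorem continuous_act (z : Fin k → ℤ) : Continuous (α.act z) := by
  refine continuous_pi fun i => ?_
  simp only [act, torusAffineMap]
  fun_prop

theorem measurable_act (z : Fin k → ℤ) : Measurable (α.act z) := (α.continuous_act z).measurable

/-- Subtracting the value at 0 leaves a continuous surjective endomorphism of a compact group, which
preserves Haar measure; a translation does the rest. -/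
theorem measurePreserving_act (z : Fin k → ℤ) : MeasurePreserving (α.act z) volume volume := by
  let f : UnitAddTorus (Fin n) →+ UnitAddTorus (Fin n) :=
    { toFun := fun x => α.act z x - α.act z 0
      map_zero' := sub_self _
      map_add' := fun x y => by
        ext i
        simp only [act, torusAffineMap, Pi.sub_apply, Pi.add_apply, smul_add,
          Finset.sum_add_distrib, Pi.zero_apply, smul_zero, Finset.sum_const_zero]
        abel }
  have hf : Function.Surjective f := by
    intro y
    refine ⟨α.act (-z) (y + α.act z 0), ?_⟩
    simp only [f, AddMonoidHom.coe_mk, ZeroHom.coe_mk]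
    rw [← α.act_add, add_neg_cancel, α.act_zero, add_sub_cancel_right]
  have hfc : Continuous f := (α.continuous_act z).sub continuous_const
  have h1 : MeasurePreserving f (volume : Measure (UnitAddTorus (Fin n))) volume :=
    AddMonoidHom.measurePreserving hfc hf rfl
  have h2 := (measurePreserving_add_right (volume : Measure (UnitAddTorus (Fin n)))
    (α.act z 0)).comp h1
  convert h2 using 1
  ext1 x
  simp [f]

/-- Exponents with multiplicity, together with the volume estimates for Bowen balls. -/
structure IsExponentSystem (χ : Fin n → Module.Dual ℝ (Fin k → ℝ)) : Prop where
  sum_eq_zero : ∑ j, χ j = 0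
  isLyapunovExponent : ∀ j, α.IsLyapunovExponent (χ j)
  abs_le : ∀ ψ, α.IsLyapunovExponent ψ → ∀ t, |ψ t| ≤ 2 * exponentSeminorm χ t
  le_volume : ∀ {ε r : ℝ}, 0 < ε → 0 < r → ∃ c : ℝ, 0 < c ∧
    ∀ (F : Set (Fin k → ℤ)) (M : Fin n → ℝ),
      (∀ z ∈ F, ∀ j, χ j (latticeVec z) + ε * ‖latticeVec z‖ ≤ M j) →
      ENNReal.ofReal (c * Real.exp (-∑ j, M j)) ≤
        volume {u : Fin n → ℝ | ∀ z ∈ F, ‖(α.linReal z).mulVec u‖ ≤ r}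
  volume_le : ∀ {ε r : ℝ}, 0 < ε → 0 < r → ∃ C : ℝ, 0 < C ∧ ∀ z : Fin k → ℤ,
      volume {u : Fin n → ℝ | ‖u‖ ≤ r ∧ ‖(α.linReal z).mulVec u‖ ≤ r} ≤
        ENNReal.ofReal (C * Real.exp (-exponentSeminorm χ (latticeVec z) + ε * ‖latticeVec z‖))

theorem exists_isExponentSystem : ∃ χ, α.IsExponentSystem χ := by
  have hA := α.isMatrixRep_linReal
  obtain ⟨b, χ, hb⟩ := hA.exists_growth_basis
  have hsum := sum_exponents_eq_zero hb α.abs_det_linReal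
  refine ⟨χ, hsum, fun j => ⟨b j, b.ne_zero j, fun z =>
    hA.tendsto_of_mem_growthSpace (hb j) (b.ne_zero j) z⟩, ?_, ?_, ?_⟩
  · rintro ψ ⟨v, hv0, hv⟩ t
    refine abs_le_seminorm_of_latticeVec ((2 : NNReal) • exponentSeminorm χ) ψ (fun z => ?_) t
    refine (abs_le_sum_of_tendsto hb hv0 hA hv z).trans (le_of_eq ?_)
    rw [smul_apply, exponentSeminorm_apply]
    simp [NNReal.smul_def]
  · exact fun hε hr => exists_le_volume_bowen hb hε hr
  · intro ε r hε hr
    obtain ⟨C, hC0, hC⟩ := exists_volume_bowen_le hA hb hε hr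
    refine ⟨C, hC0, fun z => ?_⟩
    rw [← sum_max_zero_eq_exponentSeminorm hsum]
    exact hC z

/-- Points with the same itinerary along a path with bounded steps differ by a vector that stays
small along the path. -/
theorem exists_mulVec_le_of_itinerary_eq {N : ℕ} {Q : UnitAddTorus (Fin n) → Fin N} {r L : ℝ}
    (hQ : ∀ x y, Q x = Q y → ∃ u : Fin n → ℝ, ‖u‖ ≤ r ∧ y = x + torusMk u)
    (hL : 0 ≤ L) (hLr : (L + 1) * r < 1) (z : ℕ → Fin k → ℤ) (hz0 : z 0 = 0)
    (hz : ∀ j u, ‖(α.linReal (z (j + 1))).mulVec u‖ ≤ L * ‖(α.linReal (z j)).mulVec u‖)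
    (x y : UnitAddTorus (Fin n)) (m : ℕ) (hm : 0 < m)
    (h : ∀ j < m, Q (α.act (z j) x) = Q (α.act (z j) y)) :
    ∃ u : Fin n → ℝ, y = x + torusMk u ∧ ∀ j < m, ‖(α.linReal (z j)).mulVec u‖ ≤ r := by
  have h0 := h 0 hm
  rw [hz0, α.act_zero, α.act_zero] at h0
  obtain ⟨u, hu, hy⟩ := hQ _ _ h0
  refine ⟨u, hy, fun j => ?_⟩
  induction j with
  | zero => intro _; rwa [hz0, α.isMatrixRep_linReal.zero_mulVec]
  | succ j ih =>
    intro hj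
    have ihj := ih (by omega)
    obtain ⟨v, hv, hvy⟩ := hQ _ _ (h (j + 1) hj)
    rw [hy, α.act_add_torusMk] at hvy
    have h1 := add_left_cancel hvy
    have h2 : ‖(α.linReal (z (j + 1))).mulVec u‖ ≤ L * r :=
      (hz j u).trans (mul_le_mul_of_nonneg_left ihj hL)
    -- The moved vector has length at most L r and the displacement read off from the partition at
    -- most r. Both lift the same difference, so (L + 1) r < 1 identifies them and the bound r is
    -- restored.
    rw [eq_of_torusMk_eq h1 ((norm_sub_le _ _).trans_lt (by linarith))]
    exact hv

/-- The measure of a cylinder is at most the volume of a Bowen ball. -/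
theorem volume_cylinder_le {N : ℕ} {Q : UnitAddTorus (Fin n) → Fin N} {r L : ℝ}
    (hQ : ∀ x y, Q x = Q y → ∃ u : Fin n → ℝ, ‖u‖ ≤ r ∧ y = x + torusMk u)
    (hL : 1 ≤ L) (hLr : (L + 1) * r < 1) (z : ℕ → Fin k → ℤ) (hz0 : z 0 = 0)
    (hz : ∀ j u, ‖(α.linReal (z (j + 1))).mulVec u‖ ≤ L * ‖(α.linReal (z j)).mulVec u‖)
    (m : ℕ) (w : Fin (m + 1) → Fin N) :
    volume {x | ∀ i : Fin (m + 1), Q (α.act (z i) x) = w i} ≤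
      volume {u : Fin n → ℝ | ‖u‖ ≤ r ∧ ‖(α.linReal (z m)).mulVec u‖ ≤ r} := by
  rcases Set.eq_empty_or_nonempty {x | ∀ i : Fin (m + 1), Q (α.act (z i) x) = w i} with he | ⟨x, hx⟩
  · rw [he]; simp
  set K := {u : Fin n → ℝ | ‖u‖ ≤ r ∧ ‖(α.linReal (z m)).mulVec u‖ ≤ r} with hK
  have hKc : IsCompact K := by
    have h1 : IsClosed K := (isClosed_le continuous_norm continuous_const).inter
      (isClosed_le (Continuous.matrix_mulVec continuous_const continuous_id).norm continuous_const)
    exact (isCompact_closedBall (0 : Fin n → ℝ) r).of_isClosed_subset h1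
      (fun u hu => by simpa using hu.1)
  rw [← volume_image_add_torusMk hKc (fun u hu => ?_) x]
  · refine measure_mono fun y hy => ?_
    obtain ⟨u, hu, hu'⟩ := α.exists_mulVec_le_of_itinerary_eq hQ (by linarith) hLr z hz0 hz x y
      (m + 1) (by omega) (fun j hj => (hx ⟨j, hj⟩).trans (hy ⟨j, hj⟩).symm)
    refine ⟨u, ⟨?_, hu' m (by omega)⟩, hu.symm⟩
    have := hu' 0 (by omega)
    rwa [hz0, α.isMatrixRep_linReal.zero_mulVec] at this
  · have h0 : 0 ≤ r := (norm_nonneg u).trans hu.1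
    nlinarith [hu.1]

/-- The torus is covered by few translates of a Bowen ball. -/
theorem exists_bowen_cover {F : Set (Fin k → ℤ)} (h0 : 0 ∈ F) {r : ℝ} (hr : r < 1 / 2)
    (hpos : 0 < volume {u : Fin n → ℝ | ∀ z ∈ F, ‖(α.linReal z).mulVec u‖ ≤ r}) :
    ∃ C : Finset (UnitAddTorus (Fin n)),
      (C.card : ℝ≥0∞) * volume {u : Fin n → ℝ | ∀ z ∈ F, ‖(α.linReal z).mulVec u‖ ≤ r} ≤ 1 ∧
      ∀ y, ∃ c ∈ C, ∃ u : Fin n → ℝ, y = c + torusMk u ∧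
        ∀ z ∈ F, ‖(α.linReal z).mulVec u‖ ≤ 2 * r := by
  set K := {u : Fin n → ℝ | ∀ z ∈ F, ‖(α.linReal z).mulVec u‖ ≤ r} with hK
  have hKr : ∀ u ∈ K, ‖u‖ ≤ r := fun u hu => by
    simpa [α.isMatrixRep_linReal.zero_mulVec] using hu 0 h0
  have hKc : IsCompact K := by
    have h1 : IsClosed K := by
      have : K = ⋂ z ∈ F, {u : Fin n → ℝ | ‖(α.linReal z).mulVec u‖ ≤ r} := by
        ext u; simp [hK]
      rw [this]
      exact isClosed_biInter fun z _ => isClosed_le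
        (Continuous.matrix_mulVec continuous_const continuous_id).norm continuous_const
    exact (isCompact_closedBall (0 : Fin n → ℝ) r).of_isClosed_subset h1
      (fun u hu => by simpa using hKr u hu)
  let B : UnitAddTorus (Fin n) → Set (UnitAddTorus (Fin n)) := fun x =>
    (fun u => x + torusMk u) '' K
  have hB : ∀ x, volume (B x) = volume K := fun x =>
    volume_image_add_torusMk hKc (fun u hu => (hKr u hu).trans_lt hr) x
  have hBm : ∀ x, MeasurableSet (B x) := fun x =>
    (hKc.image (continuous_const.add continuous_torusMk)).measurableSet
  let P : Finset (UnitAddTorus (Fin n)) → Prop := fun C => (C : Set _).PairwiseDisjoint B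
  have hcard : ∀ C, P C → (C.card : ℝ≥0∞) * volume K ≤ 1 := by
    intro C hC
    have h1 := measure_biUnion_finset (μ := volume) hC (fun x _ => hBm x)
    simp only [hB, Finset.sum_const, nsmul_eq_mul] at h1
    rw [← h1]
    exact prob_le_one
  have hKtop : volume K ≠ ∞ := hKc.measure_lt_top.ne
  obtain ⟨M, hM⟩ := exists_nat_gt ((volume K).toReal⁻¹)
  -- Disjoint translates have total mass at most 1, so a disjoint family of maximal size exists; by
  -- maximality every translate meets one of its members, hence the doubled radius.
  have hbdd : BddAbove {m : ℕ | ∃ C, P C ∧ C.card = m} := by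
    refine ⟨M, ?_⟩
    rintro m ⟨C, hC, rfl⟩
    have h1 := hcard C hC
    have h2 : (C.card : ℝ) * (volume K).toReal ≤ 1 := by
      have := ENNReal.toReal_mono ENNReal.one_ne_top h1
      simpa using this
    have h3 : 0 < (volume K).toReal := ENNReal.toReal_pos hpos.ne' hKtop
    have h4 : (C.card : ℝ) ≤ (volume K).toReal⁻¹ := by
      rwa [inv_eq_one_div, le_div_iff₀ h3]
    exact_mod_cast (h4.trans hM.le)
  have hne : {m : ℕ | ∃ C, P C ∧ C.card = m}.Nonempty := ⟨0, ∅, by simp [P], rfl⟩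
  obtain ⟨C, hC, hCmax⟩ := Nat.sSup_mem hne hbdd
  refine ⟨C, hcard C hC, fun y => ?_⟩
  have hex : ∃ c ∈ C, (B c ∩ B y).Nonempty := by
    by_contra! hno
    by_cases hy : y ∈ C
    · have h1 := hno y hy
      rw [Set.inter_self] at h1
      have h2 := hB y
      rw [h1, measure_empty] at h2
      exact hpos.ne h2
    · classical
      have h1 : P (insert y C) := by
        simp only [P, Finset.coe_insert]
        refine hC.insert fun c hc _ => ?_
        rw [Set.disjoint_iff_inter_eq_empty, Set.inter_comm]
        exact hno c hc
      have h2 := le_csSup hbdd ⟨insert y C, h1, rfl⟩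
      rw [← hCmax, Finset.card_insert_of_notMem hy] at h2
      omega
  obtain ⟨c, hc, p, ⟨u, hu, hup⟩, v, hv, hvp⟩ := hex
  refine ⟨c, hc, u - v, ?_, fun z hz => ?_⟩
  · have : c + torusMk u = y + torusMk v := hup.trans hvp.symm
    rw [torusMk_sub, ← add_sub_assoc, this, add_sub_cancel_right]
  · rw [Matrix.mulVec_sub]
    refine (norm_sub_le _ _).trans ?_
    linarith [hu z hz, hv z hz]

end AffineTorusAction

/-! ### Entropy of finite distributions and Hamming balls -/

/-- A Chernoff count: weight each word by κ to the number of its disagreements. The total weight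
factorizes over the letters and is at most exp(m N κ), while each word of the ball has weight at
least κ^(κ m). -/
theorem card_hamming_ball_le {m N : ℕ} (w : Fin m → Fin N) {κ : ℝ} (hκ : 0 < κ) (hκ1 : κ ≤ 1) :
    ((Finset.univ.filter fun v : Fin m → Fin N =>
      ((Finset.univ.filter fun j => v j ≠ w j).card : ℝ) ≤ κ * m).card : ℝ) ≤
      Real.exp (m * (Real.negMulLog κ + N * κ)) := by
  have hsum : ∑ v : Fin m → Fin N, κ ^ (Finset.univ.filter fun j => v j ≠ w j).card ≤
      Real.exp (m * (N * κ)) := by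
    have h1 : ∀ v : Fin m → Fin N, κ ^ (Finset.univ.filter fun j => v j ≠ w j).card =
        ∏ j, if v j ≠ w j then κ else 1 := fun v => by
      rw [Finset.prod_ite]; simp
    simp only [h1]
    have hprod : ∑ v : Fin m → Fin N, ∏ j, (if v j ≠ w j then κ else 1) =
        ∏ j, ∑ a, (if a ≠ w j then κ else 1) := by
      rw [Finset.prod_univ_sum, Fintype.piFinset_univ]
    rw [hprod]
    calc ∏ j, ∑ a, (if a ≠ w j then κ else 1) ≤ ∏ _j : Fin m, Real.exp (N * κ) := by
          refine Finset.prod_le_prod (fun j _ => Finset.sum_nonneg fun a _ => by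
            split_ifs <;> positivity) fun j _ => ?_
          have h2 :
              ∑ a, (if a ≠ w j then κ else 1) ≤ ∑ a : Fin N, (κ + if a = w j then 1 else 0) := by
            refine Finset.sum_le_sum fun a _ => ?_
            by_cases h : a = w j <;> simp [h, hκ.le]
          refine h2.trans ?_
          rw [Finset.sum_add_distrib]
          simp only [Finset.sum_const, Finset.card_univ, Fintype.card_fin, nsmul_eq_mul,
            Finset.sum_ite_eq', Finset.mem_univ, if_true]
          exact Real.add_one_le_exp _
      _ = _ := by rw [Finset.prod_const, ← Real.exp_nat_mul]; simp
  have hterm : ∀ v ∈ Finset.univ.filter (fun v : Fin m → Fin N =>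
      ((Finset.univ.filter fun j => v j ≠ w j).card : ℝ) ≤ κ * m),
      κ ^ (κ * m) ≤ κ ^ (Finset.univ.filter fun j => v j ≠ w j).card := by
    intro v hv
    rw [← Real.rpow_natCast]
    exact Real.rpow_le_rpow_of_exponent_ge hκ hκ1 (Finset.mem_filter.1 hv).2
  have h3 := Finset.card_nsmul_le_sum _ _ _ hterm
  rw [nsmul_eq_mul] at h3
  have h4 := h3.trans ((Finset.sum_le_sum_of_subset_of_nonneg (Finset.filter_subset _ _)
    fun v _ _ => by positivity).trans hsum)
  have h5 : κ ^ (κ * (m : ℝ)) = Real.exp (-(m * Real.negMulLog κ)) := by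
    rw [Real.rpow_def_of_pos hκ, Real.negMulLog]; ring_nf
  rw [h5, Real.exp_neg, ← div_eq_mul_inv, div_le_iff₀ (Real.exp_pos _), ← Real.exp_add] at h4
  refine h4.trans (le_of_eq ?_)
  ring_nf

theorem neg_log_le_sum_negMulLog {ι : Type*} [Fintype ι] {p : ι → ℝ} (hp : ∀ i, 0 ≤ p i)
    (hsum : ∑ i, p i = 1) {M : ℝ} (hM : ∀ i, p i ≤ M) :
    -Real.log M ≤ ∑ i, Real.negMulLog (p i) := by
  calc -Real.log M = ∑ i, p i * (-Real.log M) := by rw [← Finset.sum_mul, hsum, one_mul]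
    _ ≤ _ := by
      refine Finset.sum_le_sum fun i _ => ?_
      rcases (hp i).eq_or_lt with h0 | h0
      · rw [← h0]; simp
      · rw [Real.negMulLog, neg_mul, mul_neg, neg_le_neg_iff]
        exact mul_le_mul_of_nonneg_left (Real.log_le_log h0 (hM i)) (hp i)

/-- Termwise log x ≤ x - 1 at x = 1/(L p_i). No normalization of p is needed, so the bound applies
both to S and to its complement below. -/
theorem sum_negMulLog_le_of_card_le {ι : Type*} {p : ι → ℝ} (hp : ∀ i, 0 ≤ p i) (S : Finset ι)
    {L : ℝ} (hL : 0 < L) (hS : (S.card : ℝ) ≤ L) :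
    ∑ i ∈ S, Real.negMulLog (p i) ≤ (∑ i ∈ S, p i) * Real.log L + 1 := by
  calc ∑ i ∈ S, Real.negMulLog (p i) ≤ ∑ i ∈ S, (p i * Real.log L + 1 / L) := by
        refine Finset.sum_le_sum fun i _ => ?_
        rcases (hp i).eq_or_lt with h0 | h0
        · rw [← h0]; simp; positivity
        · have h1 := Real.log_le_sub_one_of_pos (show 0 < 1 / (L * p i) by positivity)
          rw [one_div, Real.log_inv, Real.log_mul hL.ne' h0.ne'] at h1
          have h2 := mul_le_mul_of_nonneg_left h1 (hp i)
          have h3 : p i * ((L * p i)⁻¹ - 1) = 1 / L - p i := by field_simp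
          rw [h3] at h2
          rw [Real.negMulLog]
          nlinarith
    _ = (∑ i ∈ S, p i) * Real.log L + S.card / L := by
        rw [Finset.sum_add_distrib, ← Finset.sum_mul]; simp [div_eq_mul_inv]
    _ ≤ _ := by
        have : S.card / L ≤ 1 := (div_le_one hL).2 hS
        linarith

/-- Entropy of a distribution concentrated, up to mass `δ`, on few atoms. -/
theorem sum_negMulLog_le {ι : Type*} [Fintype ι] [DecidableEq ι] {p : ι → ℝ} (hp : ∀ i, 0 ≤ p i)
    (hsum : ∑ i, p i = 1) (S : Finset ι) {L T δ : ℝ} (hL : 1 ≤ L) (hS : (S.card : ℝ) ≤ L)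
    (hT : (Fintype.card ι : ℝ) ≤ T) (hT1 : 1 ≤ T) (hδ : 1 - δ ≤ ∑ i ∈ S, p i) :
    ∑ i, Real.negMulLog (p i) ≤ Real.log L + δ * Real.log T + 2 := by
  have hsplit : ∑ i ∈ S, p i + ∑ i ∈ Sᶜ, p i = 1 := by rw [Finset.sum_add_sum_compl, hsum]
  have h1 := sum_negMulLog_le_of_card_le hp S (by linarith) hS
  have h2 := sum_negMulLog_le_of_card_le hp Sᶜ (L := T) (by linarith)
    (le_trans (by exact_mod_cast Finset.card_le_univ _) hT)
  rw [← Finset.sum_add_sum_compl S]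
  have h3 : ∑ i ∈ S, p i ≤ 1 := by
    have : 0 ≤ ∑ i ∈ Sᶜ, p i := Finset.sum_nonneg fun i _ => hp i
    linarith
  have h4 : (∑ i ∈ S, p i) * Real.log L ≤ Real.log L :=
    mul_le_of_le_one_left (Real.log_nonneg hL) h3
  have h5 : (∑ i ∈ Sᶜ, p i) * Real.log T ≤ δ * Real.log T :=
    mul_le_mul_of_nonneg_right (by linarith) (Real.log_nonneg hT1)
  linarith

/-! ### Regularity of labellings and visits to small sets -/

/-- A measurable labelling is locally constant at a uniform scale outside a set of small measure. -/
theorem exists_uniform_labelling {X : Type*} [MetricSpace X] [MeasurableSpace X] [BorelSpace X]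
    (ν : Measure X) [IsFiniteMeasure ν] [ν.InnerRegularCompactLTTop] {N : ℕ} {ξ : X → Fin N}
    (hξ : Measurable ξ) {η : ℝ} (hη : 0 < η) :
    ∃ (K : Set X) (r : ℝ), MeasurableSet K ∧ ν.real Kᶜ ≤ η ∧ 0 < r ∧
      ∀ x ∈ K, ∀ y ∈ K, dist x y < r → ξ x = ξ y := by
  have hN : ENNReal.ofReal (η / (N + 1)) ≠ 0 := by
    rw [Ne, ENNReal.ofReal_eq_zero, not_le]; positivity
  choose K hKsub hKc hKm using fun i => (hξ (measurableSet_singleton i)).exists_isCompact_sdiff_lt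
    (measure_ne_top ν _) hN
  have hev : ∀ i j, ∀ᶠ r in 𝓝[>] (0 : ℝ), ∀ x ∈ K i, ∀ y ∈ K j, dist x y < r → i = j := by
    intro i j
    by_cases hij : i = j
    · exact Eventually.of_forall fun r x _ y _ _ => hij
    have hd : Disjoint (K i) (K j) := by
      rw [Set.disjoint_left]
      intro x hx hy
      have h1 : ξ x = i := hKsub i hx
      have h2 : ξ x = j := hKsub j hy
      exact hij (h1.symm.trans h2)
    obtain ⟨r, hr0, hr⟩ := Metric.exists_pos_forall_lt_edist (hKc i) (hKc j).isClosed hd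
    have : Set.Ioo (0 : ℝ) r ∈ 𝓝[>] (0 : ℝ) := Ioo_mem_nhdsGT (by exact_mod_cast hr0)
    filter_upwards [this] with s hs x hx y hy hxy
    exfalso
    have h1 := hr x hx y hy
    rw [edist_nndist, ENNReal.coe_lt_coe, ← NNReal.coe_lt_coe, coe_nndist] at h1
    linarith [hs.2]
  have hev' := (eventually_all.2 fun i => eventually_all.2 fun j => hev i j).and
    (self_mem_nhdsWithin : Set.Ioi (0 : ℝ) ∈ 𝓝[>] (0 : ℝ))
  obtain ⟨r, hr, hr0⟩ := hev'.exists
  refine ⟨⋃ i, K i, r, MeasurableSet.iUnion fun i => (hKc i).measurableSet, ?_, hr0, ?_⟩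
  · have hsub : (⋃ i, K i)ᶜ ⊆ ⋃ i, (ξ ⁻¹' {i} \ K i) := by
      intro x hx
      rw [Set.mem_iUnion]
      exact ⟨ξ x, rfl, fun h => hx (Set.mem_iUnion.2 ⟨_, h⟩)⟩
    calc ν.real (⋃ i, K i)ᶜ ≤ ν.real (⋃ i, (ξ ⁻¹' {i} \ K i)) := measureReal_mono hsub
      _ ≤ ∑ i, ν.real (ξ ⁻¹' {i} \ K i) := measureReal_iUnion_fintype_le _
      _ ≤ ∑ _i : Fin N, η / (N + 1) := by
        refine Finset.sum_le_sum fun i _ => ?_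
        exact ENNReal.toReal_le_of_le_ofReal (by positivity) (hKm i).le
      _ = N * (η / (N + 1)) := by simp
      _ ≤ η := by
        rw [mul_div_assoc', div_le_iff₀ (by positivity)]; nlinarith
  · intro x hx y hy hxy
    obtain ⟨i, hi⟩ := Set.mem_iUnion.1 hx
    obtain ⟨j, hj⟩ := Set.mem_iUnion.1 hy
    have h1 : ξ x = i := hKsub i hi
    have h2 : ξ y = j := hKsub j hj
    rw [h1, h2]
    exact hr i j x hi y hj hxy

open Classical in
/-- Markov's inequality for the number of visits to a set. -/
theorem measureReal_many_visits_le {X ι : Type*} [MeasurableSpace X] (ν : Measure X)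
    [IsFiniteMeasure ν] (T : ι → X → X) (hT : ∀ i, MeasurePreserving (T i) ν ν) {B : Set X}
    (hB : MeasurableSet B) (J : Finset ι) (hJ : J.Nonempty) {a : ℝ} (ha : 0 < a) :
    ν.real {x | a * J.card ≤ ((J.filter fun i => T i x ∈ B).card : ℝ)} ≤ ν.real B / a := by
  have hJ0 : (0 : ℝ) < J.card := by exact_mod_cast hJ.card_pos
  have hf : ∀ x, ((J.filter fun i => T i x ∈ B).card : ℝ) =
      ∑ i ∈ J, (T i ⁻¹' B).indicator (fun _ => (1 : ℝ)) x := by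
    intro x
    rw [Finset.card_filter]
    push_cast
    refine Finset.sum_congr rfl fun i _ => ?_
    simp [Set.indicator_apply]
  have hint : ∀ i ∈ J, Integrable ((T i ⁻¹' B).indicator (fun _ => (1 : ℝ))) ν := fun i _ =>
    (integrable_const 1).indicator ((hT i).measurable hB)
  have h1 := mul_meas_ge_le_integral_of_nonneg (μ := ν)
    (f := fun x => ∑ i ∈ J, (T i ⁻¹' B).indicator (fun _ => (1 : ℝ)) x)
    (Eventually.of_forall fun x => Finset.sum_nonneg fun i _ =>
      Set.indicator_nonneg (fun _ _ => zero_le_one) x) (integrable_finsetSum _ hint) (a * J.card)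
  rw [integral_finsetSum _ hint] at h1
  have h2 : ∀ i ∈ J, ∫ x, (T i ⁻¹' B).indicator (fun _ => (1 : ℝ)) x ∂ν = ν.real B := fun i _ => by
    rw [integral_indicator_const _ ((hT i).measurable hB), smul_eq_mul, mul_one,
      measureReal_def, (hT i).measure_preimage hB.nullMeasurableSet, ← measureReal_def]
  rw [Finset.sum_congr rfl h2, Finset.sum_const, nsmul_eq_mul] at h1
  simp only [hf]
  rw [le_div_iff₀ ha]
  have h3 : (J.card : ℝ) * (ν.real {x | a * J.card ≤
      ∑ i ∈ J, (T i ⁻¹' B).indicator (fun _ => (1 : ℝ)) x} * a) ≤ J.card * ν.real B := by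
    calc _ = a * J.card * ν.real _ := by ring
      _ ≤ _ := h1
  exact le_of_mul_le_mul_left h3 hJ0

/-- Turns estimates with an additive constant and an arbitrarily small linear loss into a bound on
the rate. The normalizer g serves both as the time m and as the radius s. -/
theorem ofReal_le_limsup_div {ι : Type*} {l : Filter ι} [l.NeBot] {g a : ι → ℝ} {c : ℝ}
    (hg : Tendsto g l atTop)
    (h : ∀ ε : ℝ, 0 < ε → ∃ K : ℝ, ∀ᶠ i in l, g i * c - K - ε * g i ≤ a i) :
    ENNReal.ofReal c ≤ limsup (fun i => ENNReal.ofReal (a i / g i)) l := by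
  refine ENNReal.le_of_forall_pos_le_add fun ε hε _ => ?_
  obtain ⟨K, hK⟩ := h (ε / 2) (by positivity)
  have hev : ∀ᶠ i in l, ENNReal.ofReal (c - ε) ≤ ENNReal.ofReal (a i / g i) := by
    filter_upwards [hK, hg.eventually_gt_atTop 0, hg.eventually_ge_atTop (2 * K / ε)]
      with i hi hi0 hiK
    apply ENNReal.ofReal_le_ofReal
    rw [le_div_iff₀ hi0]
    rw [div_le_iff₀ (by positivity)] at hiK
    nlinarith
  have h1 : ENNReal.ofReal (c - ε) ≤ limsup (fun i => ENNReal.ofReal (a i / g i)) l :=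
    le_limsup_of_frequently_le hev.frequently
  calc ENNReal.ofReal c = ENNReal.ofReal ((c - ε) + ε) := by ring_nf
    _ ≤ ENNReal.ofReal (c - ε) + ENNReal.ofReal ε := ENNReal.ofReal_add_le
    _ ≤ _ := by rw [ENNReal.ofReal_coe_nnreal]; gcongr

theorem limsup_div_le_ofReal {ι : Type*} {l : Filter ι} {g a : ι → ℝ} {c : ℝ} (hc : 0 ≤ c)
    (hg : Tendsto g l atTop)
    (h : ∀ ε : ℝ, 0 < ε → ∃ K : ℝ, ∀ᶠ i in l, a i ≤ g i * c + K + ε * g i) :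
    limsup (fun i => ENNReal.ofReal (a i / g i)) l ≤ ENNReal.ofReal c := by
  refine ENNReal.le_of_forall_pos_le_add fun ε hε _ => ?_
  obtain ⟨K, hK⟩ := h (ε / 2) (by positivity)
  refine limsup_le_of_le (by isBoundedDefault) ?_
  filter_upwards [hK, hg.eventually_gt_atTop 0, hg.eventually_ge_atTop (2 * K / ε)]
    with i hi hi0 hiK
  rw [← ENNReal.ofReal_coe_nnreal, ← ENNReal.ofReal_add hc (by positivity)]
  apply ENNReal.ofReal_le_ofReal
  rw [div_le_iff₀ hi0]
  rw [div_le_iff₀ (by positivity)] at hiK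
  nlinarith

theorem exists_pos_negMulLog_add_le (N : ℕ) {ε : ℝ} (hε : 0 < ε) :
    ∃ κ : ℝ, 0 < κ ∧ κ ≤ 1 ∧ ∀ κ' : ℝ, 0 < κ' → κ' ≤ κ → Real.negMulLog κ' + N * κ' ≤ ε := by
  have h1 : Tendsto (fun κ : ℝ => Real.negMulLog κ + N * κ) (𝓝[>] 0) (𝓝 0) := by
    have : Continuous fun κ : ℝ => Real.negMulLog κ + N * κ :=
      Real.continuous_negMulLog.add (continuous_const.mul continuous_id)
    have h2 := (this.tendsto 0).mono_left (nhdsWithin_le_nhds (s := Set.Ioi 0))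
    simpa using h2
  have h2 := h1.eventually (eventually_le_nhds hε)
  rw [eventually_nhdsWithin_iff, Metric.eventually_nhds_iff] at h2
  obtain ⟨ρ, hρ, h⟩ := h2
  refine ⟨min 1 (ρ / 2), by positivity, min_le_left _ _, fun κ' h0 h' => ?_⟩
  refine h ?_ h0
  rw [Real.dist_eq, sub_zero, abs_of_pos h0]
  linarith [min_le_right 1 (ρ / 2)]

open Classical in
/-- The entropy of a word-valued map whose values cluster in few Hamming balls. -/
theorem sum_negMulLog_le_of_hamming_cover {X ι : Type*} [MeasurableSpace X] (ν : Measure X)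
    [IsProbabilityMeasure ν] {m N : ℕ} (hN : 1 ≤ N) (f : X → Fin m → Fin N) (hf : Measurable f)
    (I : Finset ι) (U : ι → Set X) (Good : Set X) {L κ δ : ℝ} (hL : 1 ≤ L)
    (hI : (I.card : ℝ) ≤ L) (hκ : 0 < κ) (hκ1 : κ ≤ 1) (hδ : 1 - δ ≤ ν.real Good)
    (hcov : ∀ a ∈ Good, ∃ i ∈ I, a ∈ U i)
    (hU : ∀ i ∈ I, ∀ a ∈ Good, ∀ a' ∈ Good, a ∈ U i → a' ∈ U i →
      ((Finset.univ.filter fun j => f a j ≠ f a' j).card : ℝ) ≤ κ * m) :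
    ∑ w : Fin m → Fin N, Real.negMulLog (ν.real (f ⁻¹' {w})) ≤
      Real.log L + m * (Real.negMulLog κ + N * κ) + δ * (m * Real.log N) + 2 := by
  set E := Real.exp (m * (Real.negMulLog κ + N * κ)) with hE
  have hE1 : 1 ≤ E := Real.one_le_exp (by
    have := Real.negMulLog_nonneg hκ.le hκ1
    positivity)
  set W : ι → Finset (Fin m → Fin N) := fun i =>
    Finset.univ.filter fun w => ∃ a ∈ Good, a ∈ U i ∧ f a = w with hW
  have hWcard : ∀ i ∈ I, ((W i).card : ℝ) ≤ E := by
    intro i hi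
    by_cases hne : ∃ a ∈ Good, a ∈ U i
    · obtain ⟨a, ha, hai⟩ := hne
      refine le_trans ?_ (card_hamming_ball_le (f a) hκ hκ1)
      exact_mod_cast Finset.card_le_card fun w hw => by
        obtain ⟨a', ha', hai', rfl⟩ := (Finset.mem_filter.1 hw).2
        exact Finset.mem_filter.2 ⟨Finset.mem_univ _, hU i hi a' ha' a ha hai' hai⟩
    · have : W i = ∅ := by
        refine Finset.filter_eq_empty_iff.2 fun w _ => ?_
        rintro ⟨a, ha, hai, _⟩
        exact hne ⟨a, ha, hai⟩
      rw [this]; simp; linarith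
  set S := I.biUnion W with hS
  have hScard : (S.card : ℝ) ≤ L * E := by
    calc (S.card : ℝ) ≤ ∑ i ∈ I, ((W i).card : ℝ) := by exact_mod_cast Finset.card_biUnion_le
      _ ≤ ∑ _i ∈ I, E := Finset.sum_le_sum hWcard
      _ = I.card * E := by simp
      _ ≤ _ := by gcongr
  have hfib : ∀ w, MeasurableSet (f ⁻¹' {w}) := fun w => hf (measurableSet_singleton w)
  have hsum : ∑ w, ν.real (f ⁻¹' {w}) = 1 := by
    rw [sum_measureReal_preimage_singleton _ (fun w _ => hfib w)]
    simp
  have hSmass : 1 - δ ≤ ∑ w ∈ S, ν.real (f ⁻¹' {w}) := by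
    rw [sum_measureReal_preimage_singleton _ (fun w _ => hfib w)]
    refine hδ.trans (measureReal_mono fun a ha => ?_)
    obtain ⟨i, hi, hai⟩ := hcov a ha
    simp only [Set.mem_preimage, Finset.mem_coe, hS, Finset.mem_biUnion]
    exact ⟨i, hi, Finset.mem_filter.2 ⟨Finset.mem_univ _, a, ha, hai, rfl⟩⟩
  have hN' : (1 : ℝ) ≤ N := by exact_mod_cast hN
  have h := sum_negMulLog_le (fun w => measureReal_nonneg) hsum S
    (one_le_mul_of_one_le_of_one_le hL hE1) hScard (T := (N : ℝ) ^ m) (by simp)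
    (one_le_pow₀ hN') hSmass
  rwa [Real.log_mul (by linarith) (by linarith), hE, Real.log_exp, Real.log_pow] at h

/-! ### Bowen covers with exponential bounds. -/

namespace AffineTorusAction

variable {k n : ℕ} {α : AffineTorusAction k n} {χ : Fin n → Module.Dual ℝ (Fin k → ℝ)}

/-- Packing by translates of the Bowen ball of radius ρ/2, whose volume is at least c exp(-∑ M_j);
the constant D is 1/c. -/
theorem IsExponentSystem.exists_cover (hχ : α.IsExponentSystem χ) {ε ρ : ℝ} (hε : 0 < ε)
    (hρ : 0 < ρ) (hρ1 : ρ < 1) :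
    ∃ D : ℝ, 0 < D ∧ ∀ (F : Set (Fin k → ℤ)) (M : Fin n → ℝ), 0 ∈ F →
      (∀ z ∈ F, ∀ j, χ j (latticeVec z) + ε * ‖latticeVec z‖ ≤ M j) →
      ∃ C : Finset (UnitAddTorus (Fin n)), (C.card : ℝ) ≤ D * Real.exp (∑ j, M j) ∧
        ∀ y, ∃ c ∈ C, ∃ u : Fin n → ℝ, y = c + torusMk u ∧
          ∀ z ∈ F, ‖(α.linReal z).mulVec u‖ ≤ ρ := by
  obtain ⟨c, hc0, hc⟩ := hχ.le_volume hε (half_pos hρ)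
  refine ⟨c⁻¹, by positivity, fun F M h0 hM => ?_⟩
  have hv := hc F M hM
  have hpos : 0 < ENNReal.ofReal (c * Real.exp (-∑ j, M j)) :=
    ENNReal.ofReal_pos.2 (by positivity)
  obtain ⟨C, hC, hcov⟩ := α.exists_bowen_cover h0 (r := ρ / 2) (by linarith) (hpos.trans_le hv)
  refine ⟨C, ?_, fun y => ?_⟩
  · have h1 : (C.card : ℝ≥0∞) * ENNReal.ofReal (c * Real.exp (-∑ j, M j)) ≤ 1 :=
      (mul_le_mul_right hv _).trans hC
    have h2 := ENNReal.toReal_mono ENNReal.one_ne_top h1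
    rw [ENNReal.toReal_mul, ENNReal.toReal_natCast, ENNReal.toReal_ofReal (by positivity),
      ENNReal.toReal_one, Real.exp_neg] at h2
    have h3 : (C.card : ℝ) * (c * (Real.exp (∑ j, M j))⁻¹) =
        (C.card : ℝ) / (c⁻¹ * Real.exp (∑ j, M j)) := by field_simp
    rwa [h3, div_le_one (by positivity)] at h2
  · obtain ⟨c, hc, u, hu, hz⟩ := hcov y
    exact ⟨c, hc, u, hu, fun z hzF => by linarith [hz z hzF]⟩

theorem exists_mulVec_le_of_finite (α : AffineTorusAction k n) {S : Set (Fin k → ℤ)}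
    (hS : S.Finite) :
    ∃ L : ℝ, 1 ≤ L ∧ ∀ z ∈ S, ∀ u, ‖(α.linReal z).mulVec u‖ ≤ L * ‖u‖ := by
  set T := fun z => (Matrix.toLin' (α.linReal z)).toContinuousLinearMap with hT
  refine ⟨1 + ∑ z ∈ hS.toFinset, ‖T z‖, by
    have : 0 ≤ ∑ z ∈ hS.toFinset, ‖T z‖ := Finset.sum_nonneg fun _ _ => norm_nonneg _
    linarith, fun z hz u => ?_⟩
  have h1 : ‖(α.linReal z).mulVec u‖ ≤ ‖T z‖ * ‖u‖ := (T z).le_opNorm u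
  refine h1.trans (mul_le_mul_of_nonneg_right ?_ (norm_nonneg _))
  have h2 := Finset.single_le_sum (f := fun z => ‖T z‖) (fun _ _ => norm_nonneg _)
    (hS.mem_toFinset.2 hz)
  linarith

end AffineTorusAction

theorem finite_latticeVec_norm_le {k : ℕ} (R : ℝ) :
    {z : Fin k → ℤ | ‖latticeVec z‖ ≤ R}.Finite := by
  refine (Set.Finite.pi' fun _ : Fin k => Set.finite_Icc (-⌈R⌉) ⌈R⌉).subset fun z hz i => ?_
  have h1 : |(z i : ℝ)| ≤ ⌈R⌉ := ((norm_le_pi_norm (latticeVec z) i).trans hz).trans (Int.le_ceil R)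
  have h2 : |z i| ≤ ⌈R⌉ := by exact_mod_cast h1
  exact abs_le.1 h2

/-! ### The suspension as a skew product over the unit cube -/

/-- The coordinatewise integer part. -/
noncomputable def floorVec {k : ℕ} (s : Fin k → ℝ) : Fin k → ℤ := fun i => ⌊s i⌋

/-- The coordinatewise fractional part. -/
noncomputable def fractVec {k : ℕ} (s : Fin k → ℝ) : Fin k → ℝ := fun i => Int.fract (s i)

section FloorVec

variable {k : ℕ}

theorem measurable_floorVec : Measurable (floorVec (k := k)) :=
  measurable_pi_lambda _ fun i => Int.measurable_floor.comp (measurable_pi_apply i)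

theorem fractVec_eq (s : Fin k → ℝ) : fractVec s = s - latticeVec (floorVec s) := rfl

theorem floorVec_sub_latticeVec (s : Fin k → ℝ) (z : Fin k → ℤ) :
    floorVec (s - latticeVec z) = floorVec s - z := by
  ext i; simp [floorVec, latticeVec]

theorem floorVec_eq_zero {s : Fin k → ℝ} (hs : ∀ i, s i ∈ Set.Ico (0 : ℝ) 1) :
    floorVec s = 0 := by
  ext i
  simp only [floorVec, Pi.zero_apply, Int.floor_eq_zero_iff]
  exact hs i

theorem norm_latticeVec_floorVec_sub_le {s t : Fin k → ℝ} (hs : ∀ i, s i ∈ Set.Ico (0 : ℝ) 1) :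
    ‖latticeVec (floorVec (s + t)) - t‖ ≤ 1 := by
  rw [pi_norm_le_iff_of_nonneg zero_le_one]
  intro i
  simp only [Pi.sub_apply, latticeVec, floorVec, Pi.add_apply, Real.norm_eq_abs]
  have h1 := Int.floor_le (s i + t i)
  have h2 := Int.lt_floor_add_one (s i + t i)
  have h3 := hs i
  rw [abs_le]
  constructor <;> linarith [h3.1, h3.2]

theorem norm_latticeVec_floorVec_add_sub_le (s t : Fin k → ℝ) :
    ‖latticeVec (floorVec (s + t) - floorVec s)‖ ≤ ‖t‖ + 1 := by
  rw [pi_norm_le_iff_of_nonneg (by positivity)]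
  intro i
  simp only [latticeVec, floorVec, Pi.add_apply, Pi.sub_apply, Real.norm_eq_abs]
  push_cast
  have h0 : |t i| ≤ ‖t‖ := norm_le_pi_norm t i
  rw [abs_le] at h0 ⊢
  have h1 := Int.floor_le (s i + t i)
  have h2 := Int.lt_floor_add_one (s i + t i)
  have h3 := Int.floor_le (s i)
  have h4 := Int.lt_floor_add_one (s i)
  constructor <;> linarith [h0.1, h0.2]

/-- Lebesgue measure on the unit cube. -/
noncomputable def cubeMeasure (k : ℕ) : Measure (Fin k → ℝ) :=
  volume.restrict (Set.univ.pi fun _ => Set.Ico (0 : ℝ) 1)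

theorem cubeMeasure_eq_pi (k : ℕ) :
    cubeMeasure k = Measure.pi fun _ => volume.restrict (Set.Ico (0 : ℝ) 1) :=
  Measure.restrict_pi_pi _ _

instance (k : ℕ) : IsProbabilityMeasure (cubeMeasure k) := by
  have : IsProbabilityMeasure ((volume : Measure ℝ).restrict (Set.Ico (0 : ℝ) 1)) := ⟨by simp⟩
  rw [cubeMeasure_eq_pi]
  infer_instance

theorem ae_cubeMeasure (k : ℕ) : ∀ᵐ s ∂(cubeMeasure k), ∀ i, s i ∈ Set.Ico (0 : ℝ) 1 := by
  have : ∀ᵐ s ∂(cubeMeasure k), s ∈ Set.univ.pi fun _ : Fin k => Set.Ico (0 : ℝ) 1 :=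
    ae_restrict_mem (MeasurableSet.univ_pi fun _ => measurableSet_Ico)
  filter_upwards [this] with s hs i using hs i (Set.mem_univ i)

/-- This is a rotation of the circle, conjugated by the measurable identification with [0,1). -/
theorem measurePreserving_fract_add (t : ℝ) :
    MeasurePreserving (fun s : ℝ => Int.fract (s + t))
      (volume.restrict (Set.Ico (0 : ℝ) 1)) (volume.restrict (Set.Ico (0 : ℝ) 1)) := by
  have hmk : MeasurePreserving (fun s : ℝ => (s : UnitAddCircle))
      (volume.restrict (Set.Ico (0 : ℝ) 1)) volume := by
    have := AddCircle.measurePreserving_mk 1 (0 : ℝ)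
    rw [zero_add] at this
    rwa [restrict_Ico_eq_restrict_Ioc]
  let rep : UnitAddCircle → ℝ := fun y => (AddCircle.measurableEquivIco 1 0 y : ℝ)
  have hrepm : Measurable rep :=
    measurable_subtype_coe.comp (AddCircle.measurableEquivIco 1 0).measurable
  have hrepmk : ∀ s : ℝ, rep (s : UnitAddCircle) = Int.fract s := fun s => by
    have := AddCircle.coe_equivIco_mk_apply (1 : ℝ) s
    rwa [div_one, mul_one] at this
  have hrep : MeasurePreserving rep volume (volume.restrict (Set.Ico (0 : ℝ) 1)) := by
    refine ⟨hrepm, ?_⟩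
    rw [← hmk.map_eq, Measure.map_map hrepm hmk.measurable]
    have h1 :
        (rep ∘ fun s : ℝ => (s : UnitAddCircle)) =ᵐ[volume.restrict (Set.Ico (0 : ℝ) 1)] id := by
      filter_upwards [ae_restrict_mem measurableSet_Ico] with s hs
      simp only [Function.comp, hrepmk, id]
      exact Int.fract_eq_self.2 hs
    rw [Measure.map_congr h1, Measure.map_id]
  have h := hrep.comp ((measurePreserving_add_right volume (t : UnitAddCircle)).comp hmk)
  convert h using 1
  ext s
  simp only [Function.comp]
  rw [← AddCircle.coe_add, hrepmk]

theorem measurePreserving_fractVec_add (t : Fin k → ℝ) :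
    MeasurePreserving (fun s => fractVec (s + t)) (cubeMeasure k) (cubeMeasure k) := by
  rw [cubeMeasure_eq_pi]
  exact measurePreserving_pi _ _ fun i => measurePreserving_fract_add (t i)

end FloorVec

namespace AffineTorusAction

variable {k n : ℕ} (α : AffineTorusAction k n)

/-- The time-`t` map of the suspension on the fundamental domain. -/
noncomputable def skewMap (t : Fin k → ℝ) (a : (Fin k → ℝ) × UnitAddTorus (Fin n)) :
    (Fin k → ℝ) × UnitAddTorus (Fin n) :=
  (fractVec (a.1 + t), α.act (floorVec (a.1 + t)) a.2)

theorem measurable_act_floorVec (t : Fin k → ℝ) :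
    Measurable fun a : (Fin k → ℝ) × UnitAddTorus (Fin n) => α.act (floorVec (a.1 + t)) a.2 := by
  have h1 : Measurable fun p : UnitAddTorus (Fin n) × (Fin k → ℤ) => α.act p.2 p.1 :=
    measurable_from_prod_countable_left fun z => α.measurable_act z
  have h2 : Measurable fun a : (Fin k → ℝ) × UnitAddTorus (Fin n) => (a.2, floorVec (a.1 + t)) :=
    measurable_snd.prodMk (measurable_floorVec.comp (measurable_fst.add_const t))
  exact h1.comp h2

/-- A skew product over a translation of the torus `ℝ^k/ℤ^k` whose fibre maps all preserve Lebesgue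
measure. -/
theorem measurePreserving_skewMap (t : Fin k → ℝ) : MeasurePreserving (α.skewMap t)
    ((cubeMeasure k).prod volume) ((cubeMeasure k).prod volume) :=
  (measurePreserving_fractVec_add t).skew_product
    (g := fun s x => α.act (floorVec (s + t)) x) (α.measurable_act_floorVec t)
    (Eventually.of_forall fun s => (α.measurePreserving_act (floorVec (s + t))).map_eq)

theorem suspensionMeasure_eq : α.suspensionMeasure =
    ((cubeMeasure k).prod volume).map α.suspensionMk := rfl

theorem measurable_suspensionMk : Measurable α.suspensionMk :=
  measurable_quotient_mk''

theorem suspensionFlow_mk (t : Fin k → ℝ) (a : (Fin k → ℝ) × UnitAddTorus (Fin n)) :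
    α.suspensionFlow t (α.suspensionMk a) = α.suspensionMk (a.1 + t, a.2) := rfl

theorem iterate_suspensionFlow_mk (t : Fin k → ℝ) (j : ℕ)
    (a : (Fin k → ℝ) × UnitAddTorus (Fin n)) :
    (α.suspensionFlow t)^[j] (α.suspensionMk a) =
      α.suspensionMk (a.1 + (j : ℝ) • t, a.2) := by
  induction j with
  | zero => simp
  | succ j ih =>
    rw [Function.iterate_succ_apply', ih, suspensionFlow_mk]
    congr 2
    push_cast
    rw [add_smul, one_smul, add_assoc]

theorem suspensionMk_skewMap (t : Fin k → ℝ) (a : (Fin k → ℝ) × UnitAddTorus (Fin n)) :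
    α.suspensionMk (α.skewMap t a) = α.suspensionMk (a.1 + t, a.2) :=
  (Quotient.sound ⟨floorVec (a.1 + t), fractVec_eq _, rfl⟩ :
    Quotient.mk α.suspensionSetoid (a.1 + t, a.2) = Quotient.mk α.suspensionSetoid _).symm

theorem measurable_itinerary (t : Fin k → ℝ) {N : ℕ} {ξ : α.Suspension → Fin N}
    (hξ : Measurable ξ) (m : ℕ) : Measurable
      fun (a : (Fin k → ℝ) × UnitAddTorus (Fin n)) (i : Fin m) =>
        ξ (α.suspensionMk (a.1 + ((i : ℕ) : ℝ) • t, a.2)) :=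
  measurable_pi_lambda _ fun _ => hξ.comp (α.measurable_suspensionMk.comp
    ((measurable_fst.add_const _).prodMk measurable_snd))

/-- The partition entropy of the suspension, computed on the fundamental domain. -/
theorem iteratedPartitionEntropy_suspension (t : Fin k → ℝ) {N : ℕ} {ξ : α.Suspension → Fin N}
    (hξ : Measurable ξ) (m : ℕ) :
    iteratedPartitionEntropy α.suspensionMeasure (α.suspensionFlow t) ξ m =
      ∑ w : Fin m → Fin N, Real.negMulLog (((cubeMeasure k).prod volume).real
        ((fun a (i : Fin m) => ξ (α.suspensionMk (a.1 + ((i : ℕ) : ℝ) • t, a.2))) ⁻¹' {w})) := by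
  rw [iteratedPartitionEntropy]
  refine Finset.sum_congr rfl fun w _ => ?_
  congr 1
  have hpre : α.suspensionMk ⁻¹' {p : α.Suspension |
      ∀ i : Fin m, ξ ((α.suspensionFlow t)^[i] p) = w i} =
      (fun a (i : Fin m) => ξ (α.suspensionMk (a.1 + ((i : ℕ) : ℝ) • t, a.2))) ⁻¹' {w} := by
    ext a
    simp [iterate_suspensionFlow_mk, funext_iff]
  have hset : MeasurableSet {p : α.Suspension |
      ∀ i : Fin m, ξ ((α.suspensionFlow t)^[i] p) = w i} := by
    have h1 := α.measurable_itinerary t hξ m (measurableSet_singleton w)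
    rw [← hpre] at h1
    exact h1
  rw [measureReal_def, suspensionMeasure_eq, Measure.map_apply α.measurable_suspensionMk hset,
    ← measureReal_def, hpre]

end AffineTorusAction

/-! ### Lower bound for the entropy function. -/

namespace AffineTorusAction

variable {k n : ℕ} {α : AffineTorusAction k n} {χ : Fin n → Module.Dual ℝ (Fin k → ℝ)}

/-- Over each base point s a cylinder is a torus cylinder along the lattice path floor(s + j t), so
Fubini bounds every atom by about exp(-m G(t)); a distribution with small atoms has large entropy.
-/
theorem IsExponentSystem.le_entropyFunction (hχ : α.IsExponentSystem χ) (t : Fin k → ℝ) :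
    ENNReal.ofReal (exponentSeminorm χ t) ≤ α.entropyFunction t := by
  obtain ⟨L, hL1, hL⟩ := α.exists_mulVec_le_of_finite (finite_latticeVec_norm_le (k := k) (‖t‖ + 1))
  set r : ℝ := 1 / (2 * (L + 1)) with hr
  have hr0 : 0 < r := by positivity
  have hLr : (L + 1) * r < 1 := by
    have : (L + 1) * r = 1 / 2 := by rw [hr]; field_simp
    rw [this]; norm_num
  obtain ⟨N, Q, hQm, hQ⟩ := exists_torus_partition n hr0
  -- Applying α(floor s) brings (s, x) back over the unit cube. The label is well defined because
  -- the shift of floor s by -z cancels the factor α(z).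
  let ξ : α.Suspension → Fin N := Quotient.lift
    (fun a : (Fin k → ℝ) × UnitAddTorus (Fin n) => Q (α.act (floorVec a.1) a.2)) (by
      rintro a b ⟨z, h1, h2⟩
      rw [h1, h2, floorVec_sub_latticeVec, ← α.act_add, sub_add_cancel])
  have hξmk : ∀ a, ξ (α.suspensionMk a) = Q (α.act (floorVec a.1) a.2) := fun a => rfl
  have hξ : Measurable ξ := by
    have h1 : Measurable fun a => ξ (α.suspensionMk a) := by
      simp only [hξmk]
      have := hQm.comp (α.measurable_act_floorVec 0)
      simpa only [Function.comp_def, add_zero] using this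
    exact measurable_from_quotient.2 h1
  set G := exponentSeminorm χ with hG
  obtain ⟨CG, hCG0, hCG⟩ := G.exists_le_mul_norm
  refine le_trans ?_ (le_iSup_of_le N (le_iSup_of_le ξ (le_iSup_of_le hξ le_rfl)))
  refine ofReal_le_limsup_div tendsto_natCast_atTop_atTop fun ε hε => ?_
  obtain ⟨ε', hε'0, hε'⟩ := exists_small_mul_le ‖t‖ (norm_nonneg t) hε
  obtain ⟨C, hC0, hC⟩ := hχ.volume_le hε'0 hr0
  refine ⟨Real.log C + G t + CG + ε', ?_⟩
  filter_upwards [eventually_gt_atTop 0] with m hm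
  obtain ⟨m, rfl⟩ := Nat.exists_eq_succ_of_ne_zero hm.ne'
  rw [α.iteratedPartitionEntropy_suspension t hξ]
  have hf := α.measurable_itinerary t hξ (m + 1)
  have hfib := fun w => hf (measurableSet_singleton w)
  set M : ℝ := C * Real.exp (-(m * G t) + CG + ε' * (m * ‖t‖ + 1)) with hM
  have hbound : ∀ w : Fin (m + 1) → Fin N, ((cubeMeasure k).prod volume).real
      ((fun a (i : Fin (m + 1)) => ξ (α.suspensionMk (a.1 + ((i : ℕ) : ℝ) • t, a.2))) ⁻¹' {w}) ≤
        M := by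
    intro w
    rw [measureReal_def]
    refine ENNReal.toReal_le_of_le_ofReal (by positivity) ?_
    rw [Measure.prod_apply (hfib w)]
    calc _ ≤ ∫⁻ _s, ENNReal.ofReal M ∂(cubeMeasure k) := by
          refine lintegral_mono_ae ?_
          filter_upwards [ae_cubeMeasure k] with s hs
          set z : ℕ → Fin k → ℤ := fun j => floorVec (s + (j : ℝ) • t) with hz
          have hz0 : z 0 = 0 := by simp [hz, floorVec_eq_zero hs]
          have hzstep : ∀ j u, ‖(α.linReal (z (j + 1))).mulVec u‖ ≤
              L * ‖(α.linReal (z j)).mulVec u‖ := by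
            intro j u
            have h1 : z (j + 1) = (z (j + 1) - z j) + z j := by abel
            rw [h1, α.isMatrixRep_linReal.add_mulVec]
            refine hL _ ?_ _
            have h2 := norm_latticeVec_floorVec_add_sub_le (s + (j : ℝ) • t) t
            have h3 : s + (j : ℝ) • t + t = s + ((j + 1 : ℕ) : ℝ) • t := by
              push_cast; rw [add_smul, one_smul, add_assoc]
            rw [h3] at h2
            exact h2
          have h1 := α.volume_cylinder_le hQ hL1 hLr z hz0 hzstep m w
          have h2 : Prod.mk s ⁻¹' ((fun a (i : Fin (m + 1)) =>
              ξ (α.suspensionMk (a.1 + ((i : ℕ) : ℝ) • t, a.2))) ⁻¹' {w}) =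
              {x | ∀ i : Fin (m + 1), Q (α.act (z i) x) = w i} := by
            ext x
            simp [hξmk, funext_iff, hz]
          rw [h2]
          refine h1.trans ((hC (z m)).trans (ENNReal.ofReal_le_ofReal ?_))
          have hd : ‖latticeVec (z m) - (m : ℝ) • t‖ ≤ 1 := norm_latticeVec_floorVec_sub_le hs
          have hGz : m * G t - CG ≤ G (latticeVec (z m)) := by
            have h3 : (m : ℝ) * G t = G ((m : ℝ) • t) := by
              rw [map_smul_eq_mul, Real.norm_natCast]
            have h4 := (_root_.abs_le.1 (abs_sub_map_le_sub G (latticeVec (z m)) ((m : ℝ) • t))).1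
            have h5 := hCG (latticeVec (z m) - (m : ℝ) • t)
            rw [h3]
            nlinarith
          have hnz : ‖latticeVec (z m)‖ ≤ m * ‖t‖ + 1 := by
            have h3 := norm_le_norm_add_norm_sub' (latticeVec (z m)) ((m : ℝ) • t)
            rw [norm_smul, Real.norm_natCast] at h3
            linarith
          rw [hM]
          gcongr
          linarith
      _ = _ := by simp
  have hsum : ∑ w : Fin (m + 1) → Fin N, ((cubeMeasure k).prod volume).real
      ((fun a (i : Fin (m + 1)) =>
        ξ (α.suspensionMk (a.1 + ((i : ℕ) : ℝ) • t, a.2))) ⁻¹' {w}) = 1 := by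
    rw [sum_measureReal_preimage_singleton _ (fun w _ => hfib w)]
    simp
  have h := neg_log_le_sum_negMulLog (fun w => measureReal_nonneg) hsum hbound
  rw [hM, Real.log_mul hC0.ne' (Real.exp_pos _).ne', Real.log_exp] at h
  refine le_trans ?_ h
  push_cast
  have : (m : ℝ) * (ε' * ‖t‖) ≤ m * ε := mul_le_mul_of_nonneg_left hε' (Nat.cast_nonneg m)
  nlinarith

end AffineTorusAction

/-! ### Classes of base points with the same integer parts along an orbit -/

/-- The number of integer crossings of the orbit of `s`, and its position in a mesh of size
`1/M`, in each coordinate. -/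
noncomputable def orbitClass {k : ℕ} (t : Fin k → ℝ) (m M : ℕ) (s : Fin k → ℝ) : Fin k → ℤ × ℤ :=
  fun i => (∑ j ∈ Finset.range m, (⌊s i + j * t i⌋ - ⌊(j : ℝ) * t i⌋), ⌊(M : ℝ) * s i⌋)

/-- Each crossing term is 0 or 1, so the number of classes is only polynomial in m and does not
affect the entropy. -/
theorem orbitClass_mem {k : ℕ} (t : Fin k → ℝ) (m : ℕ) {M : ℕ} (hM : 0 < M) {s : Fin k → ℝ}
    (hs : ∀ i, s i ∈ Set.Ico (0 : ℝ) 1) :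
    orbitClass t m M s ∈ Fintype.piFinset fun _ : Fin k =>
      Finset.Icc (0 : ℤ) m ×ˢ Finset.Ico (0 : ℤ) M := by
  rw [Fintype.mem_piFinset]
  intro i
  have h1 : ∀ j : ℕ, 0 ≤ ⌊s i + j * t i⌋ - ⌊(j : ℝ) * t i⌋ := fun j => by
    rw [sub_nonneg]
    exact Int.floor_le_floor (by linarith [(hs i).1])
  have h2 : ∀ j : ℕ, ⌊s i + j * t i⌋ - ⌊(j : ℝ) * t i⌋ ≤ 1 := fun j => by
    have : ⌊s i + j * t i⌋ ≤ ⌊(j : ℝ) * t i + 1⌋ := Int.floor_le_floor (by linarith [(hs i).2])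
    rw [Int.floor_add_one] at this
    linarith
  have hM' : (0 : ℝ) < M := by exact_mod_cast hM
  simp only [orbitClass, Finset.mem_product, Finset.mem_Icc, Finset.mem_Ico]
  refine ⟨⟨Finset.sum_nonneg fun j _ => h1 j, ?_⟩, ?_, ?_⟩
  · calc _ ≤ ∑ _j ∈ Finset.range m, (1 : ℤ) := Finset.sum_le_sum fun j _ => h2 j
      _ = m := by simp
  · exact Int.floor_nonneg.2 (mul_nonneg hM'.le (hs i).1)
  · rw [Int.floor_lt]
    push_cast
    nlinarith [(hs i).2]

/-- In each coordinate every floor is monotone in s, so equality of the sums forces equality of all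
terms: one counter records the entire sequence of integer parts. -/
theorem floorVec_eq_of_orbitClass_eq {k : ℕ} {t : Fin k → ℝ} {m M : ℕ} {s s' : Fin k → ℝ}
    (h : orbitClass t m M s = orbitClass t m M s') {j : ℕ} (hj : j < m) :
    floorVec (s + (j : ℝ) • t) = floorVec (s' + (j : ℝ) • t) := by
  have key : ∀ a b τ : ℝ, a ≤ b →
      ∑ j ∈ Finset.range m, (⌊a + j * τ⌋ - ⌊(j : ℝ) * τ⌋) =
        ∑ j ∈ Finset.range m, (⌊b + j * τ⌋ - ⌊(j : ℝ) * τ⌋) → ⌊a + j * τ⌋ = ⌊b + j * τ⌋ := by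
    intro a b τ hab hsum
    have hle : ∀ i ∈ Finset.range m, ⌊a + i * τ⌋ - ⌊(i : ℝ) * τ⌋ ≤ ⌊b + i * τ⌋ - ⌊(i : ℝ) * τ⌋ :=
      fun i _ => sub_le_sub_right (Int.floor_le_floor (by linarith)) _
    have := (Finset.sum_eq_sum_iff_of_le hle).1 hsum j (Finset.mem_range.2 hj)
    linarith
  ext i
  have hi := congrArg Prod.fst (congrFun h i)
  simp only [orbitClass] at hi
  simp only [floorVec, Pi.add_apply, Pi.smul_apply, smul_eq_mul]
  rcases le_total (s i) (s' i) with hle | hle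
  · exact key _ _ _ hle hi
  · exact (key _ _ _ hle hi.symm).symm

theorem norm_sub_lt_of_orbitClass_eq {k : ℕ} {t : Fin k → ℝ} {m M : ℕ} {s s' : Fin k → ℝ} {r : ℝ}
    (hr : 0 < r) (hM : 1 / r < M) (h : orbitClass t m M s = orbitClass t m M s') :
    ‖s - s'‖ < r := by
  rw [pi_norm_lt_iff hr]
  intro i
  have hM0 : (0 : ℝ) < M := lt_trans (by positivity) hM
  have hi : ⌊(M : ℝ) * s i⌋ = ⌊(M : ℝ) * s' i⌋ := congrArg Prod.snd (congrFun h i)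
  have h1 := Int.abs_sub_lt_one_of_floor_eq_floor hi
  rw [← mul_sub, abs_mul, abs_of_pos hM0] at h1
  rw [div_lt_iff₀ hr] at hM
  rw [Pi.sub_apply, Real.norm_eq_abs]
  by_contra! hge
  nlinarith

/-! ### Upper bound for the entropy function. -/

namespace AffineTorusAction

variable {k n : ℕ} {α : AffineTorusAction k n} {χ : Fin n → Module.Dual ℝ (Fin k → ℝ)}

/-- The fundamental domain is covered by few sets on which orbits of length `m` stay close. -/
theorem IsExponentSystem.exists_orbit_cover (hχ : α.IsExponentSystem χ) (t : Fin k → ℝ)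
    {ε ρ : ℝ} (hε : 0 < ε) (hρ : 0 < ρ) (hρ1 : ρ < 1) (M : ℕ) :
    ∃ D : ℝ, 0 ≤ D ∧ ∀ m : ℕ, 0 < m → ∃ C : (Fin k → ℤ × ℤ) → Finset (UnitAddTorus (Fin n)),
      (∀ σ, ((C σ).card : ℝ) ≤ Real.exp (m * exponentSeminorm χ t + D + ε * m)) ∧
      ∀ s : Fin k → ℝ, (∀ i, s i ∈ Set.Ico (0 : ℝ) 1) → ∀ x, ∃ c ∈ C (orbitClass t m M s),
        ∃ u : Fin n → ℝ, x = c + torusMk u ∧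
          ∀ j < m, ‖(α.linReal (floorVec (s + (j : ℝ) • t))).mulVec u‖ ≤ ρ := by
  obtain ⟨ε', hε'0, hε'⟩ := exists_small_mul_le (n * ‖t‖) (by positivity) hε
  obtain ⟨D, hD0, hD⟩ := hχ.exists_cover hε'0 hρ hρ1
  choose B hB0 hB using fun j => ((normSeminorm ℝ ℝ).comp (χ j)).exists_le_mul_norm
  refine ⟨|Real.log D| + ∑ j, (B j + ε'), add_nonneg (abs_nonneg _) (Finset.sum_nonneg fun j _ =>
    (add_pos (hB0 j) hε'0).le), fun m hm => ?_⟩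
  set E := Real.exp (m * exponentSeminorm χ t + (|Real.log D| + ∑ j, (B j + ε')) + ε * m) with hE
  have key : ∀ σ : Fin k → ℤ × ℤ, ∃ C : Finset (UnitAddTorus (Fin n)), (C.card : ℝ) ≤ E ∧
      ∀ s : Fin k → ℝ, (∀ i, s i ∈ Set.Ico (0 : ℝ) 1) → orbitClass t m M s = σ → ∀ x, ∃ c ∈ C,
        ∃ u : Fin n → ℝ, x = c + torusMk u ∧
          ∀ j < m, ‖(α.linReal (floorVec (s + (j : ℝ) • t))).mulVec u‖ ≤ ρ := by
    intro σ
    by_cases hσ : ∃ s : Fin k → ℝ, (∀ i, s i ∈ Set.Ico (0 : ℝ) 1) ∧ orbitClass t m M s = σ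
    swap
    · exact ⟨∅, by simp [hE, (Real.exp_pos _).le], fun s hs h => absurd ⟨s, hs, h⟩ hσ⟩
    obtain ⟨s₀, hs₀, hs₀σ⟩ := hσ
    obtain ⟨C, hC, hcov⟩ := hD {z | ∃ j < m, z = floorVec (s₀ + (j : ℝ) • t)}
      -- One bound for all times j < m: the maximum of j χ_i(t) is at most m times the positive
      -- part, and `B i` pays for rounding j t. Summing over i produces m G(t).
      (fun i => m * max 0 (χ i t) + B i + ε' * (m * ‖t‖ + 1)) ⟨0, hm, by
        simp [floorVec_eq_zero hs₀]⟩ (by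
        rintro z ⟨j, hj, rfl⟩ i
        have hjm : (j : ℝ) ≤ m := by exact_mod_cast hj.le
        set z := floorVec (s₀ + (j : ℝ) • t) with hz
        have hd : ‖latticeVec z - (j : ℝ) • t‖ ≤ 1 := norm_latticeVec_floorVec_sub_le hs₀
        have h1 : χ i (latticeVec z) ≤ j * χ i t + B i := by
          have h2 := hB i (latticeVec z - (j : ℝ) • t)
          simp only [Seminorm.comp_apply, coe_normSeminorm, map_sub, map_smul, smul_eq_mul,
            Real.norm_eq_abs] at h2
          nlinarith [le_abs_self (χ i (latticeVec z) - j * χ i t), hB0 i]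
        have h3 : (j : ℝ) * χ i t ≤ m * max 0 (χ i t) :=
          (mul_le_mul_of_nonneg_left (le_max_right _ _) (Nat.cast_nonneg j)).trans
            (mul_le_mul_of_nonneg_right hjm (le_max_left _ _))
        have h4 : ‖latticeVec z‖ ≤ m * ‖t‖ + 1 := by
          have h5 := norm_le_norm_add_norm_sub' (latticeVec z) ((j : ℝ) • t)
          rw [norm_smul, Real.norm_natCast] at h5
          nlinarith [norm_nonneg t]
        have h6 := mul_le_mul_of_nonneg_left h4 hε'0.le
        linarith)
    refine ⟨C, hC.trans ?_, fun s hs hsσ x => ?_⟩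
    · rw [hE]
      nth_rewrite 1 [← Real.exp_log hD0]
      rw [← Real.exp_add]
      apply Real.exp_le_exp.2
      have h1 : ∑ i, ((m : ℝ) * max 0 (χ i t) + B i + ε' * (m * ‖t‖ + 1)) =
          m * exponentSeminorm χ t + ∑ j, (B j + ε') + m * (ε' * (n * ‖t‖)) := by
        rw [← sum_max_zero_eq_exponentSeminorm hχ.sum_eq_zero, Finset.mul_sum,
          ← Finset.sum_add_distrib]
        have : (m : ℝ) * (ε' * (n * ‖t‖)) = ∑ _i : Fin n, (m : ℝ) * (ε' * ‖t‖) := by simp; ring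
        rw [this, ← Finset.sum_add_distrib]
        exact Finset.sum_congr rfl fun i _ => by ring
      have h2 : (m : ℝ) * (ε' * (n * ‖t‖)) ≤ m * ε :=
        mul_le_mul_of_nonneg_left hε' (Nat.cast_nonneg m)
      rw [h1]
      linarith [le_abs_self (Real.log D)]
    · obtain ⟨c, hc, u, hu, hz⟩ := hcov x
      refine ⟨c, hc, u, hu, fun j hj => hz _ ⟨j, hj, ?_⟩⟩
      exact floorVec_eq_of_orbitClass_eq (hsσ.trans hs₀σ.symm) hj
  choose C hC hcov using key
  exact ⟨C, hC, fun s hs x => hcov _ s hs rfl x⟩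

theorem dist_add_torusMk_le (x : UnitAddTorus (Fin n)) (u v : Fin n → ℝ) :
    dist (x + torusMk u) (x + torusMk v) ≤ ‖u - v‖ := by
  rw [dist_add_left, dist_eq_norm, ← torusMk_sub]
  exact norm_torusMk_le _

theorem innerRegularCompactLTTop_of_isFiniteMeasure
    (ν : Measure ((Fin k → ℝ) × UnitAddTorus (Fin n))) [IsFiniteMeasure ν] :
    ν.InnerRegularCompactLTTop := inferInstance

-- Codes of length m cluster into few Hamming balls: a cluster is an orbit class with a Bowen
-- centre, inside which two orbits stay within r of each other, so their labels can differ only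
-- while one of them is outside K.
open Classical in
theorem IsExponentSystem.entropyFunction_le (hχ : α.IsExponentSystem χ) (t : Fin k → ℝ) :
    α.entropyFunction t ≤ ENNReal.ofReal (exponentSeminorm χ t) := by
  refine iSup_le fun N => iSup_le fun ξ => iSup_le fun hξ => ?_
  have hN : 1 ≤ N := Fin.pos (ξ (α.suspensionMk 0))
  refine limsup_div_le_ofReal (apply_nonneg _ _) tendsto_natCast_atTop_atTop fun ε hε => ?_
  set ν : Measure ((Fin k → ℝ) × UnitAddTorus (Fin n)) := (cubeMeasure k).prod volume with hν
  have hνp : IsProbabilityMeasure ν := by rw [hν]; infer_instance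
  have hνr : ν.InnerRegularCompactLTTop := innerRegularCompactLTTop_of_isFiniteMeasure ν
  obtain ⟨κ, hκ0, hκ1, hκ⟩ := exists_pos_negMulLog_add_le N (show 0 < ε / 4 by positivity)
  obtain ⟨δ, hδ0, hδ⟩ := exists_small_mul_le (Real.log N)
    (Real.log_nonneg (by exact_mod_cast hN)) (show 0 < ε / 4 by positivity)
  -- With this tolerance Markov's inequality leaves mass at most δ for orbits spending a fraction
  -- κ/2 of their time outside K; two good orbits then disagree at most κ m times.
  obtain ⟨K, r, hKm, hKν, hr0, hK⟩ := exists_uniform_labelling ν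
    (hξ.comp α.measurable_suspensionMk) (show 0 < δ * (κ / 2) by positivity)
  obtain ⟨B, hB⟩ : ∃ B, B = Kᶜ := ⟨_, rfl⟩
  have hBm : MeasurableSet B := hB ▸ hKm.compl
  rw [← hB] at hKν
  set ρ := min (r / 4) (1 / 2) with hρ
  have hρ0 : 0 < ρ := by positivity
  have hρr : 2 * ρ < r := by linarith [min_le_left (r / 4) (1 / 2)]
  have hρ1 : ρ < 1 := by linarith [min_le_right (r / 4) (1 / 2)]
  obtain ⟨M, hM⟩ := exists_nat_gt (1 / r)
  have hM0 : 0 < M := by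
    have : (0 : ℝ) < M := lt_trans (by positivity) hM
    exact_mod_cast this
  obtain ⟨D, hD0, hD⟩ := hχ.exists_orbit_cover t (show 0 < ε / 4 by positivity) hρ0 hρ1 M
  obtain ⟨c, hc0, hc⟩ := exists_small_mul_le k (Nat.cast_nonneg k) (show 0 < ε / 4 by positivity)
  refine ⟨k * |c - 1 - Real.log c| + k * Real.log M + D + 2, ?_⟩
  filter_upwards [eventually_gt_atTop 0] with m hm
  obtain ⟨C, hC, hcov⟩ := hD m hm
  rw [α.iteratedPartitionEntropy_suspension t hξ]
  set f : (Fin k → ℝ) × UnitAddTorus (Fin n) → Fin m → Fin N :=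
    fun a i => ξ (α.suspensionMk (a.1 + ((i : ℕ) : ℝ) • t, a.2)) with hf
  have hfm : Measurable f := α.measurable_itinerary t hξ m
  set T : Fin m → (Fin k → ℝ) × UnitAddTorus (Fin n) → (Fin k → ℝ) × UnitAddTorus (Fin n) :=
    fun i => α.skewMap (((i : ℕ) : ℝ) • t) with hT
  have hTf : ∀ a i, f a i = ξ (α.suspensionMk (T i a)) := fun a i => by
    rw [hT, α.suspensionMk_skewMap]
  set V : Set ((Fin k → ℝ) × UnitAddTorus (Fin n)) :=
    {a | κ / 2 * (Finset.univ : Finset (Fin m)).card ≤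
      ((Finset.univ.filter fun i => T i a ∈ B).card : ℝ)} with hV
  have hm' : (Finset.univ : Finset (Fin m)).Nonempty := ⟨⟨0, hm⟩, Finset.mem_univ _⟩
  have hVν : ν.real V ≤ δ := by
    refine (measureReal_many_visits_le ν T
      (fun i => α.measurePreserving_skewMap (((i : ℕ) : ℝ) • t)) hBm Finset.univ hm'
      (half_pos hκ0)).trans ?_
    rw [div_le_iff₀ (half_pos hκ0)]
    exact hKν
  set Z : Set ((Fin k → ℝ) × UnitAddTorus (Fin n)) :=
    {a | ¬ ∀ i, a.1 i ∈ Set.Ico (0 : ℝ) 1} with hZ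
  have hZν : ν.real Z = 0 := by
    have h1 : ∀ᵐ a ∂ν, ∀ i, a.1 i ∈ Set.Ico (0 : ℝ) 1 :=
      Measure.quasiMeasurePreserving_fst.ae (ae_cubeMeasure k)
    have h2 : ν Z = 0 := h1
    rw [measureReal_def, h2, ENNReal.toReal_zero]
  have hGood : 1 - δ ≤ ν.real (V ∪ Z)ᶜ := by
    have h1 : (1 : ℝ) = ν.real Set.univ := by simp
    have h2 : ν.real Set.univ ≤ ν.real (V ∪ Z)ᶜ + ν.real (V ∪ Z) := by
      rw [← Set.compl_union_self (V ∪ Z)]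
      exact measureReal_union_le _ _
    have h3 := measureReal_union_le (μ := ν) V Z
    linarith
  set I := (Fintype.piFinset fun _ : Fin k =>
    Finset.Icc (0 : ℤ) m ×ˢ Finset.Ico (0 : ℤ) M).sigma C with hI
  set E := Real.exp (m * exponentSeminorm χ t + D + ε / 4 * m) with hE
  have hE1 : 1 ≤ E := Real.one_le_exp (by
    have := apply_nonneg (exponentSeminorm χ) t
    positivity)
  have hm1 : (1 : ℝ) ≤ m + 1 := by linarith [(Nat.cast_nonneg m : (0 : ℝ) ≤ m)]
  have hM1 : (1 : ℝ) ≤ M := by exact_mod_cast hM0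
  have hP1 : 1 ≤ (((m : ℝ) + 1) * M) ^ k :=
    one_le_pow₀ (one_le_mul_of_one_le_of_one_le hm1 hM1)
  have hIcard : (I.card : ℝ) ≤ (((m : ℝ) + 1) * M) ^ k * E := by
    rw [hI, Finset.card_sigma]
    push_cast
    refine (Finset.sum_le_sum fun σ _ => hC σ).trans (le_of_eq ?_)
    rw [Finset.sum_const, Fintype.card_piFinset, nsmul_eq_mul]
    simp
  have h := sum_negMulLog_le_of_hamming_cover ν hN f hfm I
    (fun i => {a | (∀ l, a.1 l ∈ Set.Ico (0 : ℝ) 1) ∧ orbitClass t m M a.1 = i.1 ∧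
      ∃ u : Fin n → ℝ, a.2 = i.2 + torusMk u ∧
        ∀ j < m, ‖(α.linReal (floorVec (a.1 + (j : ℝ) • t))).mulVec u‖ ≤ ρ})
    (V ∪ Z)ᶜ (one_le_mul_of_one_le_of_one_le hP1 hE1) hIcard hκ0 hκ1 hGood ?_ ?_
  · refine h.trans ?_
    have hlog : Real.log ((((m : ℝ) + 1) * M) ^ k * E) =
        k * (Real.log (m + 1) + Real.log M) + (m * exponentSeminorm χ t + D + ε / 4 * m) := by
      rw [Real.log_mul (by positivity) (by positivity), Real.log_pow,
        Real.log_mul (by positivity) (by positivity), hE, Real.log_exp]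
    -- The number of orbit classes enters through k log(m + 1), absorbed into an arbitrarily small
    -- linear term.
    have hlm : Real.log ((m : ℝ) + 1) ≤ c * m + |c - 1 - Real.log c| := by
      have h1 := Real.log_le_sub_one_of_pos (show 0 < c * ((m : ℝ) + 1) by positivity)
      rw [Real.log_mul hc0.ne' (by positivity)] at h1
      linarith [le_abs_self (c - 1 - Real.log c)]
    have h1 := mul_le_mul_of_nonneg_left hlm (Nat.cast_nonneg (α := ℝ) k)
    have h2 := mul_le_mul_of_nonneg_left hc (Nat.cast_nonneg (α := ℝ) m)
    have h3 := mul_le_mul_of_nonneg_left (hκ κ hκ0 le_rfl) (Nat.cast_nonneg (α := ℝ) m)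
    have h4 := mul_le_mul_of_nonneg_left hδ (Nat.cast_nonneg (α := ℝ) m)
    rw [hlog]
    linarith
  · intro a ha
    have haZ : ∀ i, a.1 i ∈ Set.Ico (0 : ℝ) 1 := by
      by_contra hno
      exact ha (Or.inr hno)
    obtain ⟨c, hc, u, hu, hz⟩ := hcov a.1 haZ a.2
    exact ⟨⟨orbitClass t m M a.1, c⟩, Finset.mem_sigma.2 ⟨orbitClass_mem t m hM0 haZ, hc⟩,
      haZ, rfl, u, hu, hz⟩
  · rintro ⟨σ, c⟩ - a ha a' ha' ⟨-, hσ, u, hu, hz⟩ ⟨-, hσ', u', hu', hz'⟩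
    simp only at hσ hσ' hu hu'
    have hV1 : ∀ b ∈ (V ∪ Z)ᶜ, ((Finset.univ.filter fun i => T i b ∈ B).card : ℝ) ≤
        κ / 2 * m := by
      intro b hb
      by_contra! hlt
      refine hb (Or.inl ?_)
      simp only [hV, Set.mem_ofPred_eq, Finset.card_univ, Fintype.card_fin]
      exact hlt.le
    have hsub : (Finset.univ.filter fun j => f a j ≠ f a' j) ⊆
        (Finset.univ.filter fun i => T i a ∈ B) ∪ (Finset.univ.filter fun i => T i a' ∈ B) := by
      intro i hi
      by_contra hno
      simp only [Finset.mem_union, Finset.mem_filter, Finset.mem_univ, true_and, hB,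
        Set.mem_compl_iff, not_or, not_not] at hno hi
      apply hi
      rw [hTf, hTf]
      refine hK _ hno.1 _ hno.2 ?_
      -- Equal integer parts keep the base difference constant and move both fibre points by the
      -- same α(z).
      have hfl : floorVec (a'.1 + ((i : ℕ) : ℝ) • t) = floorVec (a.1 + ((i : ℕ) : ℝ) • t) :=
        floorVec_eq_of_orbitClass_eq (hσ'.trans hσ.symm) i.2
      have hns : ‖a.1 - a'.1‖ < r := norm_sub_lt_of_orbitClass_eq hr0 hM (hσ.trans hσ'.symm)
      rw [Prod.dist_eq, max_lt_iff]
      constructor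
      · simp only [hT, skewMap, fractVec_eq, hfl]
        rw [dist_eq_norm, sub_sub_sub_cancel_right, add_sub_add_right_eq_sub]
        exact hns
      · simp only [hT, skewMap, hfl]
        rw [hu, hu', α.act_add_torusMk, α.act_add_torusMk]
        refine (dist_add_torusMk_le _ _ _).trans_lt ?_
        have h1 := hz i i.2
        have h2 := hz' i i.2
        rw [hfl] at h2
        exact (norm_sub_le _ _).trans_lt (by linarith)
    calc ((Finset.univ.filter fun j => f a j ≠ f a' j).card : ℝ) ≤
        (Finset.univ.filter fun i => T i a ∈ B).card +
          (Finset.univ.filter fun i => T i a' ∈ B).card := by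
          exact_mod_cast (Finset.card_le_card hsub).trans (Finset.card_union_le _ _)
      _ ≤ κ / 2 * m + κ / 2 * m := add_le_add (hV1 a ha) (hV1 a' ha')
      _ = κ * m := by ring

/-- The entropy function is half the sum of the absolute values of the exponents. -/
theorem IsExponentSystem.entropyFunction_eq (hχ : α.IsExponentSystem χ) (t : Fin k → ℝ) :
    α.entropyFunction t = ENNReal.ofReal (exponentSeminorm χ t) :=
  le_antisymm (hχ.entropyFunction_le t) (hχ.le_entropyFunction t)

end AffineTorusAction

/-! ### Norms on `ℝ^k` and lattice points -/

section Norms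

variable {k : ℕ} {p : Seminorm ℝ (Fin k → ℝ)}

theorem Seminorm.continuous_of_pi (p : Seminorm ℝ (Fin k → ℝ)) : Continuous p := by
  obtain ⟨C, hC0, hC⟩ := p.exists_le_mul_norm
  refine (LipschitzWith.of_dist_le_mul (K := ⟨C, hC0.le⟩) fun x y => ?_).continuous
  rw [Real.dist_eq, dist_eq_norm]
  exact (abs_sub_map_le_sub p x y).trans (hC _)

theorem IsNormOn.exists_mul_norm_le (hp : IsNormOn p) : ∃ c : ℝ, 0 < c ∧ ∀ x, c * ‖x‖ ≤ p x := by
  rcases (Metric.sphere (0 : Fin k → ℝ) 1).eq_empty_or_nonempty with he | hne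
  · refine ⟨1, one_pos, fun x => ?_⟩
    by_cases hx : x = 0
    · simp [hx]
    · exfalso
      have : ‖x‖⁻¹ • x ∈ Metric.sphere (0 : Fin k → ℝ) 1 := by
        rw [mem_sphere_zero_iff_norm, norm_smul, norm_inv, norm_norm,
          inv_mul_cancel₀ (norm_ne_zero_iff.2 hx)]
      rw [he] at this
      exact this
  · obtain ⟨y, hy, hmin⟩ := (isCompact_sphere (0 : Fin k → ℝ) 1).exists_isMinOn hne
      p.continuous_of_pi.continuousOn
    have hy0 : y ≠ 0 := by
      rintro rfl
      simp at hy
    refine ⟨p y, lt_of_le_of_ne (apply_nonneg p y) fun h => hy0 (hp y h.symm), fun x => ?_⟩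
    by_cases hx : x = 0
    · simp [hx]
    · have hxn : 0 < ‖x‖ := norm_pos_iff.2 hx
      have hmem : ‖x‖⁻¹ • x ∈ Metric.sphere (0 : Fin k → ℝ) 1 := by
        rw [mem_sphere_zero_iff_norm, norm_smul, norm_inv, norm_norm, inv_mul_cancel₀ hxn.ne']
      have h1 : p y ≤ p (‖x‖⁻¹ • x) := hmin hmem
      rw [map_smul_eq_mul, norm_inv, norm_norm, le_inv_mul_iff₀ hxn] at h1
      linarith

theorem IsNormOn.isCompact_unitBall (hp : IsNormOn p) : IsCompact {x | p x ≤ 1} := by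
  obtain ⟨c, hc0, hc⟩ := hp.exists_mul_norm_le
  refine (isCompact_closedBall (0 : Fin k → ℝ) (1 / c)).of_isClosed_subset
    (isClosed_le p.continuous_of_pi continuous_const) fun x hx => ?_
  rw [mem_closedBall_zero_iff, le_div_iff₀ hc0]
  linarith [hc x, show p x ≤ 1 from hx]

theorem Seminorm.volume_ball_pos (p : Seminorm ℝ (Fin k → ℝ)) : 0 < volume {x | p x ≤ 1} := by
  have h1 : IsOpen {x | p x < 1} := isOpen_lt p.continuous_of_pi continuous_const
  exact (h1.measure_pos volume ⟨0, by simp⟩).trans_le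
    (measure_mono fun x (hx : p x < 1) => hx.le)

/-- The unit ball of a seminorm which is not a norm has infinite volume. -/
theorem Seminorm.volume_ball_eq_top (p : Seminorm ℝ (Fin k → ℝ)) {t : Fin k → ℝ} (ht : t ≠ 0)
    (hpt : p t = 0) : volume {x | p x < 1} = ∞ := by
  obtain ⟨C, hC0, hC⟩ := p.exists_le_mul_norm
  have htn : 0 < ‖t‖ := norm_pos_iff.2 ht
  set ρ : ℝ := 1 / (2 * C) with hρ
  have hρ0 : 0 < ρ := by positivity
  set a : ℝ := 3 * ρ / ‖t‖ with ha
  set B : ℕ → Set (Fin k → ℝ) := fun j => Metric.ball (((j : ℝ) * a) • t) ρ with hB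
  have hdisj : Pairwise (Function.onFun Disjoint B) := by
    intro i j hij
    apply Metric.ball_disjoint_ball
    rw [dist_eq_norm, ← sub_smul, norm_smul, ← sub_mul, norm_mul, Real.norm_eq_abs,
      Real.norm_eq_abs, abs_of_pos (show 0 < a by positivity), mul_assoc]
    have h1 : a * ‖t‖ = 3 * ρ := by rw [ha]; field_simp
    have h2 : (1 : ℝ) ≤ |(i : ℝ) - j| := by
      have : (1 : ℤ) ≤ |(i : ℤ) - j| := Int.one_le_abs (sub_ne_zero.2 (by exact_mod_cast hij))
      exact_mod_cast this
    rw [h1]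
    nlinarith
  have hsub : ⋃ j, B j ⊆ {x | p x < 1} := by
    intro x hx
    obtain ⟨j, hj⟩ := Set.mem_iUnion.1 hx
    rw [hB, mem_ball_iff_norm] at hj
    have h1 : p x ≤ p (x - ((j : ℝ) * a) • t) + p (((j : ℝ) * a) • t) := by
      have := map_add_le_add p (x - ((j : ℝ) * a) • t) (((j : ℝ) * a) • t)
      rwa [sub_add_cancel] at this
    rw [map_smul_eq_mul, hpt, mul_zero, add_zero] at h1
    have h2 : C * ρ = 1 / 2 := by rw [hρ]; field_simp
    have h3 := hC (x - ((j : ℝ) * a) • t)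
    have : p x < 1 := by nlinarith
    exact this
  refine top_unique (le_trans ?_ (measure_mono hsub))
  rw [measure_iUnion hdisj fun j => Metric.isOpen_ball.measurableSet]
  have h1 : ∀ j, volume (B j) = volume (Metric.ball (0 : Fin k → ℝ) ρ) := fun j =>
    Measure.addHaar_ball_center _ _ _
  simp only [h1]
  rw [ENNReal.tsum_const_eq_top_of_ne_zero (Metric.measure_ball_pos volume _ hρ0).ne']

open scoped Pointwise in
/-- Scaling the unit ball of a seminorm. -/
theorem Seminorm.volume_le_scale (p : Seminorm ℝ (Fin k → ℝ)) {c : ℝ} (hc : 0 < c) :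
    volume {x | p x ≤ c} = ENNReal.ofReal (c ^ k) * volume {x | p x ≤ 1} := by
  have h1 : {x | p x ≤ c} = c • {x | p x ≤ 1} := by
    ext x
    rw [Set.mem_smul_set_iff_inv_smul_mem₀ hc.ne']
    simp only [Set.mem_ofPred_eq]
    rw [map_smul_eq_mul, norm_inv, Real.norm_eq_abs, abs_of_pos hc, inv_mul_le_iff₀ hc, mul_one]
  rw [h1, Measure.addHaar_smul]
  simp [abs_of_pos hc]

theorem IsNormOn.finite_latticeBall (hp : IsNormOn p) (s : ℝ) : (latticeBall p s).Finite := by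
  obtain ⟨c, hc0, hc⟩ := hp.exists_mul_norm_le
  refine (finite_latticeVec_norm_le (s / c)).subset fun z hz => ?_
  have h1 : p (latticeVec z) ≤ s := hz
  simp only [Set.mem_ofPred_eq]
  rw [le_div_iff₀ hc0]
  linarith [hc (latticeVec z)]

theorem zero_mem_latticeBall {s : ℝ} (hs : 0 ≤ s) : 0 ∈ latticeBall p s := by
  simp [latticeBall, hs]

theorem IsNormOn.exists_log_card_latticeBall_le (hp : IsNormOn p) {ε : ℝ} (hε : 0 < ε) :
    ∃ K : ℝ, ∀ s : ℝ, 0 ≤ s → Real.log (latticeBall p s).ncard ≤ K + ε * s := by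
  obtain ⟨c, hc0, hc⟩ := hp.exists_mul_norm_le
  obtain ⟨a, ha0, ha⟩ := exists_small_mul_le (k * (2 / c)) (by positivity) hε
  refine ⟨k * (a * 3 - 1 - Real.log a), fun s hs => ?_⟩
  set R := s / c with hR
  have hR0 : 0 ≤ R := by positivity
  have hsub : latticeBall p s ⊆
      ((Fintype.piFinset fun _ : Fin k => Finset.Icc (-⌈R⌉) ⌈R⌉ : Finset (Fin k → ℤ)) :
        Set (Fin k → ℤ)) := by
    intro z hz
    rw [Finset.mem_coe, Fintype.mem_piFinset]
    intro i
    have h0 : p (latticeVec z) ≤ s := hz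
    have h1 : ‖latticeVec z‖ ≤ R := by
      rw [hR, le_div_iff₀ hc0]; linarith [hc (latticeVec z)]
    have h2 : |(z i : ℝ)| ≤ ⌈R⌉ :=
        ((norm_le_pi_norm (latticeVec z) i).trans h1).trans (Int.le_ceil R)
    have h3 : |z i| ≤ ⌈R⌉ := by exact_mod_cast h2
    exact Finset.mem_Icc.2 (abs_le.1 h3)
  have hcard : ((latticeBall p s).ncard : ℝ) ≤ (2 * R + 3) ^ k := by
    have h1 := Set.ncard_le_ncard hsub (Finset.finite_toSet _)
    rw [Set.ncard_coe_finset, Fintype.card_piFinset] at h1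
    simp only [Int.card_Icc, Finset.prod_const, Finset.card_univ, Fintype.card_fin] at h1
    refine (Nat.cast_le.2 h1).trans ?_
    push_cast
    gcongr
    have hceil : 0 ≤ ⌈R⌉ := Int.ceil_nonneg hR0
    have h2 : ((⌈R⌉ + 1 - -⌈R⌉).toNat : ℝ) = 2 * ⌈R⌉ + 1 := by
      have : ((⌈R⌉ + 1 - -⌈R⌉).toNat : ℤ) = 2 * ⌈R⌉ + 1 := by omega
      exact_mod_cast this
    rw [h2]
    linarith [Int.ceil_lt_add_one R]
  have hpos : 0 < (latticeBall p s).ncard :=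
    (Set.ncard_pos (hp.finite_latticeBall s)).2 ⟨0, zero_mem_latticeBall hs⟩
  have h1 := Real.log_le_log (by exact_mod_cast hpos) hcard
  rw [Real.log_pow] at h1
  have h2 := Real.log_le_sub_one_of_pos (show 0 < a * (2 * R + 3) by positivity)
  rw [Real.log_mul ha0.ne' (by positivity)] at h2
  have h3 : (k : ℝ) * Real.log (2 * R + 3) ≤ k * (a * (2 * R + 3) - 1 - Real.log a) :=
    mul_le_mul_of_nonneg_left (by linarith) (Nat.cast_nonneg k)
  have h4 : (k : ℝ) * (a * (2 * R)) = a * (k * (2 / c)) * s := by rw [hR]; field_simp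
  have h5 : a * (k * (2 / c)) * s ≤ ε * s := mul_le_mul_of_nonneg_right ha hs
  nlinarith

/-- Lattice balls of a norm are doubling. -/
theorem IsNormOn.exists_card_latticeBall_le (hp : IsNormOn p) :
    ∃ M : ℕ, 0 < M ∧ ∀ s : ℝ, 0 < s →
      (latticeBall p s).ncard ≤ M * (latticeBall p (s / 2)).ncard := by
  classical
  -- Radius 1/4 makes two lattice points in one scaled patch differ by an element of the ball of
  -- radius s/2; subtracting a fixed point of the patch injects it into that ball.
  obtain ⟨I, -, hI⟩ := hp.isCompact_unitBall.elim_nhds_subcover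
    (fun x => {y | p (y - x) < 1 / 4}) (fun x _ =>
      (isOpen_lt (p.continuous_of_pi.comp (continuous_id.sub continuous_const))
        continuous_const).mem_nhds (by simp))
  refine ⟨I.card + 1, by omega, fun s hs => ?_⟩
  have hsel :
      ∀ z : Fin k → ℤ, z ∈ latticeBall p s → ∃ x ∈ I, p (s⁻¹ • latticeVec z - x) < 1 / 4 := by
    intro z hz
    have h1 : s⁻¹ • latticeVec z ∈ {x | p x ≤ 1} := by
      have h0 : p (latticeVec z) ≤ s := hz
      simp only [Set.mem_ofPred_eq]
      rw [map_smul_eq_mul, norm_inv, Real.norm_eq_abs, abs_of_pos hs, inv_mul_le_iff₀ hs, mul_one]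
      exact h0
    obtain ⟨x, hx, hxz⟩ := Set.mem_iUnion₂.1 (hI h1)
    exact ⟨x, hx, hxz⟩
  set F := (hp.finite_latticeBall s).toFinset with hF
  set F' := (hp.finite_latticeBall (s / 2)).toFinset with hF'
  have hFmem : ∀ z, z ∈ F ↔ z ∈ latticeBall p s := fun z => Set.Finite.mem_toFinset _
  have hF'mem : ∀ z, z ∈ F' ↔ z ∈ latticeBall p (s / 2) := fun z => Set.Finite.mem_toFinset _
  rw [Set.ncard_eq_toFinset_card _ (hp.finite_latticeBall s),
    Set.ncard_eq_toFinset_card _ (hp.finite_latticeBall (s / 2))]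
  have hcover : F ⊆ I.biUnion fun x => F.filter fun z => p (s⁻¹ • latticeVec z - x) < 1 / 4 := by
    intro z hz
    obtain ⟨x, hx, hxz⟩ := hsel z ((hFmem z).1 hz)
    exact Finset.mem_biUnion.2 ⟨x, hx, Finset.mem_filter.2 ⟨hz, hxz⟩⟩
  have hfiber : ∀ x ∈ I, (F.filter fun z => p (s⁻¹ • latticeVec z - x) < 1 / 4).card ≤ F'.card := by
    intro x _
    rcases (F.filter fun z => p (s⁻¹ • latticeVec z - x) < 1 / 4).eq_empty_or_nonempty with he |
        ⟨z₀, hz₀⟩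
    · rw [he]; simp
    · refine Finset.card_le_card_of_injOn (fun z => z - z₀) (fun z hz => ?_)
        (fun a _ b _ hab => sub_left_injective hab)
      have h1 := (Finset.mem_filter.1 hz).2
      have h2 := (Finset.mem_filter.1 hz₀).2
      rw [Finset.mem_coe, hF'mem]
      have h3 :
          latticeVec (z - z₀) = s • ((s⁻¹ • latticeVec z - x) - (s⁻¹ • latticeVec z₀ - x)) := by
        rw [sub_sub_sub_cancel_right, ← smul_sub, smul_smul, mul_inv_cancel₀ hs.ne', one_smul,
          sub_eq_add_neg, latticeVec_add, latticeVec_neg, ← sub_eq_add_neg]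
      have h4 := map_sub_le_add p (s⁻¹ • latticeVec z - x) (s⁻¹ • latticeVec z₀ - x)
      have h5 : p (latticeVec (z - z₀)) ≤ s / 2 := by
        rw [h3, map_smul_eq_mul, Real.norm_eq_abs, abs_of_pos hs]
        nlinarith
      exact h5
  calc F.card ≤ (I.biUnion fun x => F.filter fun z => p (s⁻¹ • latticeVec z - x) < 1 / 4).card :=
        Finset.card_le_card hcover
    _ ≤ I.card * F'.card := Finset.card_biUnion_le_card_mul _ _ _ hfiber
    _ ≤ _ := Nat.mul_le_mul_right _ (by omega)

end Norms

/-! ### Slow entropy: upper bound -/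

open Classical in
theorem hammingDistOn_coe {k N : ℕ} {X : Type*} (φ : (Fin k → ℤ) → X → X) (ξ : X → Fin N)
    (F : Finset (Fin k → ℤ)) (x y : X) :
    hammingDistOn φ ξ (F : Set (Fin k → ℤ)) x y =
      ((F.filter fun z => ξ (φ z x) ≠ ξ (φ z y)).card : ℝ) / F.card := by
  rw [hammingDistOn, Set.ncard_coe_finset]
  congr 2
  rw [← Set.ncard_coe_finset]
  congr 1
  ext z
  simp

namespace AffineTorusAction

variable {k n : ℕ} {α : AffineTorusAction k n} {χ : Fin n → Module.Dual ℝ (Fin k → ℝ)}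

open Classical in
/-- Bowen covers bound Hamming covering numbers. -/
theorem hammingCoverNumber_le {N : ℕ} {ξ : UnitAddTorus (Fin n) → Fin N}
    {K : Set (UnitAddTorus (Fin n))} {r ρ ε δ : ℝ} (hKm : MeasurableSet K)
    (hKν : (volume : Measure (UnitAddTorus (Fin n))).real Kᶜ ≤ δ * (ε / 4))
    (hK : ∀ x ∈ K, ∀ y ∈ K, dist x y < r → ξ x = ξ y) (hρ : 2 * ρ < r) (hε : 0 < ε)
    (F : Finset (Fin k → ℤ)) (hF : F.Nonempty) (C : Finset (UnitAddTorus (Fin n)))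
    (hC : ∀ y, ∃ c ∈ C, ∃ u : Fin n → ℝ, y = c + torusMk u ∧
      ∀ z ∈ F, ‖(α.linReal z).mulVec u‖ ≤ ρ) :
    hammingCoverNumber volume α.act ξ (F : Set (Fin k → ℤ)) ε δ ≤ C.card := by
  obtain ⟨B, hB⟩ : ∃ B, B = Kᶜ := ⟨_, rfl⟩
  have hBm : MeasurableSet B := hB ▸ hKm.compl
  rw [← hB] at hKν
  have hF0 : (0 : ℝ) < F.card := by exact_mod_cast hF.card_pos
  set μ : Measure (UnitAddTorus (Fin n)) := volume with hμ
  set V : Set (UnitAddTorus (Fin n)) :=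
    {x | ε / 4 * F.card ≤ ((F.filter fun z => α.act z x ∈ B).card : ℝ)} with hV
  have hVμ : μ.real V ≤ δ := by
    refine (measureReal_many_visits_le μ α.act (fun z => α.measurePreserving_act z) hBm F hF
      (show 0 < ε / 4 by positivity)).trans ?_
    rwa [div_le_iff₀ (by positivity)]
  have hGood : 1 - δ ≤ μ.real Vᶜ := by
    have h2 : μ.real Set.univ ≤ μ.real Vᶜ + μ.real V := by
      rw [← Set.compl_union_self V]
      exact measureReal_union_le _ _
    have h1 : μ.real Set.univ = 1 := by simp
    linarith
  set U : UnitAddTorus (Fin n) → Set (UnitAddTorus (Fin n)) := fun c =>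
    {y | y ∈ Vᶜ ∧ ∃ u : Fin n → ℝ, y = c + torusMk u ∧
      ∀ z ∈ F, ‖(α.linReal z).mulVec u‖ ≤ ρ} with hU
  have hclose : ∀ c, ∀ x ∈ U c, ∀ y ∈ U c, hammingDistOn α.act ξ (F : Set (Fin k → ℤ)) x y < ε := by
    rintro c x ⟨hx, u, rfl, hu⟩ y ⟨hy, v, rfl, hv⟩
    rw [hammingDistOn_coe, div_lt_iff₀ hF0]
    have hbd : ∀ b ∈ Vᶜ, ((F.filter fun z => α.act z b ∈ B).card : ℝ) ≤ ε / 4 * F.card := by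
      intro b hb
      by_contra! hlt
      exact hb hlt.le
    have hsub : (F.filter fun z => ξ (α.act z (c + torusMk u)) ≠ ξ (α.act z (c + torusMk v))) ⊆
        (F.filter fun z => α.act z (c + torusMk u) ∈ B) ∪
          (F.filter fun z => α.act z (c + torusMk v) ∈ B) := by
      intro z hz
      by_contra hno
      simp only [Finset.mem_union, Finset.mem_filter, hB, Set.mem_compl_iff, not_or, not_and,
        not_not] at hno hz
      refine hz.2 (hK _ (hno.1 hz.1) _ (hno.2 hz.1) ?_)
      rw [α.act_add_torusMk, α.act_add_torusMk]
      refine (dist_add_torusMk_le _ _ _).trans_lt ((norm_sub_le _ _).trans_lt ?_)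
      linarith [hu z hz.1, hv z hz.1]
    have h1 : ((F.filter fun z => ξ (α.act z (c + torusMk u)) ≠
        ξ (α.act z (c + torusMk v))).card : ℝ) ≤ (F.filter fun z => α.act z (c + torusMk u) ∈
            B).card +
          (F.filter fun z => α.act z (c + torusMk v) ∈ B).card := by
      exact_mod_cast (Finset.card_le_card hsub).trans (Finset.card_union_le _ _)
    have h2 := hbd _ hx
    have h3 := hbd _ hy
    nlinarith [mul_pos hε hF0]
  -- A Bowen centre may itself visit the bad set too often, so it is replaced by a good point of its
  -- patch.
  let g : UnitAddTorus (Fin n) → UnitAddTorus (Fin n) := fun c =>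
    if h : (U c).Nonempty then h.choose else c
  refine le_trans ?_ (Finset.card_image_le (s := C) (f := g))
  unfold hammingCoverNumber
  refine Nat.sInf_le ⟨C.image g, rfl, ?_⟩
  refine hGood.trans (measureReal_mono (fun y hy => ?_) (measure_ne_top _ _))
  obtain ⟨c, hc, u, hu, hz⟩ := hC y
  have hyU : y ∈ U c := ⟨hy, u, hu, hz⟩
  have hne : (U c).Nonempty := ⟨y, hyU⟩
  refine Set.mem_iUnion₂.2 ⟨g c, Finset.mem_image_of_mem g hc, ?_⟩
  have hg : g c ∈ U c := by
    simp only [g, dif_pos hne]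
    exact hne.choose_spec
  exact hclose c _ hg _ hyU

/-- On the p-ball of radius s each exponent is at most G ≤ a s, so all M_j can be taken near a s.
The resulting factor n is crude but harmless, since only smallness in a matters. -/
theorem IsExponentSystem.slowEntropyNorm_le (hχ : α.IsExponentSystem χ)
    {p : Seminorm ℝ (Fin k → ℝ)} (hp : IsNormOn p) {a : ℝ} (ha : 0 ≤ a)
    (hG : ∀ x, exponentSeminorm χ x ≤ a * p x) :
    slowEntropyNorm volume α.act p ≤ ENNReal.ofReal (n * a) := by
  refine iSup_le fun N => iSup_le fun ξ => iSup_le fun hξ => ?_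
  obtain ⟨c₁, hc₁0, hc₁⟩ := hp.exists_mul_norm_le
  refine limsup_le_of_le (by isBoundedDefault) ?_
  have hpos : ∀ᶠ e : ℝ × ℝ in 𝓝[>] (0 : ℝ) ×ˢ 𝓝[>] (0 : ℝ), 0 < e.1 ∧ 0 < e.2 :=
    (eventually_mem_nhdsWithin (s := Set.Ioi (0 : ℝ))).prod_mk
      (eventually_mem_nhdsWithin (s := Set.Ioi (0 : ℝ)))
  filter_upwards [hpos] with e he
  obtain ⟨K, r, hKm, hKν, hr0, hK⟩ := exists_uniform_labelling
    (volume : Measure (UnitAddTorus (Fin n))) hξ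
    (show 0 < e.2 * (e.1 / 4) from mul_pos he.2 (by linarith [he.1]))
  set ρ := min (r / 4) (1 / 2) with hρ
  have hρ0 : 0 < ρ := by positivity
  have hρr : 2 * ρ < r := by linarith [min_le_left (r / 4) (1 / 2)]
  have hρ1 : ρ < 1 := by linarith [min_le_right (r / 4) (1 / 2)]
  refine limsup_div_le_ofReal (by positivity) tendsto_id fun ε hε => ?_
  obtain ⟨ε', hε'0, hε'⟩ := exists_small_mul_le (n * (1 / c₁)) (by positivity) hε
  obtain ⟨D, hD0, hD⟩ := hχ.exists_cover hε'0 hρ0 hρ1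
  refine ⟨|Real.log D|, ?_⟩
  filter_upwards [eventually_ge_atTop 0] with s hs
  have hfin := hp.finite_latticeBall s
  obtain ⟨C, hC, hcov⟩ := hD (latticeBall p s) (fun _ => a * s + ε' * (s / c₁))
    (zero_mem_latticeBall hs) (by
      intro z hz j
      have hz' : p (latticeVec z) ≤ s := hz
      have h1 : χ j (latticeVec z) ≤ a * s := by
        calc χ j (latticeVec z) ≤ max 0 (χ j (latticeVec z)) := le_max_right _ _
          _ ≤ ∑ j, max 0 (χ j (latticeVec z)) :=
            Finset.single_le_sum (f := fun j => max 0 (χ j (latticeVec z)))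
              (fun i _ => le_max_left _ _) (Finset.mem_univ j)
          _ = exponentSeminorm χ (latticeVec z) :=
            sum_max_zero_eq_exponentSeminorm hχ.sum_eq_zero _
          _ ≤ a * p (latticeVec z) := hG _
          _ ≤ a * s := by gcongr
      have h2 : ‖latticeVec z‖ ≤ s / c₁ := by
        rw [le_div_iff₀ hc₁0]; linarith [hc₁ (latticeVec z)]
      gcongr)
  have hle : hammingCoverNumber volume α.act ξ (latticeBall p s) e.1 e.2 ≤ C.card := by
    have h := hammingCoverNumber_le (α := α) hKm hKν hK hρr he.1 hfin.toFinset
      ⟨0, hfin.mem_toFinset.2 (zero_mem_latticeBall hs)⟩ C (by simpa using hcov)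
    rwa [hfin.coe_toFinset] at h
  have hsum : ∑ _j : Fin n, (a * s + ε' * (s / c₁)) = s * (n * a) + ε' * (n * (1 / c₁)) * s := by
    simp only [Finset.sum_const, Finset.card_univ, Fintype.card_fin, nsmul_eq_mul]
    field_simp
  have hε's : ε' * (n * (1 / c₁)) * s ≤ ε * s := mul_le_mul_of_nonneg_right hε' hs
  rw [hsum] at hC
  -- The covering number is 0 when δ ≥ 1, since no ball is then required; the value log 0 = 0 keeps
  -- the estimate valid.
  rcases Nat.eq_zero_or_pos (hammingCoverNumber volume α.act ξ (latticeBall p s) e.1 e.2) with h0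
      | h0
  · rw [h0]
    simp only [Nat.cast_zero, Real.log_zero]
    positivity
  · have h1 : (0 : ℝ) < hammingCoverNumber volume α.act ξ (latticeBall p s) e.1 e.2 := by
      exact_mod_cast h0
    have h2 := Real.log_le_log h1 ((Nat.cast_le.2 hle).trans hC)
    rw [Real.log_mul hD0.ne' (Real.exp_pos _).ne', Real.log_exp] at h2
    linarith [le_abs_self (Real.log D)]

/-- If the exponents have a common kernel, the slow entropy vanishes. -/
theorem IsExponentSystem.slowEntropy_eq_zero (hχ : α.IsExponentSystem χ) (hk : 1 ≤ k)
    {t : Fin k → ℝ} (ht : t ≠ 0) (hGt : exponentSeminorm χ t = 0) :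
    slowEntropy volume α.act = 0 := by
  set G := exponentSeminorm χ with hG
  have hk0 : (k : ℝ) ≠ 0 := by exact_mod_cast (by omega : k ≠ 0)
  let d : ℕ → NNReal := fun N => ⟨1 / ((N : ℝ) + 1), by positivity⟩
  let P : ℕ → Seminorm ℝ (Fin k → ℝ) := fun N => G + d N • normSeminorm ℝ (Fin k → ℝ)
  have hP : ∀ N x, P N x = G x + 1 / ((N : ℝ) + 1) * ‖x‖ := fun N x => rfl
  have hPn : ∀ N, IsNormOn (P N) := by
    intro N x hx
    rw [hP] at hx
    have h1 : 0 < 1 / ((N : ℝ) + 1) := by positivity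
    have h2 := apply_nonneg G x
    have h3 : ‖x‖ = 0 := by nlinarith [norm_nonneg x]
    exact norm_eq_zero.1 h3
  have hVtop : Tendsto (fun N => volume {x | P N x ≤ 1}) atTop (𝓝 ∞) := by
    have hmono : Monotone fun N => {x | P N x ≤ 1} := by
      intro N M hNM x hx
      simp only [Set.mem_ofPred_eq, hP] at hx ⊢
      have : 1 / ((M : ℝ) + 1) ≤ 1 / ((N : ℝ) + 1) := by gcongr
      nlinarith [norm_nonneg x]
    have h1 := tendsto_measure_iUnion_atTop (μ := volume) hmono
    have h2 : volume (⋃ N, {x | P N x ≤ 1}) = ∞ := by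
      refine top_unique ?_
      rw [← G.volume_ball_eq_top ht hGt]
      refine measure_mono fun x (hx : G x < 1) => ?_
      obtain ⟨N, hN⟩ := exists_nat_gt (‖x‖ / (1 - G x))
      refine Set.mem_iUnion.2 ⟨N, ?_⟩
      simp only [Set.mem_ofPred_eq, hP]
      rw [div_lt_iff₀ (by linarith)] at hN
      have h3 : 1 / ((N : ℝ) + 1) * ‖x‖ ≤ 1 - G x := by
        rw [div_mul_eq_mul_div, one_mul, div_le_iff₀ (by positivity)]
        nlinarith
      linarith
    rwa [h2] at h1
  refine le_antisymm (ENNReal.le_of_forall_pos_le_add fun η hη _ => ?_) bot_le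
  rw [zero_add]
  -- The unit ball of P_N must have volume above b^k, so that the normalizing factor c exceeds b and
  -- n/c ≤ η.
  set b : ℝ := (n + 1) / η with hb
  have hb0 : 0 < b := by positivity
  obtain ⟨N, hN⟩ := (hVtop.eventually (eventually_gt_nhds
    (ENNReal.ofReal_lt_top (r := b ^ k)))).exists
  set V := (volume {x | P N x ≤ 1}).toReal with hV
  have hVfin : volume {x | P N x ≤ 1} ≠ ∞ := (hPn N).isCompact_unitBall.measure_lt_top.ne
  have hVb : b ^ k < V := (ENNReal.ofReal_lt_iff_lt_toReal (by positivity) hVfin).1 hN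
  have hV0 : 0 < V := lt_trans (by positivity) hVb
  set c : ℝ := V ^ (1 / (k : ℝ)) with hc
  have hc0 : 0 < c := Real.rpow_pos_of_pos hV0 _
  have hck : c ^ k = V := by
    rw [hc, ← Real.rpow_natCast, ← Real.rpow_mul hV0.le, one_div, inv_mul_cancel₀ hk0,
        Real.rpow_one]
  have hbc : b ≤ c := by
    by_contra! hlt
    have := pow_le_pow_left₀ hc0.le hlt.le k
    rw [hck] at this
    linarith
  let c' : NNReal := ⟨c, hc0.le⟩
  let p : Seminorm ℝ (Fin k → ℝ) := c' • P N
  have hp : ∀ x, p x = c * P N x := fun x => rfl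
  have hpn : IsNormOn p := fun x hx => by
    rw [hp] at hx
    exact hPn N x ((mul_eq_zero.1 hx).resolve_left hc0.ne')
  have hpv : volume {x | p x ≤ 1} = 1 := by
    have h1 : {x | p x ≤ 1} = {x | P N x ≤ c⁻¹} := by
      ext x
      simp only [Set.mem_ofPred_eq, hp]
      rw [← le_inv_mul_iff₀ hc0, mul_one]
    rw [h1, Seminorm.volume_le_scale _ (inv_pos.2 hc0), inv_pow, hck,
      ← ENNReal.ofReal_toReal hVfin, ← ENNReal.ofReal_mul (by positivity), ← hV,
      inv_mul_cancel₀ hV0.ne', ENNReal.ofReal_one]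
  calc slowEntropy volume α.act ≤ slowEntropyNorm volume α.act p :=
        iInf_le_of_le p (iInf_le_of_le hpn (iInf_le_of_le hpv le_rfl))
    _ ≤ ENNReal.ofReal (n * c⁻¹) := by
        refine hχ.slowEntropyNorm_le hpn (by positivity) fun x => ?_
        rw [hp, ← mul_assoc, inv_mul_cancel₀ hc0.ne', one_mul, hP]
        have : 0 ≤ 1 / ((N : ℝ) + 1) * ‖x‖ := by positivity
        linarith
    _ ≤ η := by
        rw [← ENNReal.ofReal_coe_nnreal]
        apply ENNReal.ofReal_le_ofReal
        have h1 : (0 : ℝ) < η := by exact_mod_cast hη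
        have h2 : (n : ℝ) + 1 ≤ c * η := by rwa [hb, div_le_iff₀ h1] at hbc
        rw [← div_eq_mul_inv, div_le_iff₀ hc0]
        linarith

end AffineTorusAction

/-! ### Slow entropy: lower bound -/

/-- The Hamming covering number is attained. -/
theorem exists_card_eq_hammingCoverNumber {k N : ℕ} {X : Type*} [MeasurableSpace X]
    (μ : Measure X) [IsProbabilityMeasure μ] (φ : (Fin k → ℤ) → X → X) (ξ : X → Fin N)
    (F : Finset (Fin k → ℤ)) {ε δ : ℝ} (hε : 0 < ε) (hδ : 0 ≤ δ) :
    ∃ C : Finset X, C.card = hammingCoverNumber μ φ ξ (F : Set (Fin k → ℤ)) ε δ ∧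
      1 - δ ≤ μ.real (⋃ c ∈ C, {x | hammingDistOn φ ξ (F : Set (Fin k → ℤ)) c x < ε}) := by
  classical
  -- One representative for each realized code on F always covers. Nonemptiness matters because the
  -- infimum of the empty set of naturals is 0.
  have hne : {m : ℕ | ∃ C : Finset X, C.card = m ∧
      1 - δ ≤ μ.real
          (⋃ c ∈ C, {x | hammingDistOn φ ξ (F : Set (Fin k → ℤ)) c x < ε})}.Nonempty := by
    let code : X → F → Fin N := fun x z => ξ (φ z x)
    have hfin : (Set.range code).Finite := Set.toFinite _
    choose g hg using fun w : Set.range code => w.2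
    let C : Finset X := Finset.univ.image g
    refine ⟨C.card, C, rfl, ?_⟩
    have huniv : (⋃ c ∈ C, {x | hammingDistOn φ ξ (F : Set (Fin k → ℤ)) c x < ε}) = Set.univ := by
      refine Set.eq_univ_of_forall fun x => ?_
      refine Set.mem_iUnion₂.2 ⟨g ⟨code x, x, rfl⟩, Finset.mem_image_of_mem g (Finset.mem_univ _),
          ?_⟩
      have h1 := hg ⟨code x, x, rfl⟩
      have h2 : (F.filter fun z => ξ (φ z (g ⟨code x, x, rfl⟩)) ≠ ξ (φ z x)) = ∅ := by
        refine Finset.filter_eq_empty_iff.2 fun z hz => not_not.2 ?_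
        exact congrFun h1 ⟨z, hz⟩
      simp only [Set.mem_ofPred_eq]
      rw [hammingDistOn_coe, h2]
      simpa using hε
    rw [huniv]
    simp [hδ]
  exact Nat.sInf_mem hne

open Classical in
/-- If two points disagree rarely on `F`, they disagree rarely on some segment in `F`. -/
theorem exists_segment_card_le {k : ℕ} {F F' bad : Finset (Fin k → ℤ)} {z : Fin k → ℤ} {m : ℕ}
    (hF' : F'.Nonempty) (hsub : ∀ w ∈ F', ∀ j < m, w + j • z ∈ F) {κ : ℝ}
    (hbad : ((F.filter fun w => w ∈ bad).card : ℝ) ≤ κ * F'.card) :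
    ∃ w ∈ F', ((Finset.univ.filter fun j : Fin m => w + (j : ℕ) • z ∈ bad).card : ℝ) ≤ κ * m := by
  -- Double counting: for each j the translation by j z maps the bad starting points injectively
  -- into the bad points of F.
  have hsum : ∑ w ∈ F', ((Finset.univ.filter fun j : Fin m => w + (j : ℕ) • z ∈ bad).card : ℝ) ≤
      ∑ _w ∈ F', κ * m := by
    have h1 : ∑ w ∈ F', ((Finset.univ.filter fun j : Fin m => w + (j : ℕ) • z ∈ bad).card : ℝ) =
        ∑ j : Fin m, ((F'.filter fun w => w + (j : ℕ) • z ∈ bad).card : ℝ) := by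
      simp only [Finset.card_filter, Nat.cast_sum]
      exact Finset.sum_comm
    have h2 : ∀ j : Fin m, ((F'.filter fun w => w + (j : ℕ) • z ∈ bad).card : ℝ) ≤ κ * F'.card := by
      intro j
      refine le_trans ?_ hbad
      exact_mod_cast Finset.card_le_card_of_injOn (fun w => w + (j : ℕ) • z)
        (fun w hw => by
          have hw' := Finset.mem_filter.1 hw
          exact Finset.mem_coe.2 (Finset.mem_filter.2 ⟨hsub w hw'.1 j j.2, hw'.2⟩))
        (fun a _ b _ hab => add_right_cancel hab)
    rw [h1]
    calc _ ≤ ∑ _j : Fin m, κ * F'.card := Finset.sum_le_sum fun j _ => h2 j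
      _ = _ := by simp; ring
  exact Finset.exists_le_of_sum_le hF' hsum

namespace AffineTorusAction

variable {k n : ℕ} {α : AffineTorusAction k n} {χ : Fin n → Module.Dual ℝ (Fin k → ℝ)}

open Classical in
/-- The measure of a Hamming ball along a segment. -/
theorem volume_segment_hamming_le {N : ℕ} {Q : UnitAddTorus (Fin n) → Fin N} (hQm : Measurable Q)
    {z : Fin k → ℤ} {m : ℕ} {b κ : ℝ} (hκ : 0 < κ) (hκ1 : κ ≤ 1)
    (hcyl : ∀ v : Fin m → Fin N,
      (volume : Measure (UnitAddTorus (Fin n))).real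
        {x | ∀ i : Fin m, Q (α.act ((i : ℕ) • z) x) = v i} ≤ b)
    (w : Fin k → ℤ) (x : UnitAddTorus (Fin n)) :
    (volume : Measure (UnitAddTorus (Fin n))).real {y | ((Finset.univ.filter fun j : Fin m =>
      Q (α.act (w + (j : ℕ) • z) x) ≠ Q (α.act (w + (j : ℕ) • z) y)).card : ℝ) ≤ κ * m} ≤
      Real.exp (m * (Real.negMulLog κ + N * κ)) * b := by
  have hb : 0 ≤ b := by
    have : Nonempty (Fin m → Fin N) := ⟨fun _ => Q x⟩
    exact measureReal_nonneg.trans (hcyl (Classical.arbitrary _))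
  set f : UnitAddTorus (Fin n) → Fin m → Fin N := fun y j => Q (α.act ((j : ℕ) • z) y) with hf
  have hfm : Measurable f := measurable_pi_lambda _ fun j => hQm.comp (α.measurable_act _)
  set S := Finset.univ.filter fun v : Fin m → Fin N =>
    ((Finset.univ.filter fun j => v j ≠ f (α.act w x) j).card : ℝ) ≤ κ * m with hS
  have hact : ∀ (j : Fin m) y, α.act (w + (j : ℕ) • z) y = α.act ((j : ℕ) • z) (α.act w y) :=
    fun j y => by rw [add_comm, α.act_add]
  have hset : {y | ((Finset.univ.filter fun j : Fin m =>
      Q (α.act (w + (j : ℕ) • z) x) ≠ Q (α.act (w + (j : ℕ) • z) y)).card : ℝ) ≤ κ * m} =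
      α.act w ⁻¹' (f ⁻¹' (S : Set (Fin m → Fin N))) := by
    ext y
    simp only [Set.mem_ofPred_eq, Set.mem_preimage, Finset.mem_coe, hS, Finset.mem_filter,
      Finset.mem_univ, true_and, hf, hact]
    simp only [ne_comm]
  have hSm : MeasurableSet (f ⁻¹' (S : Set (Fin m → Fin N))) := hfm (Finset.measurableSet S)
  rw [hset, measureReal_def, (α.measurePreserving_act w).measure_preimage hSm.nullMeasurableSet,
    ← measureReal_def, ← sum_measureReal_preimage_singleton _
      (fun v _ => hfm (measurableSet_singleton v))]
  calc ∑ v ∈ S, (volume : Measure (UnitAddTorus (Fin n))).real (f ⁻¹' {v}) ≤ ∑ _v ∈ S, b := by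
        refine Finset.sum_le_sum fun v _ => le_trans (le_of_eq ?_) (hcyl v)
        congr 1
        ext y
        simp [hf, funext_iff]
    _ = S.card * b := by simp
    _ ≤ _ := mul_le_mul_of_nonneg_right (card_hamming_ball_le _ hκ hκ1) hb

/-- A lattice direction of large entropy relative to `p` bounds the slow entropy from below. -/
theorem IsExponentSystem.le_slowEntropyNorm (hχ : α.IsExponentSystem χ)
    {p : Seminorm ℝ (Fin k → ℝ)} (hp : IsNormOn p) {c₀ : ℝ} (hc₀ : 0 < c₀) {z : Fin k → ℤ} {q : ℕ}
    (hq : 0 < q) (hpz : p (latticeVec z) ≤ q)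
    (hGz : c₀ * q ≤ exponentSeminorm χ (latticeVec z)) :
    ENNReal.ofReal (3 / 8 * c₀) ≤ slowEntropyNorm volume α.act p := by
  classical
  set G := exponentSeminorm χ with hG
  have hq0 : (0 : ℝ) < q := by exact_mod_cast hq
  obtain ⟨L, hL1, hL⟩ := α.exists_mulVec_le_of_finite (Set.finite_singleton z)
  set r : ℝ := 1 / (2 * (L + 1)) with hr
  have hr0 : 0 < r := by positivity
  have hLr : (L + 1) * r < 1 := by
    have : (L + 1) * r = 1 / 2 := by rw [hr]; field_simp
    rw [this]; norm_num
  obtain ⟨N, Q, hQm, hQ⟩ := exists_torus_partition n hr0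
  refine le_trans ?_ (le_iSup_of_le N (le_iSup_of_le Q (le_iSup_of_le hQm le_rfl)))
  obtain ⟨M₀, hM₀, hdoub⟩ := hp.exists_card_latticeBall_le
  have hM₀' : (0 : ℝ) < M₀ := by exact_mod_cast hM₀
  -- Segments of m ≈ s/(2q) steps give the rate c₀/2. The Hamming ball count and the volume error
  -- each cost c₀ q/8 per step, hence c₀/16 each in the rate, leaving 3/8 c₀.
  have hcq : 0 < c₀ * q / 8 := by positivity
  obtain ⟨κ, hκ0, hκ1, hκ⟩ := exists_pos_negMulLog_add_le N hcq
  obtain ⟨ε', hε'0, hε'⟩ := exists_small_mul_le ‖latticeVec z‖ (norm_nonneg _) hcq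
  obtain ⟨C, hC0, hC⟩ := hχ.volume_le hε'0 hr0
  have hev : ∀ᶠ e : ℝ × ℝ in 𝓝[>] (0 : ℝ) ×ˢ 𝓝[>] (0 : ℝ),
      e.1 ∈ Set.Ioo 0 (κ / M₀) ∧ e.2 ∈ Set.Ioo (0 : ℝ) 1 :=
    Eventually.prod_mk (Ioo_mem_nhdsGT (by positivity)) (Ioo_mem_nhdsGT one_pos)
  refine le_limsup_of_frequently_le (Eventually.frequently ?_)
  filter_upwards [hev] with e ⟨he1, he2⟩
  refine ofReal_le_limsup_div tendsto_id fun ε hε => ?_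
  obtain ⟨K, hK⟩ := hp.exists_log_card_latticeBall_le (show 0 < 2 * ε by positivity)
  refine ⟨|Real.log (1 - e.2)| + K + |Real.log C| + G (latticeVec z) + c₀ * q, ?_⟩
  filter_upwards [eventually_ge_atTop (2 * q : ℝ)] with s hs
  have hs0 : 0 < s := lt_of_lt_of_le (by positivity) hs
  set m : ℕ := ⌊s / (2 * q)⌋₊ with hm
  have hm1 : (m : ℝ) ≤ s / (2 * q) := Nat.floor_le (by positivity)
  have hm2 : s / (2 * q) < m + 1 := Nat.lt_floor_add_one _
  have hm3 : 1 ≤ m := by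
    rw [hm, Nat.one_le_floor_iff, le_div_iff₀ (by positivity)]
    linarith
  have hmq : (m : ℝ) * q ≤ s / 2 := by
    rw [le_div_iff₀ (by positivity)] at hm1
    linarith
  obtain ⟨m', hm'⟩ := Nat.exists_eq_succ_of_ne_zero (by omega : m ≠ 0)
  have hfin := hp.finite_latticeBall s
  have hfin' := hp.finite_latticeBall (s / 2)
  set F := hfin.toFinset with hF
  set F' := hfin'.toFinset with hF'
  have hFmem : ∀ w, w ∈ F ↔ p (latticeVec w) ≤ s := fun w => hfin.mem_toFinset
  have hF'mem : ∀ w, w ∈ F' ↔ p (latticeVec w) ≤ s / 2 := fun w => hfin'.mem_toFinset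
  have hFcoe : latticeBall p s = (F : Set (Fin k → ℤ)) := hfin.coe_toFinset.symm
  have hF'ne : F'.Nonempty := ⟨0, hfin'.mem_toFinset.2 (zero_mem_latticeBall (by positivity))⟩
  have hF0 : (0 : ℝ) < F.card := by
    have : F.Nonempty := ⟨0, hfin.mem_toFinset.2 (zero_mem_latticeBall hs0.le)⟩
    exact_mod_cast this.card_pos
  have hF'0 : (0 : ℝ) < F'.card := by exact_mod_cast hF'ne.card_pos
  have hFF' : (F.card : ℝ) ≤ M₀ * F'.card := by
    have := hdoub s hs0
    rw [Set.ncard_eq_toFinset_card _ hfin, Set.ncard_eq_toFinset_card _ hfin'] at this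
    exact_mod_cast this
  have hsub : ∀ w ∈ F', ∀ j < m, w + j • z ∈ F := by
    intro w hw j hj
    rw [hF'mem] at hw
    rw [hFmem, latticeVec_add, latticeVec_nsmul]
    have h1 := map_add_le_add p (latticeVec w) ((j : ℝ) • latticeVec z)
    rw [map_smul_eq_mul, Real.norm_natCast] at h1
    have h2 : (j : ℝ) * p (latticeVec z) ≤ m * q :=
      mul_le_mul (by exact_mod_cast hj.le) hpz (apply_nonneg _ _) (Nat.cast_nonneg m)
    linarith
  set b : ℝ := C * Real.exp (-(m' * G (latticeVec z)) + ε' * (m' * ‖latticeVec z‖)) with hb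
  have hcyl : ∀ v : Fin m → Fin N, (volume : Measure (UnitAddTorus (Fin n))).real
      {x | ∀ i : Fin m, Q (α.act ((i : ℕ) • z) x) = v i} ≤ b := by
    rw [hm']
    intro v
    have h1 := α.volume_cylinder_le hQ hL1 hLr (fun j => j • z) (zero_smul _ _) (fun j u => by
      rw [succ_nsmul', α.isMatrixRep_linReal.add_mulVec]
      exact hL z rfl _) m' v
    have h2 := h1.trans (hC (m' • z))
    rw [latticeVec_nsmul, map_smul_eq_mul, norm_smul, Real.norm_natCast] at h2
    exact ENNReal.toReal_le_of_le_ofReal (by positivity) h2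
  set E : ℝ := Real.exp (m * (Real.negMulLog κ + N * κ)) with hE
  -- A Hamming ball on F lies in a union, over starting points in F', of Hamming balls along
  -- segments. The radius below κ/M₀ compensates for the doubling constant, and the factor |F'| is
  -- subexponential in s.
  have hball : ∀ x, (volume : Measure (UnitAddTorus (Fin n))).real
      {y | hammingDistOn α.act Q (F : Set (Fin k → ℤ)) x y < e.1} ≤ F'.card * (E * b) := by
    intro x
    have hcov : {y | hammingDistOn α.act Q (F : Set (Fin k → ℤ)) x y < e.1} ⊆
        ⋃ w ∈ F', {y | ((Finset.univ.filter fun j : Fin m =>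
          Q (α.act (w + (j : ℕ) • z) x) ≠ Q (α.act (w + (j : ℕ) • z) y)).card : ℝ) ≤ κ * m} := by
      intro y hy
      simp only [Set.mem_ofPred_eq] at hy
      rw [hammingDistOn_coe, div_lt_iff₀ hF0] at hy
      have hle : e.1 * F.card ≤ κ * F'.card := by
        have h1 : e.1 * M₀ ≤ κ := by
          have := he1.2.le
          rwa [le_div_iff₀ hM₀'] at this
        calc e.1 * F.card ≤ e.1 * (M₀ * F'.card) := mul_le_mul_of_nonneg_left hFF' he1.1.le
          _ = e.1 * M₀ * F'.card := by ring
          _ ≤ _ := mul_le_mul_of_nonneg_right h1 hF'0.le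
      obtain ⟨w, hw, hwc⟩ := exists_segment_card_le (F := F) (F' := F')
        (bad := F.filter fun w => Q (α.act w x) ≠ Q (α.act w y)) hF'ne hsub (κ := κ) (by
          have : (F.filter fun w => w ∈ F.filter fun w => Q (α.act w x) ≠ Q (α.act w y)) =
              F.filter fun w => Q (α.act w x) ≠ Q (α.act w y) := by
            ext w; simp
          rw [this]
          linarith)
      refine Set.mem_iUnion₂.2 ⟨w, hw, ?_⟩
      refine le_trans (le_of_eq ?_) hwc
      congr 2
      ext j
      simp only [Finset.mem_filter, Finset.mem_univ, true_and, hsub w hw j j.2]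
    calc _ ≤ _ := measureReal_mono hcov (measure_ne_top _ _)
      _ ≤ ∑ w ∈ F', _ := measureReal_biUnion_finset_le _ _
      _ ≤ ∑ _w ∈ F', E * b := Finset.sum_le_sum fun w _ =>
        volume_segment_hamming_le hQm hκ0 hκ1 hcyl w x
      _ = _ := by simp
  obtain ⟨S, hScard, hS⟩ := exists_card_eq_hammingCoverNumber
    (volume : Measure (UnitAddTorus (Fin n))) α.act Q F he1.1 he2.1.le
  rw [hFcoe, ← hScard]
  have htot : 1 - e.2 ≤ S.card * (F'.card * (E * b)) := by
    refine hS.trans ((measureReal_biUnion_finset_le _ _).trans ?_)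
    calc _ ≤ ∑ _c ∈ S, (F'.card : ℝ) * (E * b) := Finset.sum_le_sum fun c _ => hball c
      _ = _ := by simp
  have h1e : 0 < 1 - e.2 := by linarith [he2.2]
  have hb0 : 0 < b := by positivity
  have hE0 : 0 < E := Real.exp_pos _
  have hS0 : (0 : ℝ) < S.card := by
    refine lt_of_le_of_ne (Nat.cast_nonneg _) fun h => ?_
    rw [← h, zero_mul] at htot
    linarith
  have hlog := Real.log_le_log h1e htot
  rw [Real.log_mul hS0.ne' (mul_pos hF'0 (mul_pos hE0 hb0)).ne',
    Real.log_mul hF'0.ne' (mul_pos hE0 hb0).ne',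
    Real.log_mul hE0.ne' hb0.ne', hE, Real.log_exp, hb, Real.log_mul hC0.ne' (Real.exp_pos _).ne',
    Real.log_exp] at hlog
  have hF'log : Real.log F'.card ≤ K + ε * s := by
    have := hK (s / 2) (by positivity)
    rw [Set.ncard_eq_toFinset_card _ hfin'] at this
    calc _ ≤ _ := this
      _ = _ := by ring
  have hmm' : (m : ℝ) = m' + 1 := by rw [hm']; push_cast; ring
  have t1 : (m : ℝ) * (Real.negMulLog κ + N * κ) ≤ m * (c₀ * q / 8) :=
    mul_le_mul_of_nonneg_left (hκ κ hκ0 le_rfl) (Nat.cast_nonneg m)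
  have t2 : (m' : ℝ) * (ε' * ‖latticeVec z‖) ≤ m' * (c₀ * q / 8) :=
    mul_le_mul_of_nonneg_left hε' (Nat.cast_nonneg m')
  have t3 : (m : ℝ) * (c₀ * q) ≤ m * G (latticeVec z) :=
    mul_le_mul_of_nonneg_left hGz (Nat.cast_nonneg m)
  have t4 : s * c₀ / 2 ≤ (m + 1) * (c₀ * q) := by
    rw [div_lt_iff₀ (by positivity)] at hm2
    have := mul_le_mul_of_nonneg_right hm2.le hc₀.le
    linarith
  have t5 := neg_abs_le (Real.log (1 - e.2))
  have t6 := le_abs_self (Real.log C)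
  have t7 : (m' : ℝ) * G (latticeVec z) = m * G (latticeVec z) - G (latticeVec z) := by
    rw [hmm']; ring
  have t8 : (m' : ℝ) * (c₀ * q / 8) ≤ m * (c₀ * q / 8) := by
    rw [hmm']
    linarith
  linarith

end AffineTorusAction

/-! ### Positivity of the slow entropy and the equivalences. -/

namespace AffineTorusAction

variable {k n : ℕ} {α : AffineTorusAction k n} {χ : Fin n → Module.Dual ℝ (Fin k → ℝ)}

/-- If the exponents have no common kernel, the slow entropy is positive. -/
theorem IsExponentSystem.slowEntropy_ne_zero (hχ : α.IsExponentSystem χ) (hk : 1 ≤ k)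
    (hG : IsNormOn (exponentSeminorm χ)) : slowEntropy volume α.act ≠ 0 := by
  set G := exponentSeminorm χ with hGdef
  set V := (volume {x | G x ≤ 1}).toReal with hV
  have hVfin : volume {x | G x ≤ 1} ≠ ∞ := hG.isCompact_unitBall.measure_lt_top.ne
  have hV0 : 0 < V := ENNReal.toReal_pos G.volume_ball_pos.ne' hVfin
  -- The set G ≤ c₀ then has volume below 1 (using k ≥ 1), so it cannot contain a p-ball of volume
  -- one, whatever p is.
  set c₀ : ℝ := min 1 (1 / (2 * V)) with hc₀
  have hc₀0 : 0 < c₀ := by positivity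
  have hc₀V : c₀ ^ k * V < 1 := by
    have h1 : c₀ ^ k ≤ c₀ := by
      have := pow_le_pow_of_le_one hc₀0.le (min_le_left _ _) hk
      rwa [pow_one] at this
    have h2 : c₀ * (2 * V) ≤ 1 := by
      have := min_le_right 1 (1 / (2 * V))
      rwa [le_div_iff₀ (by positivity)] at this
    nlinarith
  have hlow : ENNReal.ofReal (3 / 8 * c₀) ≤ slowEntropy volume α.act := by
    refine le_iInf fun p => le_iInf fun hp => le_iInf fun hvol => ?_
    have hex : ∃ t, p t ≤ 1 ∧ c₀ < G t := by
      by_contra! hno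
      have h1 : volume {x | p x ≤ 1} ≤ volume {x | G x ≤ c₀} := measure_mono fun x hx => hno x hx
      rw [hvol, G.volume_le_scale hc₀0, ← ENNReal.ofReal_toReal hVfin,
        ← ENNReal.ofReal_mul (by positivity), ← hV, ENNReal.one_le_ofReal] at h1
      linarith
    obtain ⟨t, hpt, hGt⟩ := hex
    -- Shrinking t by a < 1, with a G(t) midway between c₀ and G(t), leaves room in both
    -- inequalities; for large q this room exceeds the bounded error of rounding q a t to the
    -- lattice.
    set a : ℝ := (c₀ + G t) / (2 * G t) with ha
    have hGt0 : 0 < G t := hc₀0.trans hGt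
    have ha0 : 0 < a := by positivity
    have ha1 : a < 1 := by rw [ha, div_lt_one (by positivity)]; linarith
    have haG : c₀ < a * G t := by
      have : a * G t = (c₀ + G t) / 2 := by rw [ha]; field_simp
      rw [this]; linarith
    obtain ⟨Cp, hCp0, hCp⟩ := p.exists_le_mul_norm
    obtain ⟨CG, hCG0, hCG⟩ := G.exists_le_mul_norm
    obtain ⟨q, hq⟩ := exists_nat_gt (max (Cp / (1 - a)) (CG / (a * G t - c₀)))
    have hq1 := (le_max_left _ _).trans_lt hq
    have hq2 := (le_max_right _ _).trans_lt hq
    rw [div_lt_iff₀ (by linarith)] at hq1 hq2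
    have hq0 : (0 : ℝ) < q := pos_of_mul_pos_left (hCp0.trans hq1) (by linarith)
    set t' := ((q : ℝ) * a) • t with ht'
    have hd : ‖latticeVec (floorVec t') - t'‖ ≤ 1 := by
      have := norm_latticeVec_floorVec_sub_le (s := 0) (t := t') (fun i => by simp)
      rwa [zero_add] at this
    have hpt' : p t' = q * a * p t := by
      rw [ht', map_smul_eq_mul, Real.norm_eq_abs, abs_of_pos (by positivity)]
    have hGt' : G t' = q * a * G t := by
      rw [ht', map_smul_eq_mul, Real.norm_eq_abs, abs_of_pos (by positivity)]
    refine hχ.le_slowEntropyNorm hp hc₀0 (z := floorVec t') (q := q) (by exact_mod_cast hq0) ?_ ?_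
    · have h1 := (_root_.abs_le.1 (abs_sub_map_le_sub p (latticeVec (floorVec t')) t')).2
      have h2 := hCp (latticeVec (floorVec t') - t')
      have h3 : Cp * ‖latticeVec (floorVec t') - t'‖ ≤ Cp := mul_le_of_le_one_right hCp0.le hd
      have h4 : (q : ℝ) * a * p t ≤ q * a := mul_le_of_le_one_right (by positivity) hpt
      linarith
    · have h1 := (_root_.abs_le.1 (abs_sub_map_le_sub G (latticeVec (floorVec t')) t')).1
      have h2 := hCG (latticeVec (floorVec t') - t')
      have h3 : CG * ‖latticeVec (floorVec t') - t'‖ ≤ CG := mul_le_of_le_one_right hCG0.le hd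
      linarith
  intro h0
  rw [h0, nonpos_iff_eq_zero, ENNReal.ofReal_eq_zero] at hlow
  linarith

/-- The χ_j are themselves exponents, so a common vector is a zero of G; conversely |ψ| ≤ 2G puts
each zero of G in every hyperplane. -/
theorem IsExponentSystem.exists_mem_lyapunovHyperplanes_iff (hχ : α.IsExponentSystem χ) :
    (∃ t : Fin k → ℝ, t ≠ 0 ∧ ∀ H ∈ α.lyapunovHyperplanes, t ∈ H) ↔
      ¬ IsNormOn (exponentSeminorm χ) := by
  simp only [IsNormOn, not_forall]
  constructor
  · rintro ⟨t, ht, hH⟩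
    refine ⟨t, exponentSeminorm_eq_zero_iff.2 fun j => ?_, ht⟩
    exact hH _ ⟨χ j, hχ.isLyapunovExponent j, rfl⟩
  · rintro ⟨t, hGt, ht⟩
    refine ⟨t, ht, ?_⟩
    rintro H ⟨ψ, hψ, rfl⟩
    have h1 := hχ.abs_le ψ hψ t
    rw [hGt, mul_zero] at h1
    exact abs_nonpos_iff.1 h1

theorem IsExponentSystem.entropyFunctionIsNorm_iff (hχ : α.IsExponentSystem χ) :
    α.EntropyFunctionIsNorm ↔ IsNormOn (exponentSeminorm χ) := by
  constructor
  · rintro ⟨p, hp, h⟩ t ht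
    apply hp
    have h1 := h t
    rw [hχ.entropyFunction_eq, ENNReal.ofReal_eq_ofReal_iff (apply_nonneg _ _)
      (apply_nonneg _ _)] at h1
    rw [← h1, ht]
  · exact fun h => ⟨exponentSeminorm χ, h, hχ.entropyFunction_eq⟩

/-- The numerator is nonzero, so the quotient vanishes exactly when the unit ball of G has infinite
volume. -/
theorem IsExponentSystem.friedEntropy_eq_zero_iff (hχ : α.IsExponentSystem χ) :
    α.friedEntropy = 0 ↔ ¬ IsNormOn (exponentSeminorm χ) := by
  have hset : {t : Fin k → ℝ | α.entropyFunction t ≤ 1} = {t | exponentSeminorm χ t ≤ 1} := by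
    ext t
    simp only [Set.mem_ofPred_eq, hχ.entropyFunction_eq, ENNReal.ofReal_le_one]
  have hne : (2 : ℝ≥0∞) ^ k / (k.factorial : ℝ≥0∞) ≠ 0 :=
    ENNReal.div_ne_zero.2 ⟨pow_ne_zero _ two_ne_zero, ENNReal.natCast_ne_top _⟩
  rw [friedEntropy, ENNReal.div_eq_zero_iff, or_iff_right hne, hset]
  constructor
  · exact fun h hn => hn.isCompact_unitBall.measure_lt_top.ne h
  · intro hn
    simp only [IsNormOn, not_forall] at hn
    obtain ⟨t, hGt, ht⟩ := hn
    refine top_unique ?_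
    rw [← (exponentSeminorm χ).volume_ball_eq_top ht hGt]
    exact measure_mono fun x (hx : exponentSeminorm χ x < 1) => hx.le

theorem IsExponentSystem.slowEntropy_eq_zero_iff (hχ : α.IsExponentSystem χ) (hk : 1 ≤ k) :
    slowEntropy volume α.act = 0 ↔ ¬ IsNormOn (exponentSeminorm χ) := by
  constructor
  · exact fun h hn => hχ.slowEntropy_ne_zero hk hn h
  · intro hn
    simp only [IsNormOn, not_forall] at hn
    obtain ⟨t, hGt, ht⟩ := hn
    exact hχ.slowEntropy_eq_zero hk ht hGt

end AffineTorusAction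

theorem proposition4p3 (k n : ℕ) (hk : 1 ≤ k) (α : AffineTorusAction k n) :
    (slowEntropy (volume : Measure (UnitAddTorus (Fin n))) α.act = 0 ↔
      ∃ t : Fin k → ℝ, t ≠ 0 ∧ ∀ H ∈ α.lyapunovHyperplanes, t ∈ H) ∧
    ((∃ t : Fin k → ℝ, t ≠ 0 ∧ ∀ H ∈ α.lyapunovHyperplanes, t ∈ H) ↔
      ¬ α.EntropyFunctionIsNorm) ∧
    (¬ α.EntropyFunctionIsNorm ↔ α.friedEntropy = 0) := by
  obtain ⟨χ, hχ⟩ := α.exists_isExponentSystem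
  rw [hχ.slowEntropy_eq_zero_iff hk, hχ.exists_mem_lyapunovHyperplanes_iff,
    hχ.entropyFunctionIsNorm_iff, hχ.friedEntropy_eq_zero_iff]
  exact ⟨Iff.rfl, Iff.rfl, Iff.rfl⟩
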